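/- Let $K$ be a field with a product formula: a family $(|\cdot|_v)_{v\in M_K}$ of absolute values on $K$ and positive reals $(n_v)_{v \in M_K}$ such that all but finitely many $|\cdot|_v$ are non-archimedean; every $|\cdot|_v$ that is not non-archimedean is induced by an embedding $K\hookrightarrow\mathbb{C}$; and for every $x\in K^*$ one has $|x|_v=1$ for all but finitely many $v$ and $\prod_{v\in M_K}|x|_v^{n_v}=1$. For $v\in M_K$ let $K_v$ be the completion of $K$ at $v$ and let $\mathbb{C}_v$ be the completion of an algebraic closure of $K_v$, with the unique extension of $|\cdot|_v$. Fix an algebraic closure $\overline K$ of $K$ and $K$-embeddings $\overline K\hookrightarrow\mathbb{C}_v$ for all $v\in M_K$. A subset of $\overline K$ is Galois-stable if it is mapped into itself by every $K$-automorphism of $\overline K$. For a finite Galois-stable set $S\subset\overline K$ put $$h(S)=\frac1{\#S}\sum_{z\in S}\sum_{v\in M_K} n_v\log^+|z|_v ,$$ and for $\alpha\in\overline K$ let $h(\alpha)$ be $h$ of the set of conjugates of $\alpha$ over $K$. Assume the Northcott finiteness property: for every integer $d\ge1$ and real $M>0$ there are only finitely many $\alpha\in\overline K$ of degree at most $d$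 over $K$ with $h(\alpha)\le M$. Let $\phi\in K[z]$ be a polynomial of degree $d\ge2$, and for a finite Galois-stable set $S\subset\overline K$ put $$\hat h_\phi(S)=\lim_{n\to\infty}\frac1{d^n}\cdot\frac1{\#S}\sum_{z\in S}\sum_{v\in M_K}n_v\log^+|\phi^n(z)|_v ,$$ where $\phi^n$ is the $n$-th iterate of $\phi$. Fix a place $v\in M_K$, let $F=\{z\in\mathbb{C}_v: |\phi^n(z)|_v\not\to\infty\}$ be the $v$-adic filled Julia set of $\phi$, and assume that $F$ is compact. Let $(S_n)$ be a sequence of distinct finite Galois-stable subsets of $\overline K$ such that $\lim_{n\to\infty}\hat h_\phi(S_n)=0$. Then $(S_n)$ is equidistributed with respect to the equilibrium measure $\mu_F$ of $F$. That is, there is a unique Borel probability measure $\mu_F$ on $\mathbb{C}_v$ supported on $F$ that minimizes the energy $\iint-\log|x-y|_v\,d\mu(x)\,d\mu(y)$ among all Borel probability measures $\mu$ supported on $F$, and for every bounded continuous function $f:\mathbb{C}_v\to\mathbb{R}$, $$\lim_{n\to\infty}\frac1{\#S_n}\sum_{z\in S_n}f(z)=\int f\,d\mu_F .$$ -/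

import Mathlib

open Filter Topology MeasureTheory Polynomial
open scoped ENNReal BoundedContinuousFunction

noncomputable section

universe u w

/-! ### Extending absolute values to the algebraic closure of the completion -/

/-- A nonarchimedean absolute value of a field `K` extends from the completion of `K` to the
algebraic closure of that completion. -/
theorem AbsoluteValue.exists_extension_of_isNonarchimedean {K : Type u} [Field K]
    (a : AbsoluteValue K ℝ) (ha : IsNonarchimedean a) :
    ∃ b : AbsoluteValue (AlgebraicClosure a.Completion) ℝ,
      ∀ x : a.Completion, b (algebraMap a.Completion (AlgebraicClosure a.Completion) x) = ‖x‖ := by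
  classical
  have hnorm : ∀ x y : a.Completion, ‖x + y‖ ≤ max ‖x‖ ‖y‖ := by
    intro x y
    induction x, y using UniformSpace.Completion.induction_on₂ with
    | hp => exact isClosed_le (by fun_prop) (by fun_prop)
    | ih x y =>
      rw [← UniformSpace.Completion.coe_add]
      simp only [UniformSpace.Completion.norm_coe, WithAbs.norm_eq_apply_ofAbs]
      exact ha _ _
  have hu : IsUltrametricDist a.Completion :=
    IsUltrametricDist.isUltrametricDist_of_forall_norm_add_le_max_norm hnorm
  by_cases ht : ∃ x : a.Completion, 1 < ‖x‖
  · letI : NontriviallyNormedField a.Completion :=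
      { (inferInstance : NormedField a.Completion) with non_trivial := ht }
    let := spectralNorm.normedField a.Completion (AlgebraicClosure a.Completion)
    refine ⟨NormedField.toAbsoluteValue (AlgebraicClosure a.Completion), fun x => ?_⟩
    exact spectralNorm_extends x
  · push Not at ht
    refine ⟨AbsoluteValue.trivial, fun x => ?_⟩
    by_cases hx : x = 0
    · simp [hx]
    · have h1 := ht x
      have h2 := ht x⁻¹
      rw [norm_inv] at h2
      have h3 : 1 ≤ ‖x‖ := by
        by_contra h
        exact absurd h2 (not_le.mpr ((one_lt_inv₀ (norm_pos_iff.mpr hx)).mpr (not_le.mp h)))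
      rw [AbsoluteValue.trivial_apply (by simpa using hx)]
      exact le_antisymm h3 h1

/-- An absolute value induced by an embedding into `ℂ` extends from the completion of `K` to the
algebraic closure of that completion. -/
theorem AbsoluteValue.exists_extension_of_embedding {K : Type u} [Field K]
    (a : AbsoluteValue K ℝ) (σ : K →+* ℂ) (hσ : ∀ x, a x = ‖σ x‖) :
    ∃ b : AbsoluteValue (AlgebraicClosure a.Completion) ℝ,
      ∀ x : a.Completion, b (algebraMap a.Completion (AlgebraicClosure a.Completion) x) = ‖x‖ := by
  let f : WithAbs a →+* ℂ := σ.comp (WithAbs.equiv a).toRingHom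
  have hf : Isometry f := by
    refine AddMonoidHomClass.isometry_of_norm f fun x => ?_
    rw [WithAbs.norm_eq_apply_ofAbs, hσ]
    rfl
  let g : a.Completion →+* ℂ := UniformSpace.Completion.extensionHom f hf.continuous
  have hg : Isometry g := hf.completion_extension
  let : Algebra a.Completion ℂ := g.toAlgebra
  let l : AlgebraicClosure a.Completion →ₐ[a.Completion] ℂ := IsAlgClosed.lift
  refine ⟨(NormedField.toAbsoluteValue ℂ).comp (f := l.toRingHom) l.injective, fun x => ?_⟩
  have h1 : l (algebraMap a.Completion (AlgebraicClosure a.Completion) x) = g x := l.commutes x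
  change ‖l (algebraMap a.Completion (AlgebraicClosure a.Completion) x)‖ = ‖x‖
  rw [h1]
  simpa using hg.dist_eq x 0

/-! ### Fields with a product formula -/

/-- A product formula structure on a field `K`: a family of absolute values `|·|_v`, indexed by a
type `Place`, with positive real weights `n_v`. -/
structure ProductFormulaField (K : Type u) [Field K] (Place : Type w) where
  /-- the absolute value `|·|_v` -/
  abv : Place → AbsoluteValue K ℝ
  /-- the weight `n_v` -/
  weight : Place → ℝ
  weight_pos : ∀ v, 0 < weight v
  finite_archimedean : {v | ¬ IsNonarchimedean (abv v)}.Finite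
  archimedean_embedding :
    ∀ v, ¬ IsNonarchimedean (abv v) → ∃ σ : K →+* ℂ, ∀ x, abv v x = ‖σ x‖
  finite_ne_one : ∀ x : K, x ≠ 0 → {v | abv v x ≠ 1}.Finite
  product_formula : ∀ x : K, x ≠ 0 → ∏ᶠ v, (abv v x) ^ (weight v) = 1

namespace ProductFormulaField

variable {K : Type u} [Field K] {Place : Type w} (P : ProductFormulaField K Place)

theorem exists_extension (v : Place) :
    ∃ b : AbsoluteValue (AlgebraicClosure (P.abv v).Completion) ℝ,
      ∀ x : (P.abv v).Completion,
        b (algebraMap (P.abv v).Completion (AlgebraicClosure (P.abv v).Completion) x) = ‖x‖ := by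
  by_cases h : IsNonarchimedean (P.abv v)
  · exact (P.abv v).exists_extension_of_isNonarchimedean h
  · obtain ⟨σ, hσ⟩ := P.archimedean_embedding v h
    exact (P.abv v).exists_extension_of_embedding σ hσ

/-- The (unique) extension of `|·|_v` from `K_v` to the algebraic closure of `K_v`. -/
def extAbv (v : Place) : AbsoluteValue (AlgebraicClosure (P.abv v).Completion) ℝ :=
  (P.exists_extension v).choose

theorem extAbv_algebraMap (v : Place) (x : (P.abv v).Completion) :
    P.extAbv v (algebraMap (P.abv v).Completion (AlgebraicClosure (P.abv v).Completion) x) = ‖x‖ :=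
  (P.exists_extension v).choose_spec x

/-- The field `ℂ_v`: the completion of the algebraic closure of the completion `K_v` of `K`. -/
abbrev Cv (v : Place) : Type u := (P.extAbv v).Completion

instance instMeasurableSpaceCv (v : Place) : MeasurableSpace (P.Cv v) := borel _

instance instBorelSpaceCv (v : Place) : BorelSpace (P.Cv v) := ⟨rfl⟩

/-- The absolute value of `ℂ_v` extends the absolute value `|·|_v` of `K`. -/
theorem norm_algebraMap_Cv (v : Place) (x : K) : ‖algebraMap K (P.Cv v) x‖ = P.abv v x := by
  have h : algebraMap K (P.Cv v) x =
      ((WithAbs.toAbs (P.extAbv v) (algebraMap (P.abv v).Completion _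
        ((WithAbs.toAbs (P.abv v) x : WithAbs (P.abv v)) : (P.abv v).Completion)) :
          WithAbs (P.extAbv v)) : P.Cv v) := rfl
  rw [h, UniformSpace.Completion.norm_coe, WithAbs.norm_eq_apply_ofAbs,
    WithAbs.ofAbs_toAbs, extAbv_algebraMap, UniformSpace.Completion.norm_coe,
    WithAbs.norm_eq_apply_ofAbs, WithAbs.ofAbs_toAbs]

/-- Embeddings of the algebraic closure of `K` into `ℂ_v` exist. -/
theorem nonempty_embedding (v : Place) : Nonempty (AlgebraicClosure K →ₐ[K] P.Cv v) := by
  let f : AlgebraicClosure K →ₐ[K] AlgebraicClosure (P.abv v).Completion := IsAlgClosed.lift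
  let g : AlgebraicClosure (P.abv v).Completion →+* P.Cv v :=
    UniformSpace.Completion.coeRingHom.comp (WithAbs.equiv (P.extAbv v)).symm.toRingHom
  refine ⟨⟨g.comp f.toRingHom, fun x => ?_⟩⟩
  change g (f (algebraMap K _ x)) = _
  rw [f.commutes]
  rfl

end ProductFormulaField

/-! ### Galois-stable sets -/

/-- A finite subset of the algebraic closure of `K` is Galois-stable. -/
def IsGaloisStable (K : Type u) [Field K] (S : Finset (AlgebraicClosure K)) : Prop :=
  ∀ σ : AlgebraicClosure K ≃ₐ[K] AlgebraicClosure K, ∀ z ∈ S, σ z ∈ S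

theorem finite_galoisOrbits {K : Type u} [Field K] (T : Finset (AlgebraicClosure K)) :
    {z : AlgebraicClosure K |
      ∃ t ∈ T, ∃ σ : AlgebraicClosure K ≃ₐ[K] AlgebraicClosure K, σ t = z}.Finite := by
  have h : (⋃ t ∈ T, (minpoly K t).rootSet (AlgebraicClosure K)).Finite :=
    T.finite_toSet.biUnion fun t _ => Polynomial.rootSet_finite _ _
  refine h.subset ?_
  rintro z ⟨t, ht, σ, rfl⟩
  refine Set.mem_biUnion ht ?_
  rw [Polynomial.mem_rootSet_of_ne (minpoly.ne_zero (Algebra.IsIntegral.isIntegral t))]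
  have := congrArg σ (minpoly.aeval K t)
  rwa [map_zero, ← AlgEquiv.coe_toAlgHom, ← Polynomial.aeval_algHom_apply] at this

/-- The smallest Galois-stable subset containing `T`. -/
def galoisHull {K : Type u} [Field K] (T : Finset (AlgebraicClosure K)) :
    Finset (AlgebraicClosure K) :=
  (finite_galoisOrbits T).toFinset

/-! ### Heights and filled Julia sets -/

namespace ProductFormulaField

variable {K : Type u} [Field K] {Place : Type w} (P : ProductFormulaField K Place)
  (ι : ∀ v, AlgebraicClosure K →ₐ[K] P.Cv v)

/-- The sum over all places `v` of `n_v * log⁺ |z|_v`, for fixed embeddings of the algebraic closure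
of `K` into the fields `ℂ_v`. -/
def sumLocalHeights (z : AlgebraicClosure K) : ℝ :=
  ∑ᶠ v, P.weight v * Real.posLog ‖ι v z‖

/-- The absolute logarithmic height of a finite set `T`: the average of the local heights over the
smallest Galois-stable set containing `T`. -/
def height (T : Finset (AlgebraicClosure K)) : ℝ :=
  ((galoisHull T).card : ℝ)⁻¹ * ∑ z ∈ galoisHull T, P.sumLocalHeights ι z

/-- The Northcott finiteness property. -/
def Northcott : Prop :=
  ∀ d : ℕ, 1 ≤ d → ∀ M : ℝ, 0 < M →
    {α : AlgebraicClosure K | (minpoly K α).natDegree ≤ d ∧ P.height ι {α} ≤ M}.Finite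

/-- The canonical height of a finite set `T`, where `T` is first replaced by the smallest
Galois-stable set containing it. The images under the iterates of `φ` are counted with
multiplicity, so this is the average of the canonical heights of the points. -/
def canonicalHeight (φ : K[X]) (T : Finset (AlgebraicClosure K)) : ℝ :=
  limUnder atTop fun n : ℕ =>
    ((φ.natDegree : ℝ) ^ n)⁻¹ * (((galoisHull T).card : ℝ)⁻¹ *
      ∑ z ∈ galoisHull T, P.sumLocalHeights ι ((fun y => aeval y φ)^[n] z))

/-- The `v`-adic filled Julia set of `φ`. -/
def filledJulia (φ : K[X]) (v : Place) : Set (P.Cv v) :=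
  {z | ¬ Tendsto (fun n : ℕ => ‖(fun y => aeval y φ)^[n] z‖) atTop atTop}

end ProductFormulaField

/-! ### Equilibrium measures and equidistribution -/

section Measures

variable {X : Type u} [MetricSpace X] [MeasurableSpace X]

/-- `-log d(x, y)`, equal to `⊤` on the diagonal. -/
def logKernel (x y : X) : EReal := -ENNReal.log (edist x y)

/-- The energy `∫∫ -log d(x, y) dμ(x) dμ(y)`, as the integral of the positive part minus the
integral of the negative part. The negative part is finite for finite measures with bounded
support. -/
def energy (μ : Measure X) : EReal :=
  ((∫⁻ x, ∫⁻ y, (logKernel x y).toENNReal ∂μ ∂μ : ℝ≥0∞) : EReal) -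
    ((∫⁻ x, ∫⁻ y, (-logKernel x y).toENNReal ∂μ ∂μ : ℝ≥0∞) : EReal)

/-- `μ` is a probability measure supported on `F` and has minimal energy among all of these. -/
def IsEquilibriumMeasure (F : Set X) (μ : Measure X) : Prop :=
  IsProbabilityMeasure μ ∧ μ Fᶜ = 0 ∧
    ∀ ν : Measure X, IsProbabilityMeasure ν → ν Fᶜ = 0 → energy μ ≤ energy ν

/-- The uniform probability measure on a finite set of points. -/
def uniformDirac (T : Finset X) : Measure X := (T.card : ℝ≥0∞)⁻¹ • ∑ z ∈ T, Measure.dirac z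

/-- The uniform measures on the finite sets `T n` converge weakly to `μ`. -/
def IsEquidistributed (T : ℕ → Finset X) (μ : Measure X) : Prop :=
  ∀ f : X →ᵇ ℝ, Tendsto (fun n => ∫ x, f x ∂(uniformDirac (T n))) atTop (𝓝 (∫ x, f x ∂μ))

end Measures

end

/-! The proof compares a global identity with local inequalities. At each place w let g_w be the
Green function of φ (the escape rate of log⁺|·|_w), which vanishes exactly on the filled Julia set,
and let V_w = log|a|_w/(d-1), with a the leading coefficient, be the Robin constant. The canonical
height of S is the average over S of ∑ n_w g_w.

Local input (`Polynomial.exists_prod_norm_sub_le`): for N points at any place, ∑_{x≠y} log|x-y|_w ≤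
2N ∑ g_w(x) - V_w N² + o(N²). The left side is twice the logarithm of a Vandermonde determinant.
Monomials may be replaced there by monic polynomials built from iterates of φ, whose size is
controlled by g_w and V_w. At places of good reduction V_w = 0 and there is no error term.

Global input: for Galois-stable S the product of all differences is Galois-invariant, so a power of
it lies in K up to sign, and the product formula makes the weighted sum of its log|·|_w vanish. The
product formula for a gives ∑ n_w V_w = 0. Bounding every place other than v by the local input
leaves -∑_{x≠y} log|x-y|_v ≤ (V_v + 2h/n_v + ε)N² + A, where h is the canonical height of S
(`exists_discreteEnergy_le`). With h → 0 and N → ∞, the discrete energy is asymptotically at most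
V_v.

Conversely every probability measure on F has energy at least V_v: integrate the local input over
independent random points (`le_logEnergy`). Since h → 0 the average of g_v tends to 0, and points
with small g_v lie near F, so S_n may be projected to F. Weak limits of the projected measures have
energy at most V_v, hence are minimizers. The logarithmic energy is strictly convex, so the
minimizer is unique and the whole sequence converges.

That points with small g_v lie near F follows from local compactness at an archimedean place. At a
non-archimedean place its failure would put a closed ball inside F, which compactness of F forbids.

That N → ∞ also uses compactness of F. Otherwise infinitely many S_n have bounded size and small
height. Applied to unions of two of them, the discrete energy bound separates all their points
uniformly, while these points lie near F. So only finitely many points, and finitely many sets,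
occur. -/

noncomputable section

universe u w

/-! ### Escape rates -/

/-- The limit of `h (T^n x) / d^n`. -/
def escapeRate {X : Type*} (T : X → X) (h : X → ℝ) (d : ℝ) (x : X) : ℝ :=
  limUnder atTop fun n : ℕ => (d ^ n)⁻¹ * h (T^[n] x)

section escapeRate

variable {X : Type*} {T : X → X} {h : X → ℝ} {d C : ℝ}

/-- Consecutive terms differ by d^{-(n+1)} times the defect of the functional equation. The bound is
written as C/2/2^n, whose sum over n is C, so the limit is within C of h itself. -/
theorem dist_escapeRate_step (hd : 2 ≤ d) (hC : ∀ x, |h (T x) - d * h x| ≤ C) (x : X) (n : ℕ) :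
    dist ((d ^ n)⁻¹ * h (T^[n] x)) ((d ^ (n + 1))⁻¹ * h (T^[n + 1] x)) ≤ C / 2 / 2 ^ n := by
  have hd0 : 0 < d := by linarith
  have hC0 : 0 ≤ C := (abs_nonneg _).trans (hC x)
  have h1 : (d ^ n)⁻¹ * h (T^[n] x) - (d ^ (n + 1))⁻¹ * h (T^[n + 1] x) =
      -((d ^ (n + 1))⁻¹ * (h (T (T^[n] x)) - d * h (T^[n] x))) := by
    rw [Function.iterate_succ_apply']
    field_simp
    ring
  rw [Real.dist_eq, h1, abs_neg, abs_mul, abs_of_pos (by positivity)]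
  calc (d ^ (n + 1))⁻¹ * |h (T (T^[n] x)) - d * h (T^[n] x)|
      ≤ (2 ^ (n + 1))⁻¹ * C := by
        gcongr
        exact hC _
    _ = C / 2 / 2 ^ n := by field_simp; ring

theorem tendsto_escapeRate (hd : 2 ≤ d) (hC : ∀ x, |h (T x) - d * h x| ≤ C) (x : X) :
    Tendsto (fun n : ℕ => (d ^ n)⁻¹ * h (T^[n] x)) atTop (𝓝 (escapeRate T h d x)) :=
  (cauchySeq_of_le_geometric_two (dist_escapeRate_step hd hC x)).tendsto_limUnder

theorem abs_escapeRate_sub_le (hd : 2 ≤ d) (hC : ∀ x, |h (T x) - d * h x| ≤ C) (x : X) :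
    |escapeRate T h d x - h x| ≤ C := by
  have := dist_le_of_le_geometric_two_of_tendsto₀ (dist_escapeRate_step hd hC x)
    (tendsto_escapeRate hd hC x)
  rw [dist_comm, Real.dist_eq] at this
  simpa using this

theorem escapeRate_apply_map (hd : 2 ≤ d) (hC : ∀ x, |h (T x) - d * h x| ≤ C) (x : X) :
    escapeRate T h d (T x) = d * escapeRate T h d x := by
  have hd0 : 0 < d := by linarith
  refine tendsto_nhds_unique (tendsto_escapeRate hd hC (T x)) ?_
  have h1 := ((tendsto_escapeRate hd hC x).comp (tendsto_add_atTop_nat 1)).const_mul d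
  refine h1.congr fun n => ?_
  simp only [Function.comp_apply, Function.iterate_succ_apply]
  field_simp
  ring

theorem escapeRate_iterate (hd : 2 ≤ d) (hC : ∀ x, |h (T x) - d * h x| ≤ C) (x : X) (n : ℕ) :
    escapeRate T h d (T^[n] x) = d ^ n * escapeRate T h d x := by
  induction n with
  | zero => simp
  | succ n ih => rw [Function.iterate_succ_apply', escapeRate_apply_map hd hC, ih]; ring

theorem escapeRate_nonneg (hd : 2 ≤ d) (hC : ∀ x, |h (T x) - d * h x| ≤ C) (h0 : ∀ x, 0 ≤ h x)
    (x : X) : 0 ≤ escapeRate T h d x :=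
  ge_of_tendsto' (tendsto_escapeRate hd hC x) fun n => mul_nonneg (by positivity) (h0 _)

end escapeRate

/-! ### Polynomials over normed fields -/

namespace Polynomial

variable {L : Type*} [NormedField L]

theorem norm_eval_le_of_natDegree_le (φ : L[X]) {n : ℕ} (hn : φ.natDegree ≤ n) (x : L) :
    ‖φ.eval x‖ ≤ (∑ i ∈ Finset.range (n + 1), ‖φ.coeff i‖) * max 1 ‖x‖ ^ n := by
  rw [eval_eq_sum_range' (Nat.lt_succ_of_le hn), Finset.sum_mul]
  refine (norm_sum_le _ _).trans (Finset.sum_le_sum fun i hi => ?_)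
  rw [norm_mul, norm_pow]
  gcongr
  calc ‖x‖ ^ i ≤ max 1 ‖x‖ ^ i := by gcongr; exact le_max_right _ _
    _ ≤ max 1 ‖x‖ ^ n :=
      pow_le_pow_right₀ (le_max_left _ _) (Nat.lt_succ_iff.mp (Finset.mem_range.mp hi))

/-- Outside a large radius the leading term is at least twice all other terms together; inside it
the left side is bounded outright. -/
theorem max_one_norm_pow_le (φ : L[X]) (hφ : φ ≠ 0) :
    ∃ c : ℝ, 1 ≤ c ∧ ∀ x, max 1 ‖x‖ ^ φ.natDegree ≤ c * max 1 ‖φ.eval x‖ := by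
  set d := φ.natDegree
  have ha : 0 < ‖φ.leadingCoeff‖ := norm_pos_iff.mpr (leadingCoeff_ne_zero.mpr hφ)
  set B := ∑ i ∈ Finset.range d, ‖φ.coeff i‖
  have hB : 0 ≤ B := Finset.sum_nonneg fun _ _ => norm_nonneg _
  -- This radius makes the lower-order terms at most half of the leading term.
  set R := max 1 (2 * B / ‖φ.leadingCoeff‖)
  have hR : 1 ≤ R := le_max_left _ _
  refine ⟨max (R ^ d) (2 / ‖φ.leadingCoeff‖), (one_le_pow₀ hR).trans (le_max_left _ _), fun x => ?_⟩
  have h1 : 1 ≤ max 1 ‖φ.eval x‖ := le_max_left _ _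
  have hm : 1 ≤ max 1 ‖x‖ := le_max_left _ _
  rcases le_or_gt (max 1 ‖x‖) R with hx | hx
  · calc max 1 ‖x‖ ^ d ≤ R ^ d := by gcongr
      _ ≤ R ^ d * max 1 ‖φ.eval x‖ := le_mul_of_one_le_right (by positivity) h1
      _ ≤ _ := by gcongr; exact le_max_left _ _
  · have hx1 : max 1 ‖x‖ = ‖x‖ := by
      refine max_eq_right ?_
      by_contra hc
      rw [max_eq_left (not_le.mp hc).le] at hx
      linarith
    rw [hx1] at hx hm ⊢
    have hd : φ.eval x = ∑ i ∈ Finset.range d, φ.coeff i * x ^ i + φ.leadingCoeff * x ^ d := by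
      rw [eval_eq_sum_range, Finset.sum_range_succ]
      rfl
    have h2 : ‖∑ i ∈ Finset.range d, φ.coeff i * x ^ i‖ ≤ ‖φ.leadingCoeff‖ * ‖x‖ ^ d / 2 := by
      calc ‖∑ i ∈ Finset.range d, φ.coeff i * x ^ i‖
          ≤ ∑ i ∈ Finset.range d, ‖φ.coeff i‖ * (‖x‖ ^ d / ‖x‖) := by
            refine (norm_sum_le _ _).trans (Finset.sum_le_sum fun i hi => ?_)
            rw [norm_mul, norm_pow]
            gcongr
            rw [le_div_iff₀ (by linarith), ← pow_succ]
            exact pow_le_pow_right₀ hm (Finset.mem_range.mp hi)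
        _ = B * ‖x‖ ^ d / ‖x‖ := by rw [← Finset.sum_mul]; ring
        _ ≤ _ := by
          have h3 : 2 * B / ‖φ.leadingCoeff‖ ≤ ‖x‖ := (le_max_right _ _).trans hx.le
          rw [div_le_iff₀ ha] at h3
          rw [div_le_div_iff₀ (by linarith) two_pos]
          have : 0 ≤ ‖x‖ ^ d := by positivity
          nlinarith
    have h3 : ‖φ.leadingCoeff‖ * ‖x‖ ^ d / 2 ≤ ‖φ.eval x‖ := by
      have h4 : ‖φ.leadingCoeff * x ^ d‖ ≤
          ‖φ.eval x‖ + ‖∑ i ∈ Finset.range d, φ.coeff i * x ^ i‖ := by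
        rw [hd]
        refine le_trans (le_of_eq ?_) (norm_sub_le _ _)
        congr 1
        ring
      rw [norm_mul, norm_pow] at h4
      linarith
    calc ‖x‖ ^ d = 2 / ‖φ.leadingCoeff‖ * (‖φ.leadingCoeff‖ * ‖x‖ ^ d / 2) := by field_simp
      _ ≤ 2 / ‖φ.leadingCoeff‖ * max 1 ‖φ.eval x‖ := by
        gcongr
        exact h3.trans (le_max_right _ _)
      _ ≤ _ := by gcongr; exact le_max_right _ _

/-- This approximate functional equation is the hypothesis under which the escape rate of log⁺
exists. -/
theorem exists_abs_posLog_eval_sub_le (φ : L[X]) (hφ : φ ≠ 0) :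
    ∃ C : ℝ, ∀ x, |Real.posLog ‖φ.eval x‖ - φ.natDegree * Real.posLog ‖x‖| ≤ C := by
  obtain ⟨c, hc1, hc⟩ := φ.max_one_norm_pow_le hφ
  set c' := 1 + ∑ i ∈ Finset.range (φ.natDegree + 1), ‖φ.coeff i‖
  have hc'1 : 1 ≤ c' := le_add_of_nonneg_right (Finset.sum_nonneg fun _ _ => norm_nonneg _)
  refine ⟨Real.log c + Real.log c', fun x => ?_⟩
  have hl := Real.log_nonneg hc1
  have hl' := Real.log_nonneg hc'1
  have hm : 1 ≤ max 1 ‖x‖ := le_max_left _ _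
  have hm' : 1 ≤ max 1 ‖φ.eval x‖ := le_max_left _ _
  have h1 : max 1 ‖φ.eval x‖ ≤ c' * max 1 ‖x‖ ^ φ.natDegree := by
    refine max_le ?_ ?_
    · exact one_le_mul_of_one_le_of_one_le hc'1 (one_le_pow₀ hm)
    · refine (φ.norm_eval_le_of_natDegree_le le_rfl x).trans ?_
      gcongr
      exact le_add_of_nonneg_left zero_le_one
  have h2 := Real.log_le_log (by positivity) h1
  have h3 := Real.log_le_log (by positivity) (hc x)
  rw [Real.log_mul (by positivity) (by positivity), Real.log_pow] at h2
  rw [Real.log_mul (by positivity) (by positivity), Real.log_pow] at h3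
  rw [Real.posLog_eq_log_max_one (norm_nonneg _), Real.posLog_eq_log_max_one (norm_nonneg _), abs_le]
  constructor <;> linarith

/-- Good reduction: integral coefficients preserve the unit ball, and outside it the leading term
strictly dominates. Exactness is what removes every error term at almost all places. -/
theorem posLog_eval_of_isUltrametricDist [IsUltrametricDist L] (φ : L[X])
    (hd : φ.natDegree ≠ 0) (hlead : ‖φ.leadingCoeff‖ = 1) (hcoeff : ∀ i, ‖φ.coeff i‖ ≤ 1) (x : L) :
    Real.posLog ‖φ.eval x‖ = φ.natDegree * Real.posLog ‖x‖ := by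
  rcases le_or_gt ‖x‖ 1 with hx | hx
  · have h1 : ‖φ.eval x‖ ≤ 1 := by
      rw [eval_eq_sum_range]
      refine IsUltrametricDist.norm_sum_le_of_forall_le_of_nonneg zero_le_one fun i _ => ?_
      rw [norm_mul, norm_pow]
      exact mul_le_one₀ (hcoeff i) (by positivity) (pow_le_one₀ (norm_nonneg _) hx)
    rw [(Real.posLog_eq_zero_iff _).mpr (by simpa using h1),
      (Real.posLog_eq_zero_iff _).mpr (by simpa using hx), mul_zero]
  · have hx0 : 0 < ‖x‖ := by linarith
    have h1 : ‖∑ i ∈ Finset.range φ.natDegree, φ.coeff i * x ^ i‖ <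
        ‖φ.leadingCoeff * x ^ φ.natDegree‖ := by
      rw [norm_mul, hlead, one_mul, norm_pow]
      have h2 : ‖∑ i ∈ Finset.range φ.natDegree, φ.coeff i * x ^ i‖ ≤
          ‖x‖ ^ (φ.natDegree - 1) := by
        refine IsUltrametricDist.norm_sum_le_of_forall_le_of_nonneg (by positivity) fun i hi => ?_
        rw [norm_mul, norm_pow]
        calc ‖φ.coeff i‖ * ‖x‖ ^ i ≤ 1 * ‖x‖ ^ (φ.natDegree - 1) := by
              gcongr
              · exact hcoeff i
              · exact hx.le
              · have := Finset.mem_range.mp hi; omega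
          _ = _ := one_mul _
      exact h2.trans_lt (pow_lt_pow_right₀ hx (by omega))
    have h3 : ‖φ.eval x‖ = ‖x‖ ^ φ.natDegree := by
      rw [eval_eq_sum_range, Finset.sum_range_succ]
      change ‖_ + φ.leadingCoeff * x ^ φ.natDegree‖ = _
      rw [IsUltrametricDist.norm_add_eq_max_of_norm_ne_norm h1.ne, max_eq_right h1.le, norm_mul,
        hlead, one_mul, norm_pow]
    rw [h3, Real.posLog_pow]

/-- The Green function of the filled Julia set of `φ`: the limit of `log⁺ ‖φ^n x‖ / d^n`. -/
def green (φ : L[X]) (x : L) : ℝ :=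
  escapeRate (fun y => φ.eval y) (fun y => Real.posLog ‖y‖) φ.natDegree x

/-- The Robin constant of the filled Julia set of `φ`. -/
def robin (φ : L[X]) : ℝ := Real.log ‖φ.leadingCoeff‖ / (φ.natDegree - 1)

variable {φ : L[X]}

theorem ne_zero_of_two_le_natDegree {R : Type*} [Semiring R] {φ : R[X]} (hφ : 2 ≤ φ.natDegree) :
    φ ≠ 0 := by
  rintro rfl
  simp at hφ

theorem two_le_natDegree_cast {R : Type*} [Semiring R] {φ : R[X]} (hφ : 2 ≤ φ.natDegree) :
    (2 : ℝ) ≤ φ.natDegree := by exact_mod_cast hφ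

theorem tendsto_green (hφ : 2 ≤ φ.natDegree) (x : L) :
    Tendsto (fun n : ℕ => ((φ.natDegree : ℝ) ^ n)⁻¹ * Real.posLog ‖(fun y => φ.eval y)^[n] x‖) atTop
      (𝓝 (φ.green x)) := by
  obtain ⟨C, hC⟩ := φ.exists_abs_posLog_eval_sub_le (ne_zero_of_two_le_natDegree hφ)
  exact tendsto_escapeRate (two_le_natDegree_cast hφ) hC x

theorem green_nonneg (hφ : 2 ≤ φ.natDegree) (x : L) : 0 ≤ φ.green x := by
  obtain ⟨C, hC⟩ := φ.exists_abs_posLog_eval_sub_le (ne_zero_of_two_le_natDegree hφ)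
  exact escapeRate_nonneg (two_le_natDegree_cast hφ) hC (fun _ => Real.posLog_nonneg) x

theorem exists_abs_green_sub_posLog_le (hφ : 2 ≤ φ.natDegree) :
    ∃ C : ℝ, 0 ≤ C ∧ ∀ x, |φ.green x - Real.posLog ‖x‖| ≤ C := by
  obtain ⟨C, hC⟩ := φ.exists_abs_posLog_eval_sub_le (ne_zero_of_two_le_natDegree hφ)
  exact ⟨C, (abs_nonneg _).trans (hC 0), abs_escapeRate_sub_le (two_le_natDegree_cast hφ) hC⟩

theorem green_iterate (hφ : 2 ≤ φ.natDegree) (x : L) (n : ℕ) :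
    φ.green ((fun y => φ.eval y)^[n] x) = φ.natDegree ^ n * φ.green x := by
  obtain ⟨C, hC⟩ := φ.exists_abs_posLog_eval_sub_le (ne_zero_of_two_le_natDegree hφ)
  exact escapeRate_iterate (two_le_natDegree_cast hφ) hC x n

theorem green_eq_posLog_of_isUltrametricDist [IsUltrametricDist L] (hφ : 2 ≤ φ.natDegree)
    (hlead : ‖φ.leadingCoeff‖ = 1) (hcoeff : ∀ i, ‖φ.coeff i‖ ≤ 1) (x : L) :
    φ.green x = Real.posLog ‖x‖ := by
  have := abs_escapeRate_sub_le (T := fun y => φ.eval y) (h := fun y => Real.posLog ‖y‖) (C := 0)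
    (two_le_natDegree_cast hφ) (fun x => by
      rw [φ.posLog_eval_of_isUltrametricDist (by omega) hlead hcoeff]; simp) x
  exact sub_eq_zero.mp (abs_nonpos_iff.mp this)

/-- A point has bounded orbit if and only if the Green function vanishes there. -/
theorem green_eq_zero_iff (hφ : 2 ≤ φ.natDegree) (x : L) :
    φ.green x = 0 ↔ ¬ Tendsto (fun n : ℕ => ‖(fun y => φ.eval y)^[n] x‖) atTop atTop := by
  obtain ⟨C, hC0, hC⟩ := exists_abs_green_sub_posLog_le hφ
  have hd := two_le_natDegree_cast hφ
  constructor
  · intro h ht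
    -- The Green function vanishes along the whole orbit, so log⁺ of the orbit never exceeds C.
    obtain ⟨n, hn⟩ := (ht.eventually_gt_atTop (Real.exp C)).exists
    have h1 := hC ((fun y => φ.eval y)^[n] x)
    rw [green_iterate hφ, h, mul_zero, zero_sub, abs_neg, abs_of_nonneg Real.posLog_nonneg] at h1
    have h2 : C < Real.log ‖(fun y => φ.eval y)^[n] x‖ :=
      (Real.lt_log_iff_exp_lt ((Real.exp_pos _).trans hn)).mpr hn
    exact absurd (h2.trans_le (le_max_right 0 _)) (not_lt.mpr h1)
  · intro h
    by_contra hne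
    have hpos : 0 < φ.green x := lt_of_le_of_ne (green_nonneg hφ x) (Ne.symm hne)
    refine h (tendsto_atTop.mpr fun B => ?_)
    have h1 : Tendsto (fun n : ℕ => (φ.natDegree : ℝ) ^ n * φ.green x) atTop atTop :=
      (tendsto_pow_atTop_atTop_of_one_lt (by linarith)).atTop_mul_const hpos
    filter_upwards [h1.eventually_gt_atTop (C + Real.posLog B)] with n hn
    have h2 := hC ((fun y => φ.eval y)^[n] x)
    rw [green_iterate hφ] at h2
    have h3 : Real.posLog B < Real.posLog ‖(fun y => φ.eval y)^[n] x‖ := by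
      linarith [(abs_le.mp h2).2]
    by_contra hlt
    exact absurd h3 (not_lt.mpr (Real.posLog_le_posLog (norm_nonneg _) (not_le.mp hlt).le))

end Polynomial

/-! ### The transfinite diameter inequality -/

/-- Leibniz expansion. The factorial is harmless because N! = exp(o(N²)), so no sharper Hadamard
bound is needed, and the estimate is uniform over all normed fields. -/
theorem Matrix.norm_det_le_factorial_mul {L : Type*} [NormedField L] {N : ℕ}
    (M : Matrix (Fin N) (Fin N) L) (a b : Fin N → ℝ) (h : ∀ i j, ‖M i j‖ ≤ a i * b j) :
    ‖M.det‖ ≤ N.factorial * ((∏ i, a i) * ∏ i, b i) := by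
  rw [Matrix.det_apply]
  refine (norm_sum_le _ _).trans ?_
  calc ∑ σ : Equiv.Perm (Fin N), ‖Equiv.Perm.sign σ • ∏ i, M (σ i) i‖
      ≤ ∑ σ : Equiv.Perm (Fin N), (∏ i, a i) * ∏ i, b i := by
        refine Finset.sum_le_sum fun σ _ => ?_
        have h1 : ‖Equiv.Perm.sign σ • ∏ i, M (σ i) i‖ = ∏ i, ‖M (σ i) i‖ := by
          rcases Int.units_eq_one_or (Equiv.Perm.sign σ) with hs | hs <;>
            simp [hs, norm_prod, Units.smul_def]
        rw [h1, ← Equiv.prod_comp σ a, ← Finset.prod_mul_distrib]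
        exact Finset.prod_le_prod (fun _ _ => norm_nonneg _) fun i _ => h _ _
    _ = _ := by simp [Fintype.card_perm]

namespace Polynomial

variable {L : Type*} [NormedField L] {φ : L[X]}

/-- The leading coefficient of the k-th iterate is a^{1+d+⋯+d^{k-1}}, and the geometric sum is
(d^k-1)/(d-1). -/
theorem norm_leadingCoeff_iterate_comp (hφ : 2 ≤ φ.natDegree) (k : ℕ) :
    ‖(φ.comp^[k] X).leadingCoeff‖ = Real.exp (φ.robin * ((φ.natDegree : ℝ) ^ k - 1)) := by
  have hd := two_le_natDegree_cast hφ
  have ha : 0 < ‖φ.leadingCoeff‖ :=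
    norm_pos_iff.mpr (leadingCoeff_ne_zero.mpr (ne_zero_of_two_le_natDegree hφ))
  have hr : ‖φ.leadingCoeff‖ = Real.exp (φ.robin * (φ.natDegree - 1)) := by
    rw [robin, div_mul_cancel₀ _ (by linarith), Real.exp_log ha]
  induction k with
  | zero => simp
  | succ k ih =>
    have h1 : (φ.comp^[k] X).natDegree ≠ 0 := by
      rw [natDegree_iterate_comp, natDegree_X, mul_one]
      positivity
    rw [Function.iterate_succ_apply', leadingCoeff_comp h1, norm_mul, norm_pow, ih, hr,
      ← Real.exp_nat_mul, ← Real.exp_add]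
    congr 1
    ring

/-- Monic polynomials of degree `j` that are small on the filled Julia set: products of a power of
the normalized iterate `φ^k` and a power of `X`. -/
def feketeBasis (φ : L[X]) (k j : ℕ) : L[X] :=
  X ^ (j % φ.natDegree ^ k) *
    (C (φ.comp^[k] X).leadingCoeff⁻¹ * φ.comp^[k] X) ^ (j / φ.natDegree ^ k)

theorem iterate_comp_X_ne_zero (hφ : 2 ≤ φ.natDegree) (k : ℕ) : φ.comp^[k] X ≠ 0 := by
  intro h
  have := congrArg natDegree h
  rw [natDegree_iterate_comp, natDegree_X, mul_one, natDegree_zero] at this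
  exact absurd this (by positivity)

theorem monic_feketeBasis (hφ : 2 ≤ φ.natDegree) (k j : ℕ) : (φ.feketeBasis k j).Monic := by
  refine (monic_X_pow _).mul (Monic.pow ?_ _)
  rw [mul_comm]
  exact monic_mul_leadingCoeff_inv (iterate_comp_X_ne_zero hφ k)

theorem natDegree_feketeBasis (hφ : 2 ≤ φ.natDegree) (k j : ℕ) :
    (φ.feketeBasis k j).natDegree = j := by
  have h1 : (C (φ.comp^[k] X).leadingCoeff⁻¹ * φ.comp^[k] X).Monic := by
    rw [mul_comm]
    exact monic_mul_leadingCoeff_inv (iterate_comp_X_ne_zero hφ k)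
  rw [feketeBasis, (monic_X_pow _).natDegree_mul (h1.pow _), natDegree_X_pow, h1.natDegree_pow,
    natDegree_C_mul (by simpa using iterate_comp_X_ne_zero hφ k), natDegree_iterate_comp,
    natDegree_X, mul_one]
  exact Nat.mod_add_div' _ _

/-- Each factor X or normalized iterate costs one bounded error, since log⁺ and the Green function
differ by at most C. There are only j mod d^k plus j / d^k factors, so the total error is a small
fraction of j when k and j / d^k are large. -/
theorem norm_eval_feketeBasis_le (hφ : 2 ≤ φ.natDegree) {C : ℝ}
    (hC : ∀ x, |φ.green x - Real.posLog ‖x‖| ≤ C) (k j : ℕ) (x : L) :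
    ‖(φ.feketeBasis k j).eval x‖ ≤ Real.exp (j * φ.green x - φ.robin * j +
      ((j % φ.natDegree ^ k : ℕ) + (j / φ.natDegree ^ k : ℕ)) * (C + φ.robin)) := by
  have hle : ∀ y : L, ‖y‖ ≤ Real.exp (φ.green y + C) := fun y => by
    refine (Real.le_exp_log _).trans (Real.exp_le_exp.mpr ?_)
    have h1 : Real.log ‖y‖ ≤ Real.posLog ‖y‖ := le_max_right _ _
    linarith [(abs_le.mp (hC y)).1]
  have h1 : ‖(φ.comp^[k] X).eval x‖ ≤ Real.exp (φ.natDegree ^ k * φ.green x + C) := by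
    refine (hle _).trans (le_of_eq ?_)
    rw [iterate_comp_eval, eval_X, green_iterate hφ]
  rw [feketeBasis, eval_mul, eval_pow, eval_X, eval_pow, eval_mul, eval_C, norm_mul, norm_pow,
    norm_pow, norm_mul, norm_inv, norm_leadingCoeff_iterate_comp hφ, ← Real.exp_neg]
  set q := j % φ.natDegree ^ k
  set m := j / φ.natDegree ^ k
  have hj : (j : ℝ) = q + φ.natDegree ^ k * m := by exact_mod_cast (Nat.mod_add_div _ _).symm
  calc ‖x‖ ^ q * (Real.exp (-(φ.robin * ((φ.natDegree : ℝ) ^ k - 1))) *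
        ‖(φ.comp^[k] X).eval x‖) ^ m
      ≤ Real.exp (φ.green x + C) ^ q * (Real.exp (-(φ.robin * ((φ.natDegree : ℝ) ^ k - 1))) *
        Real.exp (φ.natDegree ^ k * φ.green x + C)) ^ m := by
        gcongr
        exact hle x
    _ = _ := by
      rw [← Real.exp_add, ← Real.exp_nat_mul, ← Real.exp_nat_mul, ← Real.exp_add, hj]
      congr 1
      ring

theorem prod_norm_sub_eq_sq_det {N : ℕ} (x : Fin N → L) :
    ∏ i, ∏ j ∈ {i}ᶜ, ‖x j - x i‖ = ‖(Matrix.vandermonde x).det‖ ^ 2 := by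
  rw [← Finset.prod_prod_Ioi_mul_eq_prod_prod_off_diag (fun i j => ‖x i - x j‖),
    Matrix.det_vandermonde, norm_prod, ← Finset.prod_pow]
  refine Finset.prod_congr rfl fun i _ => ?_
  rw [norm_prod, ← Finset.prod_pow]
  refine Finset.prod_congr rfl fun j _ => ?_
  rw [norm_sub_rev (x i), sq]

theorem prod_norm_sub_le_aux (hφ : 2 ≤ φ.natDegree) {C : ℝ}
    (hC : ∀ x, |φ.green x - Real.posLog ‖x‖| ≤ C) (k N : ℕ) (x : Fin N → L) :
    ∏ i, ∏ j ∈ {i}ᶜ, ‖x j - x i‖ ≤ Real.exp (2 * N * ∑ i, φ.green (x i) - φ.robin * N ^ 2 +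
      (2 * N * Real.log N + |φ.robin| * N +
        2 * N * (φ.natDegree ^ k + N / φ.natDegree ^ k) * |C + φ.robin|)) := by
  have hD : (0 : ℝ) < (φ.natDegree : ℝ) ^ k := by
    have := two_le_natDegree_cast hφ
    positivity
  set D : ℝ := (φ.natDegree : ℝ) ^ k
  -- Monic polynomials of degree j in column j differ from monomials by a unipotent change of
  -- columns.
  rw [prod_norm_sub_eq_sq_det, Matrix.det_eval_matrixOfPolynomials_eq_det_vandermonde x
    (fun j => φ.feketeBasis k j) (fun j => natDegree_feketeBasis hφ k j)
    (fun j => monic_feketeBasis hφ k j)]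
  have h1 := Matrix.norm_det_le_factorial_mul
    (Matrix.of fun i j : Fin N => (φ.feketeBasis k j).eval (x i))
    -- Rows carry the Green function, with j raised to N because it is nonnegative; columns carry
    -- the Robin constant and the errors.
    (fun i => Real.exp (N * φ.green (x i)))
    (fun j => Real.exp (- φ.robin * j + (D + N / D) * |C + φ.robin|))
    (fun i j => by
      rw [Matrix.of_apply, ← Real.exp_add]
      refine (norm_eval_feketeBasis_le hφ hC k j (x i)).trans (Real.exp_le_exp.mpr ?_)
      have hj : ((j : ℕ) : ℝ) ≤ N := by exact_mod_cast j.2.le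
      have h2 := mul_le_mul_of_nonneg_right hj (green_nonneg hφ (x i))
      have h3 : (((j : ℕ) % φ.natDegree ^ k : ℕ) : ℝ) ≤ D := by
        have : (j : ℕ) % φ.natDegree ^ k ≤ φ.natDegree ^ k := (Nat.mod_lt _ (by positivity)).le
        calc (((j : ℕ) % φ.natDegree ^ k : ℕ) : ℝ) ≤ ((φ.natDegree ^ k : ℕ) : ℝ) := by
              exact_mod_cast this
          _ = D := by push_cast; rfl
      have h4 : (((j : ℕ) / φ.natDegree ^ k : ℕ) : ℝ) ≤ N / D := by
        refine Nat.cast_div_le.trans ?_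
        push_cast
        gcongr
      have h5 : ((((j : ℕ) % φ.natDegree ^ k : ℕ) : ℝ) + ((j : ℕ) / φ.natDegree ^ k : ℕ)) *
          (C + φ.robin) ≤ (D + N / D) * |C + φ.robin| :=
        calc _ ≤ ((((j : ℕ) % φ.natDegree ^ k : ℕ) : ℝ) + ((j : ℕ) / φ.natDegree ^ k : ℕ)) *
              |C + φ.robin| := by
              gcongr
              exact le_abs_self _
          _ ≤ _ := by gcongr
      linarith)
  rw [← Real.exp_sum, ← Real.exp_sum, ← Finset.mul_sum, Finset.sum_add_distrib,
    ← Finset.mul_sum] at h1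
  have hsum : (∑ j : Fin N, ((j : ℕ) : ℝ)) = N * (N - 1) / 2 := by
    have h2 := Finset.sum_range_id_mul_two N
    rw [Fin.sum_univ_eq_sum_range (fun j => (j : ℝ))]
    have h3 : ((∑ i ∈ Finset.range N, i : ℕ) : ℝ) * 2 = N * (N - 1) := by
      rcases Nat.eq_zero_or_pos N with rfl | hN
      · simp
      · rw [← Nat.cast_pred hN]
        exact_mod_cast h2
    push_cast at h3
    linarith
  have hfac : (N.factorial : ℝ) ≤ Real.exp (N * Real.log N) := by
    rcases Nat.eq_zero_or_pos N with rfl | hN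
    · simp
    · rw [← Real.log_pow, Real.exp_log (by positivity)]
      exact_mod_cast Nat.factorial_le_pow N
  rw [hsum, Finset.sum_const, Finset.card_univ, Fintype.card_fin, nsmul_eq_mul] at h1
  set c := |C + φ.robin|
  calc ‖_‖ ^ 2 ≤ (N.factorial * (Real.exp (N * ∑ i, φ.green (x i)) *
        Real.exp (-φ.robin * (N * (N - 1) / 2) + N * ((D + N / D) * c)))) ^ 2 := by
        gcongr
    _ ≤ (Real.exp (N * Real.log N) * (Real.exp (N * ∑ i, φ.green (x i)) *
        Real.exp (-φ.robin * (N * (N - 1) / 2) + N * ((D + N / D) * c)))) ^ 2 := by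
        gcongr
    _ ≤ _ := by
      rw [← Real.exp_add, ← Real.exp_add, ← Real.exp_nat_mul]
      refine Real.exp_le_exp.mpr ?_
      -- Squaring turns N(N-1)/2 into N² - N; the stray V·N goes into the error.
      have h2 : φ.robin * N ≤ |φ.robin| * N := by
        gcongr
        exact le_abs_self _
      push_cast
      nlinarith

/-- The product of the mutual distances of `N` points is at most
`exp (2 N ∑ g(x_i) - V N² + o(N²))`, where `g` is the Green function and `V` is the Robin constant
of the filled Julia set. -/
theorem exists_prod_norm_sub_le (hφ : 2 ≤ φ.natDegree) {ε : ℝ} (hε : 0 < ε) :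
    ∃ A : ℝ, 0 ≤ A ∧ ∀ (N : ℕ) (x : Fin N → L),
      ∏ i, ∏ j ∈ {i}ᶜ, ‖x j - x i‖ ≤
        Real.exp (2 * N * ∑ i, φ.green (x i) - φ.robin * N ^ 2 + ε * N ^ 2 + A) := by
  obtain ⟨C, -, hC⟩ := exists_abs_green_sub_posLog_le hφ
  have hd := two_le_natDegree_cast hφ
  set c := |C + φ.robin|
  -- With d^k > 4c/ε the error 2cN²/d^k is at most εN²/2; k is now fixed, and everything else is
  -- o(N²).
  obtain ⟨k, hk⟩ : ∃ k : ℕ, 4 * c / ε < (φ.natDegree : ℝ) ^ k :=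
    pow_unbounded_of_one_lt _ (by linarith)
  set D : ℝ := (φ.natDegree : ℝ) ^ k
  have hD : 0 < D := by positivity
  set B := |φ.robin| + 2 * D * c
  have hB : 0 ≤ B := by positivity
  have hlim : Tendsto (fun N : ℕ => 2 * (Real.log N / N) + B * (N : ℝ)⁻¹) atTop (𝓝 0) := by
    have h1 : Tendsto (fun N : ℕ => Real.log N / N) atTop (𝓝 0) :=
      (Real.isLittleO_log_id_atTop.tendsto_div_nhds_zero).comp tendsto_natCast_atTop_atTop
    simpa using (h1.const_mul 2).add (tendsto_inv_atTop_nhds_zero_nat (𝕜 := ℝ) |>.const_mul B)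
  obtain ⟨N₀, hN₀⟩ := eventually_atTop.mp (hlim.eventually_lt_const (half_pos hε))
  -- For N < N₀ the remaining error is monotone in N, so its value at N₀ serves as the constant.
  refine ⟨2 * N₀ * Real.log N₀ + B * N₀,
    add_nonneg (mul_nonneg (by positivity) (Real.log_natCast_nonneg _)) (by positivity),
    fun N x => ?_⟩
  refine (prod_norm_sub_le_aux hφ hC k N x).trans (Real.exp_le_exp.mpr ?_)
  have h1 : 2 * N * (D + N / D) * c ≤ 2 * D * c * N + ε / 2 * N ^ 2 := by
    have h2 : 2 * c / D ≤ ε / 2 := by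
      rw [div_lt_iff₀ hε] at hk
      rw [div_le_iff₀ hD]
      linarith
    calc 2 * N * (D + N / D) * c = 2 * D * c * N + 2 * c / D * N ^ 2 := by field_simp
      _ ≤ _ := by gcongr
  have h2 : 2 * N * Real.log N + B * N ≤
      ε / 2 * N ^ 2 + (2 * N₀ * Real.log N₀ + B * N₀) := by
    rcases le_or_gt N₀ N with hN | hN
    · have h4 : 0 ≤ 2 * N₀ * Real.log N₀ + B * N₀ :=
        add_nonneg (mul_nonneg (by positivity) (Real.log_natCast_nonneg _)) (by positivity)
      rcases Nat.eq_zero_or_pos N with rfl | hpos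
      · simpa using h4
      · have h3 := hN₀ N hN
        have hNpos : (0 : ℝ) < N := by exact_mod_cast hpos
        have h5 : 2 * N * Real.log N + B * N =
            (2 * (Real.log N / N) + B * (N : ℝ)⁻¹) * N ^ 2 := by field_simp
        have h6 : (2 * (Real.log N / N) + B * (N : ℝ)⁻¹) * N ^ 2 ≤ ε / 2 * N ^ 2 := by gcongr
        linarith
    · have hle : (N : ℝ) ≤ N₀ := by exact_mod_cast hN.le
      have h3 : N * Real.log N ≤ N₀ * Real.log N₀ := by
        rcases Nat.eq_zero_or_pos N with rfl | hpos
        · simpa using mul_nonneg (Nat.cast_nonneg N₀) (Real.log_natCast_nonneg N₀)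
        · exact mul_le_mul hle (Real.log_le_log (by exact_mod_cast hpos) hle)
            (Real.log_natCast_nonneg _) (Nat.cast_nonneg _)
      have h4 : B * N ≤ B * N₀ := by gcongr
      have h5 : 0 ≤ ε / 2 * (N : ℝ) ^ 2 := by positivity
      linarith
  have h3 : B * N = |φ.robin| * N + 2 * D * c * N := by ring
  linarith

end Polynomial

theorem Finset.prod_offDiag_eq_prod_fin {M α : Type*} [CommMonoid M] (S : Finset α)
    (F : α → α → M) :
    ∏ p ∈ S.offDiag, F p.1 p.2 =
      ∏ i : Fin S.card, ∏ j ∈ {i}ᶜ, F (S.equivFin.symm j) (S.equivFin.symm i) := by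
  rw [Finset.prod_sigma']
  symm
  refine Finset.prod_bij (fun a _ => ((S.equivFin.symm a.2 : α), (S.equivFin.symm a.1 : α)))
    ?_ ?_ ?_ ?_
  · rintro ⟨i, j⟩ h
    simp only [Finset.mem_sigma, Finset.mem_univ, Finset.mem_compl, Finset.mem_singleton,
      true_and] at h
    simp only [Finset.mem_offDiag, Finset.coe_mem, true_and]
    intro hc
    exact h (S.equivFin.symm.injective (Subtype.ext hc))
  · rintro ⟨i, j⟩ _ ⟨i', j'⟩ _ h
    simp only [Prod.mk.injEq] at h
    obtain rfl := S.equivFin.symm.injective (Subtype.ext h.1)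
    obtain rfl := S.equivFin.symm.injective (Subtype.ext h.2)
    rfl
  · rintro ⟨a, b⟩ h
    obtain ⟨ha, hb, hab⟩ := Finset.mem_offDiag.mp h
    refine ⟨⟨S.equivFin ⟨b, hb⟩, S.equivFin ⟨a, ha⟩⟩, ?_, by simp⟩
    simp only [Finset.mem_sigma, Finset.mem_univ, Finset.mem_compl, Finset.mem_singleton, true_and]
    intro hc
    exact hab (congrArg Subtype.val (S.equivFin.injective hc))
  · intros
    rfl

theorem Polynomial.exists_sum_log_norm_sub_le {L : Type*} [NormedField L] {φ : L[X]}
    (hφ : 2 ≤ φ.natDegree) {ε : ℝ} (hε : 0 < ε) :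
    ∃ A : ℝ, 0 ≤ A ∧ ∀ {α : Type u} (S : Finset α) (f : α → L), Function.Injective f →
      ∑ p ∈ S.offDiag, Real.log ‖f p.1 - f p.2‖ ≤
        2 * S.card * ∑ a ∈ S, φ.green (f a) - φ.robin * S.card ^ 2 + ε * S.card ^ 2 + A := by
  obtain ⟨A, hA0, hA⟩ := exists_prod_norm_sub_le hφ hε
  refine ⟨A, hA0, fun S f hf => ?_⟩
  have hne : ∀ p ∈ S.offDiag, ‖f p.1 - f p.2‖ ≠ 0 := fun p hp => by
    rw [norm_ne_zero_iff, sub_ne_zero]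
    exact fun h => (Finset.mem_offDiag.mp hp).2.2 (hf h)
  have h1 := hA S.card fun i => f (S.equivFin.symm i)
  rw [← Finset.prod_offDiag_eq_prod_fin S fun a b => ‖f a - f b‖] at h1
  rw [← Real.log_prod hne, Real.log_le_iff_le_exp
    (Finset.prod_pos fun p hp => lt_of_le_of_ne (norm_nonneg _) (hne p hp).symm)]
  refine h1.trans (le_of_eq ?_)
  congr 4
  rw [Equiv.sum_comp S.equivFin.symm fun a : S => φ.green (f a), Finset.sum_coe_sort S
    fun a => φ.green (f a)]

namespace ProductFormulaField

variable {K : Type u} [Field K] {Place : Type w} (P : ProductFormulaField K Place)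
  (ι : ∀ v, AlgebraicClosure K →ₐ[K] P.Cv v)

theorem isUltrametricDist_Cv {v : Place} (hv : IsNonarchimedean (P.abv v)) :
    IsUltrametricDist (P.Cv v) := by
  refine IsUltrametricDist.isUltrametricDist_of_forall_norm_natCast_le_one fun n => ?_
  have h := P.norm_algebraMap_Cv v n
  rw [map_natCast] at h
  rw [h]
  exact hv.apply_natCast_le_one

/-! ### The product formula over the algebraic closure -/

theorem sum_weight_mul_log_abv {x : K} (hx : x ≠ 0) (s : Finset Place)
    (hs : {v | P.abv v x ≠ 1} ⊆ s) : ∑ v ∈ s, P.weight v * Real.log (P.abv v x) = 0 := by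
  have h1 := P.product_formula x hx
  rw [finprod_eq_prod_of_mulSupport_subset (s := s)] at h1
  · have h2 := congrArg Real.log h1
    rw [Real.log_prod fun v _ => (Real.rpow_pos_of_pos ((P.abv v).pos hx) _).ne', Real.log_one] at h2
    rw [← h2]
    exact Finset.sum_congr rfl fun v _ => (Real.log_rpow ((P.abv v).pos hx) _).symm
  · intro v hv
    refine hs fun h => hv ?_
    simp [h]

theorem finite_coeff (f : K[X]) : {v | ∃ i, 1 < P.abv v (f.coeff i)}.Finite := by
  have h : (⋃ i ∈ f.support, {v | P.abv v (f.coeff i) ≠ 1}).Finite :=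
    f.support.finite_toSet.biUnion fun i hi => P.finite_ne_one _ (mem_support_iff.mp hi)
  refine h.subset ?_
  rintro v ⟨i, hi⟩
  refine Set.mem_biUnion (mem_support_iff.mpr ?_) hi.ne'
  intro h0
  rw [h0, map_zero] at hi
  linarith

/-- The exact good-reduction formula, applied to the minimal polynomial at its root z, reads 0 = deg
· log⁺|z|. -/
theorem norm_le_one_of_coeff {v : Place} (hv : IsNonarchimedean (P.abv v)) {z : AlgebraicClosure K}
    (hz : ∀ i, P.abv v ((minpoly K z).coeff i) ≤ 1) : ‖ι v z‖ ≤ 1 := by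
  have := P.isUltrametricDist_Cv hv
  have hint : IsIntegral K z := Algebra.IsIntegral.isIntegral z
  set f := (minpoly K z).map (algebraMap K (P.Cv v))
  have hmonic : f.Monic := (minpoly.monic hint).map _
  have hdeg : f.natDegree ≠ 0 := by
    rw [natDegree_map]
    exact (minpoly.natDegree_pos hint).ne'
  have h1 := f.posLog_eval_of_isUltrametricDist hdeg (by rw [hmonic.leadingCoeff, norm_one])
    (fun i => by rw [coeff_map, norm_algebraMap_Cv]; exact hz i) (ι v z)
  have h2 : f.eval (ι v z) = 0 := by
    rw [eval_map_algebraMap, aeval_algHom_apply, minpoly.aeval, map_zero]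
  rw [h2, norm_zero, Real.posLog_zero, eq_comm, mul_eq_zero] at h1
  have h3 := h1.resolve_left (by exact_mod_cast hdeg)
  simpa using (Real.posLog_eq_zero_iff _).mp h3

theorem finite_one_lt_norm (z : AlgebraicClosure K) : {v | 1 < ‖ι v z‖}.Finite := by
  refine (P.finite_archimedean.union (P.finite_coeff (minpoly K z))).subset fun v hv => ?_
  by_contra hc
  simp only [Set.mem_union, Set.mem_ofPred_eq, not_or, not_not, not_exists, not_lt] at hc
  exact absurd (P.norm_le_one_of_coeff ι hc.1 hc.2) (not_le.mpr hv)

theorem finite_norm_ne_one {z : AlgebraicClosure K} (hz : z ≠ 0) : {v | ‖ι v z‖ ≠ 1}.Finite := by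
  refine ((P.finite_one_lt_norm ι z).union (P.finite_one_lt_norm ι z⁻¹)).subset fun v hv => ?_
  rcases lt_or_gt_of_ne hv with h | h
  · right
    have : 0 < ‖ι v z‖ := norm_pos_iff.mpr ((map_ne_zero_iff _ (ι v).injective).mpr hz)
    simpa only [Set.mem_ofPred_eq, map_inv₀, norm_inv] using (one_lt_inv₀ this).mpr h
  · exact Or.inl h

/-- A power of a Galois-invariant element is, up to sign, an element of the base field. -/
theorem exists_pow_eq_of_fixed {z : AlgebraicClosure K}
    (hz : ∀ σ : AlgebraicClosure K ≃ₐ[K] AlgebraicClosure K, σ z = z) :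
    ∃ m : ℕ, m ≠ 0 ∧ ∃ x : K, algebraMap K _ x = (-1) ^ m * z ^ m := by
  have hint : IsIntegral K z := Algebra.IsIntegral.isIntegral z
  refine ⟨(minpoly K z).natDegree, (minpoly.natDegree_pos hint).ne', (minpoly K z).coeff 0, ?_⟩
  set f := (minpoly K z).map (algebraMap K (AlgebraicClosure K))
  have hsplit : f.Splits := IsAlgClosed.splits f
  have hmonic : f.Monic := (minpoly.monic hint).map _
  -- Every root is a conjugate of z, so the minimal polynomial is (X - z)^m, with m > 1 only in the
  -- inseparable case.
  have hroots : ∀ y ∈ f.roots, y = z := fun y hy => by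
    have h1 : aeval y (minpoly K z) = 0 := by
      rw [← eval_map_algebraMap]
      exact (mem_roots'.mp hy).2
    obtain ⟨σ, hσ⟩ := isConjRoot_iff_exists_algEquiv.mp (isConjRoot_of_aeval_eq_zero hint h1)
    exact σ.injective (hσ.trans (hz σ).symm)
  rw [← coeff_map, hsplit.coeff_zero_eq_prod_roots_of_monic hmonic,
    Multiset.eq_replicate_of_mem hroots, Multiset.prod_replicate, ← hsplit.natDegree_eq_card_roots,
    natDegree_map]

theorem sum_weight_mul_log_norm {z : AlgebraicClosure K} (hz0 : z ≠ 0)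
    (hz : ∀ σ : AlgebraicClosure K ≃ₐ[K] AlgebraicClosure K, σ z = z) (s : Finset Place)
    (hs : {v | ‖ι v z‖ ≠ 1} ⊆ s) : ∑ v ∈ s, P.weight v * Real.log ‖ι v z‖ = 0 := by
  obtain ⟨m, hm, x, hx⟩ := exists_pow_eq_of_fixed hz
  have habv : ∀ v, P.abv v x = ‖ι v z‖ ^ m := fun v => by
    have h1 := congrArg (fun y => ‖ι v y‖) hx
    simp only [AlgHom.commutes, map_mul, map_pow, map_neg, map_one, norm_mul, norm_pow, norm_neg,
      norm_one, one_pow, one_mul] at h1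
    rw [← P.norm_algebraMap_Cv, h1]
  have hx0 : x ≠ 0 := by
    rintro rfl
    rw [map_zero] at hx
    exact (mul_ne_zero (pow_ne_zero _ (neg_ne_zero.mpr one_ne_zero)) (pow_ne_zero _ hz0)) hx.symm
  have h1 := P.sum_weight_mul_log_abv hx0 s fun v hv => hs fun h => hv (by
    change ‖ι v z‖ = 1 at h
    rw [habv, h, one_pow])
  simp_rw [habv, Real.log_pow] at h1
  have h2 : (m : ℝ) * ∑ v ∈ s, P.weight v * Real.log ‖ι v z‖ = 0 := by
    rw [Finset.mul_sum, ← h1]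
    exact Finset.sum_congr rfl fun v _ => by ring
  exact (mul_eq_zero.mp h2).resolve_left (by exact_mod_cast hm)

/-! ### Canonical heights as sums of local contributions -/

variable (φ : K[X])

/-- The polynomial `φ` over the field `ℂ_v`. -/
def localPoly (v : Place) : (P.Cv v)[X] := φ.map (algebraMap K (P.Cv v))

theorem natDegree_localPoly (v : Place) : (P.localPoly φ v).natDegree = φ.natDegree :=
  natDegree_map _

theorem eval_localPoly (v : Place) (y : P.Cv v) : (P.localPoly φ v).eval y = aeval y φ :=
  eval_map_algebraMap _ _

theorem norm_leadingCoeff_localPoly (v : Place) :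
    ‖(P.localPoly φ v).leadingCoeff‖ = P.abv v φ.leadingCoeff := by
  rw [localPoly, leadingCoeff_map, norm_algebraMap_Cv]

theorem iterate_localPoly (v : Place) (n : ℕ) (z : AlgebraicClosure K) :
    (fun y => (P.localPoly φ v).eval y)^[n] (ι v z) = ι v ((fun y => aeval y φ)^[n] z) := by
  induction n with
  | zero => rfl
  | succ n ih =>
    rw [Function.iterate_succ_apply', Function.iterate_succ_apply', ih, eval_localPoly,
      aeval_algHom_apply]

/-- The places of bad reduction of `φ`, including the archimedean places. -/
def badPlaces : Set Place :=
  {v | ¬ IsNonarchimedean (P.abv v)} ∪ {v | ∃ i, 1 < P.abv v (φ.coeff i)} ∪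
    {v | P.abv v φ.leadingCoeff ≠ 1}

variable {φ}

theorem finite_badPlaces (hφ : φ ≠ 0) : (P.badPlaces φ).Finite :=
  (P.finite_archimedean.union (P.finite_coeff φ)).union
    (P.finite_ne_one _ (leadingCoeff_ne_zero.mpr hφ))

variable {P} in
theorem good_of_notMem_badPlaces {v : Place} (hv : v ∉ P.badPlaces φ) :
    IsNonarchimedean (P.abv v) ∧ (∀ i, ‖(P.localPoly φ v).coeff i‖ ≤ 1) ∧
      ‖(P.localPoly φ v).leadingCoeff‖ = 1 := by
  simp only [badPlaces, Set.mem_union, Set.mem_ofPred_eq, not_or, not_not, not_exists, not_lt] at hv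
  refine ⟨hv.1.1, fun i => ?_, ?_⟩
  · rw [localPoly, coeff_map, norm_algebraMap_Cv]
    exact hv.1.2 i
  · rw [norm_leadingCoeff_localPoly]
    exact hv.2

theorem green_localPoly_of_good {v : Place} (hφ : 2 ≤ φ.natDegree) (hv : v ∉ P.badPlaces φ)
    (x : P.Cv v) : (P.localPoly φ v).green x = Real.posLog ‖x‖ := by
  obtain ⟨h1, h2, h3⟩ := good_of_notMem_badPlaces hv
  have := P.isUltrametricDist_Cv h1
  exact green_eq_posLog_of_isUltrametricDist (by rwa [natDegree_localPoly]) h3 h2 x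

theorem posLog_iterate_of_good {v : Place} (hφ : 2 ≤ φ.natDegree) (hv : v ∉ P.badPlaces φ)
    {z : AlgebraicClosure K} (hz : ‖ι v z‖ ≤ 1) (n : ℕ) :
    Real.posLog ‖ι v ((fun y => aeval y φ)^[n] z)‖ = 0 := by
  have hφ' : 2 ≤ (P.localPoly φ v).natDegree := by rwa [natDegree_localPoly]
  rw [← iterate_localPoly, ← P.green_localPoly_of_good hφ hv, green_iterate hφ',
    P.green_localPoly_of_good hφ hv, (Real.posLog_eq_zero_iff _).mpr (by simpa using hz), mul_zero]

theorem galoisHull_eq {S : Finset (AlgebraicClosure K)} (hS : IsGaloisStable K S) :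
    galoisHull S = S := by
  ext z
  simp only [galoisHull, Set.Finite.mem_toFinset, Set.mem_ofPred_eq]
  constructor
  · rintro ⟨t, ht, σ, rfl⟩
    exact hS σ t ht
  · exact fun hz => ⟨z, hz, AlgEquiv.refl, rfl⟩

/-- One finite set of places works for all iterates at once: at a good place where z is integral,
the whole orbit stays integral. The limit then passes through finite sums. -/
theorem canonicalHeight_eq (hφ : 2 ≤ φ.natDegree) {S : Finset (AlgebraicClosure K)}
    (hS : IsGaloisStable K S) (W : Finset Place) (hW : P.badPlaces φ ⊆ W)
    (hSW : ∀ z ∈ S, {v | 1 < ‖ι v z‖} ⊆ W) :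
    P.canonicalHeight ι φ S = (S.card : ℝ)⁻¹ *
      ∑ v ∈ W, P.weight v * ∑ z ∈ S, (P.localPoly φ v).green (ι v z) := by
  rw [canonicalHeight, galoisHull_eq hS]
  refine Tendsto.limUnder_eq ?_
  have h1 : ∀ n : ℕ, ∀ z ∈ S, P.sumLocalHeights ι ((fun y => aeval y φ)^[n] z) =
      ∑ v ∈ W, P.weight v * Real.posLog ‖(fun y => (P.localPoly φ v).eval y)^[n] (ι v z)‖ := by
    intro n z hz
    rw [sumLocalHeights, finsum_eq_sum_of_support_subset (s := W)]
    · simp_rw [iterate_localPoly]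
    · intro v hv
      by_contra hvW
      refine hv ?_
      have h2 : ‖ι v z‖ ≤ 1 := not_lt.mp fun h => hvW (hSW z hz h)
      change P.weight v * _ = 0
      rw [P.posLog_iterate_of_good ι hφ (fun h => hvW (hW h)) h2, mul_zero]
  have h2 : Tendsto (fun n : ℕ => (S.card : ℝ)⁻¹ * ∑ v ∈ W, P.weight v * ∑ z ∈ S,
      (((P.localPoly φ v).natDegree : ℝ) ^ n)⁻¹ *
        Real.posLog ‖(fun y => (P.localPoly φ v).eval y)^[n] (ι v z)‖) atTop
      (𝓝 ((S.card : ℝ)⁻¹ * ∑ v ∈ W, P.weight v * ∑ z ∈ S, (P.localPoly φ v).green (ι v z))) :=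
    Tendsto.const_mul _ (tendsto_finsetSum _ fun v _ => Tendsto.const_mul _
      (tendsto_finsetSum _ fun z _ => tendsto_green (by rwa [natDegree_localPoly]) _))
  refine h2.congr fun n => ?_
  rw [Finset.sum_congr rfl (h1 n), Finset.sum_comm, mul_left_comm]
  congr 1
  rw [Finset.mul_sum]
  refine Finset.sum_congr rfl fun v _ => ?_
  rw [natDegree_localPoly, ← Finset.mul_sum, ← Finset.mul_sum]
  ring

end ProductFormulaField

/-! ### The global bound for the discrete energy. -/

namespace ProductFormulaField

variable {K : Type u} [Field K] {Place : Type w} (P : ProductFormulaField K Place)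
  (ι : ∀ v, AlgebraicClosure K →ₐ[K] P.Cv v) {φ : K[X]}

theorem robin_eq_zero_of_good {v : Place} (hv : v ∉ P.badPlaces φ) :
    (P.localPoly φ v).robin = 0 := by
  rw [robin, (good_of_notMem_badPlaces hv).2.2, Real.log_one, zero_div]

theorem two_le_natDegree_localPoly (hφ : 2 ≤ φ.natDegree) (v : Place) :
    2 ≤ (P.localPoly φ v).natDegree := by
  rw [natDegree_localPoly]
  exact hφ

variable (φ) in
/-- The local height of `φ` at the place `v`. -/
def localHeight (v : Place) (z : AlgebraicClosure K) : ℝ := (P.localPoly φ v).green (ι v z)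

theorem localHeight_nonneg (hφ : 2 ≤ φ.natDegree) (v : Place) (z : AlgebraicClosure K) :
    0 ≤ P.localHeight ι φ v z :=
  green_nonneg (P.two_le_natDegree_localPoly hφ v) (ι v z)

theorem exists_sum_log_norm_sub_le_local (hφ : 2 ≤ φ.natDegree) {ε : ℝ} (hε : 0 < ε) (v : Place) :
    ∃ A : ℝ, 0 ≤ A ∧ ∀ S : Finset (AlgebraicClosure K),
      ∑ p ∈ S.offDiag, Real.log ‖ι v p.1 - ι v p.2‖ ≤
        2 * S.card * ∑ z ∈ S, P.localHeight ι φ v z -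
          (P.localPoly φ v).robin * S.card ^ 2 + ε * S.card ^ 2 + A := by
  obtain ⟨A, hA0, hA⟩ := exists_sum_log_norm_sub_le (P.two_le_natDegree_localPoly hφ v) hε
  exact ⟨A, hA0, fun S => hA S (ι v) (ι v).injective⟩

/-- The product of the differences of distinct elements of `S`. -/
def differenceProduct (S : Finset (AlgebraicClosure K)) : AlgebraicClosure K :=
  ∏ p ∈ S.offDiag, (p.1 - p.2)

theorem differenceProduct_ne_zero (S : Finset (AlgebraicClosure K)) : differenceProduct S ≠ 0 :=
  Finset.prod_ne_zero_iff.mpr fun _ hp => sub_ne_zero.mpr (Finset.mem_offDiag.mp hp).2.2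

theorem algEquiv_differenceProduct {S : Finset (AlgebraicClosure K)} (hS : IsGaloisStable K S)
    (σ : AlgebraicClosure K ≃ₐ[K] AlgebraicClosure K) :
    σ (differenceProduct S) = differenceProduct S := by
  rw [differenceProduct, map_prod]
  refine Finset.prod_nbij' (fun p => (σ p.1, σ p.2)) (fun p => (σ.symm p.1, σ.symm p.2)) ?_ ?_ ?_ ?_ ?_
  · rintro ⟨a, b⟩ h
    simp only [Finset.mem_offDiag] at h ⊢
    exact ⟨hS σ a h.1, hS σ b h.2.1, σ.injective.ne h.2.2⟩
  · rintro ⟨a, b⟩ h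
    simp only [Finset.mem_offDiag] at h ⊢
    exact ⟨hS σ.symm a h.1, hS σ.symm b h.2.1, σ.symm.injective.ne h.2.2⟩
  · simp
  · simp
  · simp

theorem log_norm_differenceProduct (S : Finset (AlgebraicClosure K)) (v : Place) :
    Real.log ‖ι v (differenceProduct S)‖ =
      ∑ p ∈ S.offDiag, Real.log ‖ι v p.1 - ι v p.2‖ := by
  rw [differenceProduct, map_prod, norm_prod, Real.log_prod]
  · simp_rw [map_sub]
  · intro p hp
    rw [norm_ne_zero_iff, map_sub, sub_ne_zero]
    exact (ι v).injective.ne (Finset.mem_offDiag.mp hp).2.2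

/-- Here log|x-y| ≤ max(log⁺|x|, log⁺|y|) without an additive constant. This matters because the set
of good places that contribute varies with S. -/
theorem sum_log_norm_sub_le_of_good {v : Place} (hφ : 2 ≤ φ.natDegree) (hv : v ∉ P.badPlaces φ)
    (S : Finset (AlgebraicClosure K)) :
    ∑ p ∈ S.offDiag, Real.log ‖ι v p.1 - ι v p.2‖ ≤
      2 * S.card * ∑ z ∈ S, P.localHeight ι φ v z := by
  have := P.isUltrametricDist_Cv (good_of_notMem_badPlaces hv).1
  simp_rw [localHeight, P.green_localPoly_of_good hφ hv]
  calc ∑ p ∈ S.offDiag, Real.log ‖ι v p.1 - ι v p.2‖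
      ≤ ∑ p ∈ S.offDiag, (Real.posLog ‖ι v p.1‖ + Real.posLog ‖ι v p.2‖) := by
        refine Finset.sum_le_sum fun p _ => ?_
        refine (le_max_right 0 _).trans ?_
        change Real.posLog _ ≤ _
        have hmax := IsUltrametricDist.norm_add_le_max (ι v p.1) (-ι v p.2)
        rw [← sub_eq_add_neg, norm_neg] at hmax
        refine (Real.posLog_le_posLog (norm_nonneg _) hmax).trans ?_
        rcases max_cases ‖ι v p.1‖ ‖ι v p.2‖ with h | h <;> rw [h.1]
        · exact le_add_of_nonneg_right Real.posLog_nonneg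
        · exact le_add_of_nonneg_left Real.posLog_nonneg
    _ ≤ ∑ p ∈ S ×ˢ S, (Real.posLog ‖ι v p.1‖ + Real.posLog ‖ι v p.2‖) := by
        refine Finset.sum_le_sum_of_subset_of_nonneg (fun p hp => ?_) fun p _ _ =>
          add_nonneg Real.posLog_nonneg Real.posLog_nonneg
        obtain ⟨h1, h2, -⟩ := Finset.mem_offDiag.mp hp
        exact Finset.mem_product.mpr ⟨h1, h2⟩
    _ = _ := by
        rw [Finset.sum_product]
        simp only [Finset.sum_add_distrib, Finset.sum_const, nsmul_eq_mul]
        rw [← Finset.mul_sum]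
        ring

theorem weight_mul_sum_green_le (hφ : 2 ≤ φ.natDegree) {S : Finset (AlgebraicClosure K)}
    (hS : IsGaloisStable K S) (v : Place) :
    P.weight v * ∑ z ∈ S, P.localHeight ι φ v z ≤
      S.card * P.canonicalHeight ι φ S := by
  classical
  have hfin : ({v} ∪ P.badPlaces φ ∪ ⋃ z ∈ S, {v | 1 < ‖ι v z‖}).Finite :=
    ((Set.finite_singleton v).union (P.finite_badPlaces (ne_zero_of_two_le_natDegree hφ))).union
      (S.finite_toSet.biUnion fun z _ => P.finite_one_lt_norm ι z)
  rcases S.eq_empty_or_nonempty with rfl | hne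
  · simp
  have hcard : (S.card : ℝ) ≠ 0 := by exact_mod_cast hne.card_pos.ne'
  rw [P.canonicalHeight_eq ι hφ hS hfin.toFinset (fun w hw => by simp [hw])
    (fun z hz w hw => by
      rw [Set.Finite.coe_toFinset]
      exact Or.inr (Set.mem_biUnion hz hw)), mul_inv_cancel_left₀ hcard]
  exact Finset.single_le_sum (f := fun v => P.weight v * ∑ z ∈ S, P.localHeight ι φ v z)
    (fun w _ => mul_nonneg (P.weight_pos w).le (Finset.sum_nonneg fun z _ =>
      P.localHeight_nonneg ι hφ w z)) (by simp)

/-- The discrete energy at the place `v` of a finite Galois-stable set of small height is bounded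
by the Robin constant, up to a small error. -/
theorem exists_discreteEnergy_le (hφ : 2 ≤ φ.natDegree) (v : Place) {ε : ℝ} (hε : 0 < ε) :
    ∃ A : ℝ, 0 ≤ A ∧ ∀ S : Finset (AlgebraicClosure K), IsGaloisStable K S →
      -∑ p ∈ S.offDiag, Real.log ‖ι v p.1 - ι v p.2‖ ≤
        (P.localPoly φ v).robin * S.card ^ 2 +
          2 / P.weight v * P.canonicalHeight ι φ S * S.card ^ 2 + ε * S.card ^ 2 + A := by
  classical
  have hφ0 := ne_zero_of_two_le_natDegree hφ
  have hB := P.finite_badPlaces hφ0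
  set B := hB.toFinset
  have hn := P.weight_pos v
  set n := ∑ w ∈ B, P.weight w
  have hn0 : 0 ≤ n := Finset.sum_nonneg fun w _ => (P.weight_pos w).le
  -- Chosen so that the errors at the bad places, of total weight n, add up to at most n_v ε; the 1
  -- keeps the denominator positive.
  set ε' := P.weight v * ε / (1 + n)
  have hε' : 0 < ε' := by positivity
  choose A hA0 hA using fun w => P.exists_sum_log_norm_sub_le_local ι hφ hε' w
  -- Errors appear only at the fixed bad places, which makes A independent of S although the set W
  -- below is not.
  have hT : ∀ w (S : Finset (AlgebraicClosure K)),
      ∑ p ∈ S.offDiag, Real.log ‖ι w p.1 - ι w p.2‖ ≤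
        2 * S.card * ∑ z ∈ S, P.localHeight ι φ w z -
          (P.localPoly φ w).robin * S.card ^ 2 +
            if w ∈ B then ε' * S.card ^ 2 + A w else 0 := by
    intro w S
    split_ifs with hw
    · rw [← add_assoc]
      exact hA w S
    · have hw' : w ∉ P.badPlaces φ := fun h => hw (by simpa [B] using h)
      rw [P.robin_eq_zero_of_good hw', zero_mul, sub_zero, add_zero]
      exact P.sum_log_norm_sub_le_of_good ι hφ hw' S
  refine ⟨(∑ w ∈ B, P.weight w * A w) / P.weight v,
    div_nonneg (Finset.sum_nonneg fun w _ => mul_nonneg (P.weight_pos w).le (hA0 w)) hn.le,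
    fun S hS => ?_⟩
  have hfin : ({v} ∪ P.badPlaces φ ∪ (⋃ z ∈ S, {v | 1 < ‖ι v z‖}) ∪
      {v | ‖ι v (differenceProduct S)‖ ≠ 1}).Finite :=
    (((Set.finite_singleton v).union hB).union
      (S.finite_toSet.biUnion fun z _ => P.finite_one_lt_norm ι z)).union
        (P.finite_norm_ne_one ι (differenceProduct_ne_zero S))
  set W := hfin.toFinset
  have hvW : v ∈ W := by simp [W]
  have hBW : B ⊆ W := fun w hw => by
    have : w ∈ P.badPlaces φ := by simpa [B] using hw
    simp [W, this]
  have hht := P.canonicalHeight_eq ι hφ hS W (fun w hw => by simp [W, hw])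
    (fun z hz w hw => by
      rw [Set.Finite.coe_toFinset]
      exact Or.inl (Or.inr (Set.mem_biUnion hz hw)))
  have hprod := P.sum_weight_mul_log_norm ι (differenceProduct_ne_zero S)
    (algEquiv_differenceProduct hS) W (fun w hw => by
      rw [Set.Finite.coe_toFinset]
      exact Or.inr hw)
  simp_rw [log_norm_differenceProduct] at hprod
  set N : ℝ := (S.card : ℝ) with hN
  set T : Place → ℝ := fun w => ∑ p ∈ S.offDiag, Real.log ‖ι w p.1 - ι w p.2‖
  set G : Place → ℝ := fun w => ∑ z ∈ S, P.localHeight ι φ w z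
  set V : Place → ℝ := fun w => (P.localPoly φ w).robin
  have hG : ∀ w, 0 ≤ G w := fun w => Finset.sum_nonneg fun z _ => P.localHeight_nonneg ι hφ w z
  have hV : ∑ w ∈ W, P.weight w * V w = 0 := by
    have h1 := P.sum_weight_mul_log_abv (leadingCoeff_ne_zero.mpr hφ0) W
      fun w hw => hBW (hB.mem_toFinset.mpr (Or.inr hw))
    have h2 : ∀ w, P.weight w * V w =
        (P.weight w * Real.log (P.abv w φ.leadingCoeff)) / (φ.natDegree - 1) := fun w => by
      simp only [V, robin, natDegree_localPoly, norm_leadingCoeff_localPoly]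
      ring
    simp_rw [h2]
    rw [← Finset.sum_div, h1, zero_div]
  have hNh : ∑ w ∈ W, P.weight w * G w = N * P.canonicalHeight ι φ S := by
    rcases S.eq_empty_or_nonempty with rfl | hne
    · simp [G, N]
    · have hcard : N ≠ 0 := by
        rw [hN]
        exact_mod_cast hne.card_pos.ne'
      rw [hht, mul_inv_cancel_left₀ hcard]
      rfl
  rw [← Finset.add_sum_erase W _ hvW] at hprod hV hNh
  have hsum : ∑ w ∈ W.erase v, P.weight w * T w ≤
      2 * N * ∑ w ∈ W.erase v, P.weight w * G w - N ^ 2 * ∑ w ∈ W.erase v, P.weight w * V w +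
        ∑ w ∈ B, P.weight w * (ε' * N ^ 2 + A w) := by
    calc ∑ w ∈ W.erase v, P.weight w * T w
        ≤ ∑ w ∈ W.erase v, P.weight w * (2 * N * G w - V w * N ^ 2 +
            if w ∈ B then ε' * N ^ 2 + A w else 0) :=
          Finset.sum_le_sum fun w _ => mul_le_mul_of_nonneg_left (hT w S) (P.weight_pos w).le
      _ = 2 * N * ∑ w ∈ W.erase v, P.weight w * G w - N ^ 2 * ∑ w ∈ W.erase v, P.weight w * V w +
            ∑ w ∈ W.erase v, (if w ∈ B then P.weight w * (ε' * N ^ 2 + A w) else 0) := by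
          rw [Finset.mul_sum, Finset.mul_sum, ← Finset.sum_sub_distrib, ← Finset.sum_add_distrib]
          refine Finset.sum_congr rfl fun w _ => ?_
          split_ifs <;> ring
      _ ≤ _ := by
          rw [← Finset.sum_filter]
          refine add_le_add le_rfl (Finset.sum_le_sum_of_subset_of_nonneg
            (fun w hw => (Finset.mem_filter.mp hw).2) fun w _ _ =>
              mul_nonneg (P.weight_pos w).le (add_nonneg (by positivity) (hA0 w)))
  have hε2 : ∑ w ∈ B, P.weight w * (ε' * N ^ 2 + A w) ≤
      P.weight v * ε * N ^ 2 + ∑ w ∈ B, P.weight w * A w := by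
    simp_rw [mul_add]
    rw [Finset.sum_add_distrib, ← Finset.sum_mul]
    have h1 : n * ε' ≤ P.weight v * ε := by
      rw [mul_div_assoc', div_le_iff₀ (by positivity)]
      nlinarith [mul_pos hn hε]
    have h2 : 0 ≤ N ^ 2 := by positivity
    nlinarith
  have hkey : P.weight v * -T v ≤ P.weight v * (V v * N ^ 2 +
      2 / P.weight v * P.canonicalHeight ι φ S * N ^ 2 + ε * N ^ 2 +
        (∑ w ∈ B, P.weight w * A w) / P.weight v) := by
    have h1 : P.weight v * (V v * N ^ 2 +
      2 / P.weight v * P.canonicalHeight ι φ S * N ^ 2 + ε * N ^ 2 +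
        (∑ w ∈ B, P.weight w * A w) / P.weight v) = P.weight v * V v * N ^ 2 +
        2 * N * (N * P.canonicalHeight ι φ S) + P.weight v * ε * N ^ 2 +
          ∑ w ∈ B, P.weight w * A w := by field_simp
    rw [h1, ← hNh]
    -- The places other than v use only part of the height; the nonnegative share of v is given
    -- away.
    have h2 : 0 ≤ 2 * N * (P.weight v * G v) :=
      mul_nonneg (by positivity) (mul_nonneg hn.le (hG v))
    have h3 : N ^ 2 * ∑ w ∈ W.erase v, P.weight w * V w = -(N ^ 2 * (P.weight v * V v)) := by
      rw [← mul_neg]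
      congr 1
      linarith
    linarith
  exact le_of_mul_le_mul_left hkey hn

end ProductFormulaField

/-! ### Logarithmic energies on bounded metric spaces -/

theorem map_pi_pair {Ω : Type*} [MeasurableSpace Ω] (μ : Measure Ω) [IsProbabilityMeasure μ] {N : ℕ} {i j : Fin N} (hij : i ≠ j) :
    (Measure.pi fun _ : Fin N => μ).map (fun x => (x i, x j)) = μ.prod μ := by
  have h1 := ProbabilityTheory.iIndepFun_pi (μ := fun _ : Fin N => μ) (X := fun _ y => y)
    fun _ => aemeasurable_id
  have h2 := (h1.indepFun hij).map_prod_eq_prod_map_map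
    (measurable_pi_apply i).aemeasurable (measurable_pi_apply j).aemeasurable
  rw [h2]
  have h3 : ∀ k : Fin N, (Measure.pi fun _ : Fin N => μ).map (fun x => x k) = μ := fun k =>
    (measurePreserving_eval (fun _ : Fin N => μ) k).map_eq
  rw [h3, h3]

section LogEnergy

variable {Y : Type u} [MetricSpace Y]

/-- The kernel `log (D / d(x, y))`, equal to `∞` on the diagonal. -/
def logKer (D : ℝ) (x y : Y) : ℝ≥0∞ :=
  if dist x y = 0 then ⊤ else ENNReal.ofReal (Real.log (D / dist x y))

theorem logKernel_eq_top_of_dist_eq_zero {x y : Y} (h : dist x y = 0) : logKernel x y = ⊤ := by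
  rw [logKernel, edist_dist, h, ENNReal.ofReal_zero, ENNReal.log_zero, EReal.neg_bot]

theorem logKernel_eq_of_dist_ne_zero {x y : Y} (h : dist x y ≠ 0) :
    logKernel x y = ((-Real.log (dist x y) : ℝ) : EReal) := by
  rw [logKernel, edist_dist, ENNReal.log_ofReal_of_pos (lt_of_le_of_ne dist_nonneg h.symm),
    EReal.coe_neg]

theorem logKer_comm (D : ℝ) (x y : Y) : logKer D x y = logKer D y x := by
  rw [logKer, logKer, dist_comm]

/-- Stated with sums on both sides so that it survives the diagonal, where both sides are ∞ and no
difference makes sense. -/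
theorem toENNReal_logKernel_add {D : ℝ} (hD1 : 1 ≤ D) {x y : Y} (hD : dist x y ≤ D) :
    (logKernel x y).toENNReal + ENNReal.ofReal (Real.log D) =
      logKer D x y + (-logKernel x y).toENNReal := by
  by_cases h : dist x y = 0
  · rw [logKernel_eq_top_of_dist_eq_zero h, logKer, if_pos h]
    simp
  · have hpos : 0 < dist x y := lt_of_le_of_ne dist_nonneg (Ne.symm h)
    rw [logKernel_eq_of_dist_ne_zero h, logKer, if_neg h, ← EReal.coe_neg,
      EReal.real_coe_toENNReal, EReal.real_coe_toENNReal, neg_neg,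
      Real.log_div (by linarith) h]
    have h1 := Real.log_le_log hpos hD
    have h2 := Real.log_nonneg hD1
    rcases le_total 0 (Real.log (dist x y)) with h3 | h3
    · rw [ENNReal.ofReal_of_nonpos (by linarith : -Real.log (dist x y) ≤ 0), zero_add,
        ← ENNReal.ofReal_add (by linarith) h3]
      congr 1
      ring
    · rw [ENNReal.ofReal_of_nonpos h3, add_zero, ← ENNReal.ofReal_add (by linarith) h2]
      congr 1
      ring

/-- If two points coincide the right side is ∞; otherwise this is the logarithm of the hypothesis.
-/
theorem ofReal_le_sum_logKer {D : ℝ} (hD0 : 0 < D) (hD : ∀ x y : Y, dist x y ≤ D) {N : ℕ} {B : ℝ}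
    (x : Fin N → Y) (hx : ∏ i, ∏ j ∈ {i}ᶜ, dist (x j) (x i) ≤ Real.exp B) :
    ENNReal.ofReal (N * (N - 1) * Real.log D - B) ≤
      ∑ i : Fin N, ∑ j ∈ {i}ᶜ, logKer D (x j) (x i) := by
  by_cases hinj : ∃ i, ∃ j ∈ ({i}ᶜ : Finset (Fin N)), dist (x j) (x i) = 0
  · obtain ⟨i, j, hj, h0⟩ := hinj
    have h1 : logKer D (x j) (x i) = ⊤ := by rw [logKer, if_pos h0]
    have h2 : ∑ i : Fin N, ∑ j ∈ {i}ᶜ, logKer D (x j) (x i) = ⊤ :=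
      ENNReal.sum_eq_top.mpr ⟨i, Finset.mem_univ _, ENNReal.sum_eq_top.mpr ⟨j, hj, h1⟩⟩
    rw [h2]
    exact le_top
  · push Not at hinj
    have hpos : ∀ i, ∀ j ∈ ({i}ᶜ : Finset (Fin N)), 0 < dist (x j) (x i) := fun i j hj =>
      lt_of_le_of_ne dist_nonneg (Ne.symm (hinj i j hj))
    have h1 : ∑ i : Fin N, ∑ j ∈ {i}ᶜ, logKer D (x j) (x i) = ENNReal.ofReal
        (∑ i : Fin N, ∑ j ∈ {i}ᶜ, (Real.log D - Real.log (dist (x j) (x i)))) := by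
      have h2 : ∀ i, ∀ j ∈ ({i}ᶜ : Finset (Fin N)),
          0 ≤ Real.log D - Real.log (dist (x j) (x i)) := fun i j hj =>
        sub_nonneg.mpr (Real.log_le_log (hpos i j hj) (hD _ _))
      rw [ENNReal.ofReal_sum_of_nonneg fun i _ => Finset.sum_nonneg (h2 i)]
      refine Finset.sum_congr rfl fun i _ => ?_
      rw [ENNReal.ofReal_sum_of_nonneg (h2 i)]
      refine Finset.sum_congr rfl fun j hj => ?_
      rw [logKer, if_neg (hinj i j hj), Real.log_div hD0.ne' (hinj i j hj)]
    rw [h1]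
    refine ENNReal.ofReal_le_ofReal ?_
    have h3 : ∑ i : Fin N, ∑ j ∈ {i}ᶜ, Real.log (dist (x j) (x i)) ≤ B := by
      have h4 := Real.log_le_log (Finset.prod_pos fun i _ => Finset.prod_pos (hpos i)) hx
      rw [Real.log_exp, Real.log_prod fun i _ => (Finset.prod_pos (hpos i)).ne'] at h4
      refine le_trans (le_of_eq ?_) h4
      exact Finset.sum_congr rfl fun i _ => (Real.log_prod fun j hj => (hpos i j hj).ne').symm
    have h5 : ∀ i : Fin N, (({i}ᶜ : Finset (Fin N)).card : ℝ) = N - 1 := fun i => by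
      rw [Finset.card_compl, Finset.card_singleton, Fintype.card_fin, Nat.cast_pred i.pos]
    simp only [Finset.sum_sub_distrib, Finset.sum_const, nsmul_eq_mul, h5, Finset.card_univ,
      Fintype.card_fin]
    linarith

variable [MeasurableSpace Y] [BorelSpace Y] [SecondCountableTopology Y]

theorem measurable_logKer (D : ℝ) : Measurable fun p : Y × Y => logKer D p.1 p.2 := by
  unfold logKer
  refine Measurable.ite ?_ measurable_const (by fun_prop)
  exact (isClosed_eq continuous_dist continuous_const).measurableSet

theorem measurable_logKernel : Measurable fun p : Y × Y => logKernel p.1 p.2 := by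
  unfold logKernel
  have h : Measurable fun p : Y × Y => edist p.1 p.2 := continuous_edist.measurable
  fun_prop

/-- The mutual energy of two measures for the kernel `log (D / d(x, y))`. -/
def logEnergy (D : ℝ) (μ ν : Measure Y) : ℝ≥0∞ := ∫⁻ p, logKer D p.1 p.2 ∂(μ.prod ν)

/-- Normalizing by the diameter bound D makes the kernel nonnegative, so energies become lower
Lebesgue integrals and minimizers are unchanged. -/
theorem energy_eq_logEnergy_sub {D : ℝ} (hD1 : 1 ≤ D) (hD : ∀ x y : Y, dist x y ≤ D)
    (μ : Measure Y) [IsProbabilityMeasure μ] :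
    energy μ = (logEnergy D μ μ : EReal) - (Real.log D : EReal) := by
  have hm1 : Measurable fun p : Y × Y => (logKernel p.1 p.2).toENNReal :=
    measurable_logKernel.ereal_toENNReal
  have hm2 : Measurable fun p : Y × Y => (-logKernel p.1 p.2).toENNReal :=
    measurable_logKernel.neg.ereal_toENNReal
  rw [energy, ← lintegral_prod (fun p : Y × Y => (logKernel p.1 p.2).toENNReal) hm1.aemeasurable,
    ← lintegral_prod (fun p : Y × Y => (-logKernel p.1 p.2).toENNReal) hm2.aemeasurable]
  set a := ∫⁻ p, (logKernel p.1 p.2).toENNReal ∂(μ.prod μ)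
  set b := ∫⁻ p, (-logKernel p.1 p.2).toENNReal ∂(μ.prod μ)
  have hlog := Real.log_nonneg hD1
  have h1 : a + ENNReal.ofReal (Real.log D) = logEnergy D μ μ + b := by
    have h2 : ∫⁻ p : Y × Y, ((logKernel p.1 p.2).toENNReal + ENNReal.ofReal (Real.log D))
        ∂(μ.prod μ) = ∫⁻ p : Y × Y, (logKer D p.1 p.2 + (-logKernel p.1 p.2).toENNReal)
          ∂(μ.prod μ) :=
      lintegral_congr fun p => toENNReal_logKernel_add hD1 (hD _ _)
    rw [lintegral_add_left hm1, lintegral_add_left (measurable_logKer D), lintegral_const,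
      measure_univ, mul_one] at h2
    exact h2
  have hb : b ≠ ⊤ := by
    refine ne_top_of_le_ne_top (ENNReal.ofReal_ne_top (r := Real.log D)) ?_
    calc b ≤ ∫⁻ _ : Y × Y, ENNReal.ofReal (Real.log D) ∂(μ.prod μ) := by
          refine lintegral_mono fun p => ?_
          by_cases h : dist p.1 p.2 = 0
          · rw [logKernel_eq_top_of_dist_eq_zero h]
            simp
          · rw [logKernel_eq_of_dist_ne_zero h, ← EReal.coe_neg, EReal.real_coe_toENNReal, neg_neg]
            exact ENNReal.ofReal_le_ofReal
              (Real.log_le_log (lt_of_le_of_ne dist_nonneg (Ne.symm h)) (hD _ _))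
      _ = _ := by rw [lintegral_const, measure_univ, mul_one]
  by_cases ha : a = ⊤
  · have h2 : logEnergy D μ μ = ⊤ := by
      rw [ha, top_add] at h1
      exact (WithTop.add_eq_top.mp h1.symm).resolve_right hb
    rw [ha, h2, EReal.coe_ennreal_top, EReal.top_sub_coe]
    clear_value b
    lift b to NNReal using hb
    rfl
  · have h2 : logEnergy D μ μ ≠ ⊤ := fun h => by
      rw [h, top_add] at h1
      exact (ENNReal.add_ne_top.mpr ⟨ha, ENNReal.ofReal_ne_top⟩) h1
    have h3 := congrArg ENNReal.toReal h1
    rw [ENNReal.toReal_add ha ENNReal.ofReal_ne_top, ENNReal.toReal_add h2 hb,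
      ENNReal.toReal_ofReal hlog] at h3
    rw [← EReal.coe_ennreal_toReal ha, ← EReal.coe_ennreal_toReal hb, ← EReal.coe_ennreal_toReal h2,
      ← EReal.coe_sub, ← EReal.coe_sub]
    congr 1
    linarith

theorem energy_le_energy_iff {D : ℝ} (hD1 : 1 ≤ D) (hD : ∀ x y : Y, dist x y ≤ D)
    (μ ν : Measure Y) [IsProbabilityMeasure μ] [IsProbabilityMeasure ν] :
    energy μ ≤ energy ν ↔ logEnergy D μ μ ≤ logEnergy D ν ν := by
  rw [energy_eq_logEnergy_sub hD1 hD, energy_eq_logEnergy_sub hD1 hD,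
    ← EReal.coe_ennreal_le_coe_ennreal_iff]
  constructor
  · intro h
    have := add_le_add_left h (Real.log D : EReal)
    rwa [EReal.sub_add_cancel, EReal.sub_add_cancel] at this
  · intro h
    exact EReal.sub_le_sub h le_rfl

/-! ### A lower bound for the energy by sampling -/

theorem lintegral_sum_logKer (D : ℝ) (μ : Measure Y) [IsProbabilityMeasure μ] (N : ℕ) :
    ∫⁻ x, ∑ i : Fin N, ∑ j ∈ {i}ᶜ, logKer D (x j) (x i) ∂(Measure.pi fun _ : Fin N => μ) =
      ∑ i : Fin N, ∑ _j ∈ ({i}ᶜ : Finset (Fin N)), logEnergy D μ μ := by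
  have hm : ∀ i j : Fin N, Measurable fun x : Fin N → Y => logKer D (x j) (x i) := fun i j =>
    (measurable_logKer D).comp ((measurable_pi_apply j).prodMk (measurable_pi_apply i))
  rw [lintegral_finsetSum _ fun i _ => Finset.measurable_sum _ fun j _ => hm i j]
  refine Finset.sum_congr rfl fun i _ => ?_
  rw [lintegral_finsetSum _ fun j _ => hm i j]
  refine Finset.sum_congr rfl fun j hj => ?_
  have hij : j ≠ i := by simpa using hj
  rw [logEnergy, ← map_pi_pair μ hij, lintegral_map (measurable_logKer D) (by fun_prop)]

/-- Average the discrete energy over N independent μ-random points: each ordered pair contributes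
the energy of μ, and the pointwise bound holds for every sample. Divide by N² and let N → ∞, then ε
→ 0. -/
theorem le_logEnergy {D V : ℝ} (hD1 : 1 ≤ D) (hD : ∀ x y : Y, dist x y ≤ D)
    (hV : ∀ ε > 0, ∃ A : ℝ, ∀ (N : ℕ) (x : Fin N → Y),
      ∏ i, ∏ j ∈ {i}ᶜ, dist (x j) (x i) ≤ Real.exp (-V * N ^ 2 + ε * N ^ 2 + A))
    (μ : Measure Y) [IsProbabilityMeasure μ] :
    ENNReal.ofReal (Real.log D + V) ≤ logEnergy D μ μ := by
  by_cases htop : logEnergy D μ μ = ⊤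
  · rw [htop]
    exact le_top
  rw [ENNReal.ofReal_le_iff_le_toReal htop]
  refine le_of_forall_pos_le_add fun ε hε => ?_
  obtain ⟨A, hA⟩ := hV ε hε
  set J := (logEnergy D μ μ).toReal
  have hJ : 0 ≤ J := ENNReal.toReal_nonneg
  have h1 : ∀ N : ℕ, 0 < N →
      Real.log D * (1 - (N : ℝ)⁻¹) + V - ε - A * ((N : ℝ)⁻¹ * (N : ℝ)⁻¹) ≤ J := by
    intro N hN
    have hN0 : (0 : ℝ) < N := by exact_mod_cast hN
    have h2 : ENNReal.ofReal (N * (N - 1) * Real.log D - (-V * N ^ 2 + ε * N ^ 2 + A)) ≤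
        ∑ i : Fin N, ∑ _j ∈ ({i}ᶜ : Finset (Fin N)), logEnergy D μ μ := by
      rw [← lintegral_sum_logKer]
      calc _ = ∫⁻ _ : Fin N → Y, ENNReal.ofReal
            (N * (N - 1) * Real.log D - (-V * N ^ 2 + ε * N ^ 2 + A))
              ∂(Measure.pi fun _ : Fin N => μ) := by
            rw [lintegral_const, measure_univ, mul_one]
        _ ≤ _ := lintegral_mono fun x => ofReal_le_sum_logKer (by linarith) hD x (hA N x)
    have h3 : ∑ i : Fin N, ∑ _j ∈ ({i}ᶜ : Finset (Fin N)), logEnergy D μ μ ≤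
        ENNReal.ofReal (N * (N * J)) := by
      have h4 : logEnergy D μ μ = ENNReal.ofReal J := (ENNReal.ofReal_toReal htop).symm
      simp only [Finset.sum_const, nsmul_eq_mul, Finset.card_univ, Fintype.card_fin,
        Finset.card_compl, Finset.card_singleton]
      rw [h4, ENNReal.ofReal_mul hN0.le, ENNReal.ofReal_mul hN0.le, ENNReal.ofReal_natCast]
      gcongr
      exact Nat.sub_le N 1
    have h5 := (ENNReal.ofReal_le_ofReal_iff (by positivity)).mp (h2.trans h3)
    have h6 : (N : ℝ) ^ 2 * (Real.log D * (1 - (N : ℝ)⁻¹) + V - ε - A * ((N : ℝ)⁻¹ * (N : ℝ)⁻¹)) ≤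
        (N : ℝ) ^ 2 * J := by
      refine le_trans (le_of_eq ?_) (h5.trans (le_of_eq (by ring)))
      field_simp
      ring
    exact le_of_mul_le_mul_left h6 (by positivity)
  have hlim : Tendsto (fun N : ℕ => Real.log D * (1 - (N : ℝ)⁻¹) + V - ε -
      A * ((N : ℝ)⁻¹ * (N : ℝ)⁻¹)) atTop
      (𝓝 (Real.log D * (1 - 0) + V - ε - A * (0 * 0))) := by
    have h0 := tendsto_inv_atTop_nhds_zero_nat (𝕜 := ℝ)
    exact ((((h0.const_sub 1).const_mul _).add_const V).sub_const ε).sub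
      ((h0.mul h0).const_mul A)
  have := le_of_tendsto hlim ((eventually_gt_atTop 0).mono h1)
  linarith

/-! ### Energies of weak limits -/

/-- The truncated kernel `log (D / max (d(x, y)) r)` as a continuous function. -/
def truncatedKer [CompactSpace Y] (D r : ℝ) (hr : 0 < r) : Y × Y →ᵇ ℝ :=
  BoundedContinuousFunction.mkOfCompact
    ⟨fun p => Real.log D - Real.log (max (dist p.1 p.2) r), by
      refine continuous_const.sub (Continuous.log (by fun_prop) fun p => ?_)
      exact (lt_max_of_lt_right hr).ne'⟩

/-- Truncated kernels are continuous, so their integrals pass to the weak limit of the product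
measures; Fatou's lemma then removes the truncation. Truncation also keeps the diagonal mass of
discrete measures finite. -/
theorem logEnergy_le_of_tendsto [CompactSpace Y] {D v : ℝ} (hD0 : 0 < D)
    (hD : ∀ x y : Y, dist x y ≤ D) {l : Filter ℕ} [l.NeBot] {μs : ℕ → ProbabilityMeasure Y}
    {μ : ProbabilityMeasure Y} (hlim : Tendsto μs l (𝓝 μ))
    (h : ∀ (r : ℝ) (hr : 0 < r), r ≤ D → ∀ ε > 0, ∀ᶠ n in l,
      ∫ p, truncatedKer D r hr p ∂((μs n : Measure Y).prod (μs n)) ≤ v + ε) :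
    logEnergy D (μ : Measure Y) μ ≤ ENNReal.ofReal v := by
  have hprod : Tendsto (fun n => (μs n).prod (μs n)) l (𝓝 (μ.prod μ)) :=
    (ProbabilityMeasure.continuous_prod.tendsto (μ, μ)).comp (hlim.prodMk_nhds hlim)
  have h1 : ∀ (r : ℝ) (hr : 0 < r), r ≤ D →
      ∫⁻ p, ENNReal.ofReal (truncatedKer D r hr p) ∂((μ : Measure Y).prod μ) ≤
        ENNReal.ofReal v := by
    intro r hr hrD
    have h2 : ∫ p, truncatedKer D r hr p ∂((μ : Measure Y).prod μ) ≤ v := by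
      refine le_of_forall_pos_le_add fun ε hε => ?_
      exact le_of_tendsto (ProbabilityMeasure.tendsto_iff_forall_integral_tendsto.mp hprod
        (truncatedKer D r hr)) (h r hr hrD ε hε)
    rw [← ofReal_integral_eq_lintegral_ofReal]
    · exact ENNReal.ofReal_le_ofReal h2
    · exact BoundedContinuousFunction.integrable _ _
    · refine Eventually.of_forall fun p => ?_
      exact sub_nonneg.mpr (Real.log_le_log (lt_max_of_lt_right hr) (max_le (hD _ _) hrD))
  set r : ℕ → ℝ := fun k => D / (k + 1)
  have hr : ∀ k, 0 < r k := fun k => by positivity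
  have hrD : ∀ k, r k ≤ D := fun k => div_le_self hD0.le (by linarith [(Nat.cast_nonneg k : (0:ℝ) ≤ k)])
  have hr0 : Tendsto r atTop (𝓝 0) := by
    have := (tendsto_one_div_add_atTop_nhds_zero_nat (𝕜 := ℝ)).const_mul D
    rw [mul_zero] at this
    exact this.congr fun k => by simp [r, div_eq_mul_inv]
  have h3 : ∀ p : Y × Y, Tendsto (fun k => ENNReal.ofReal (truncatedKer D (r k) (hr k) p)) atTop
      (𝓝 (logKer D p.1 p.2)) := by
    intro p
    change Tendsto (fun k => ENNReal.ofReal (Real.log D - Real.log (max (dist p.1 p.2) (r k))))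
      atTop _
    by_cases h0 : dist p.1 p.2 = 0
    · rw [logKer, if_pos h0, h0]
      refine ENNReal.tendsto_ofReal_atTop.comp ?_
      have h4 : Tendsto (fun k => -Real.log (r k)) atTop atTop :=
        tendsto_neg_atBot_atTop.comp (Real.tendsto_log_nhdsGT_zero.comp
          (tendsto_nhdsWithin_iff.mpr ⟨hr0, Eventually.of_forall hr⟩))
      refine (tendsto_atTop_add_const_left atTop (Real.log D) h4).congr fun k => ?_
      rw [max_eq_right (hr k).le, sub_eq_add_neg]
    · have hpos : 0 < dist p.1 p.2 := lt_of_le_of_ne dist_nonneg (Ne.symm h0)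
      rw [logKer, if_neg h0, Real.log_div hD0.ne' h0]
      refine tendsto_const_nhds.congr' ?_
      filter_upwards [hr0.eventually_lt_const hpos] with k hk
      rw [max_eq_left hk.le]
  calc logEnergy D (μ : Measure Y) μ
      = ∫⁻ p, liminf (fun k => ENNReal.ofReal (truncatedKer D (r k) (hr k) p)) atTop
          ∂((μ : Measure Y).prod μ) := lintegral_congr fun p => (h3 p).liminf_eq.symm
    _ ≤ liminf (fun k => ∫⁻ p, ENNReal.ofReal (truncatedKer D (r k) (hr k) p)
          ∂((μ : Measure Y).prod μ)) atTop :=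
        lintegral_liminf_le fun k =>
          ENNReal.measurable_ofReal.comp (truncatedKer D (r k) (hr k)).continuous.measurable
    _ ≤ ENNReal.ofReal v := by
        refine liminf_le_of_le (by isBoundedDefault) fun b hb => ?_
        obtain ⟨k, hk⟩ := hb.exists
        exact hk.trans (h1 _ _ (hrD k))

/-! ### Uniqueness of the minimizer -/

theorem logEnergy_comm (D : ℝ) (μ ν : Measure Y) [SFinite μ] [SFinite ν] :
    logEnergy D μ ν = logEnergy D ν μ := by
  rw [logEnergy, logEnergy, ← Measure.prod_swap, lintegral_map (measurable_logKer D) measurable_swap]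
  exact lintegral_congr fun p => logKer_comm _ _ _

variable (Y) in
/-- Strict convexity of the logarithmic energy: a probability measure is determined among those of
energy at most `v` by having mutual energy at least `v`. -/
def StrictlyConvexEnergy (D : ℝ) : Prop :=
  ∀ (μ ν : Measure Y) [IsProbabilityMeasure μ] [IsProbabilityMeasure ν] (v : ℝ≥0∞), v ≠ ⊤ →
    logEnergy D μ μ ≤ v → logEnergy D ν ν ≤ v → v ≤ logEnergy D μ ν → μ = ν

/-- The midpoint of μ and ν has energy (I(μ) + 2I(μ,ν) + I(ν))/4. Minimality bounds this below by v,
which forces I(μ,ν) ≥ v. -/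
theorem StrictlyConvexEnergy.eq_of_minimal {D : ℝ} (hconv : StrictlyConvexEnergy Y D) {v : ℝ≥0∞}
    (hv : v ≠ ⊤) (hmin : ∀ (m : Measure Y) [IsProbabilityMeasure m], v ≤ logEnergy D m m)
    (μ ν : Measure Y) [IsProbabilityMeasure μ] [IsProbabilityMeasure ν]
    (hμ : logEnergy D μ μ ≤ v) (hν : logEnergy D ν ν ≤ v) : μ = ν := by
  refine hconv μ ν v hv hμ hν ?_
  set m : Measure Y := (2⁻¹ : ℝ≥0∞) • (μ + ν)
  have : IsProbabilityMeasure m := ⟨by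
    simp only [m, Measure.smul_apply, Measure.add_apply, measure_univ, smul_eq_mul]
    rw [one_add_one_eq_two, ENNReal.inv_mul_cancel (by simp) (by simp)]⟩
  have h1 : logEnergy D m m = 2⁻¹ * (2⁻¹ * (logEnergy D μ μ + logEnergy D μ ν +
      (logEnergy D μ ν + logEnergy D ν ν))) := by
    rw [logEnergy, Measure.prod_smul_left, Measure.prod_smul_right, lintegral_smul_measure,
      lintegral_smul_measure, Measure.prod_add, Measure.add_prod, Measure.add_prod,
      lintegral_add_measure, lintegral_add_measure, lintegral_add_measure]
    change _ * (_ * (logEnergy D μ μ + logEnergy D ν μ + (logEnergy D μ ν + logEnergy D ν ν))) = _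
    rw [logEnergy_comm D ν μ]
  have h2 := hmin m
  rw [h1] at h2
  by_contra hlt
  push Not at hlt
  set b := logEnergy D μ ν
  have hb : b ≠ ⊤ := ne_top_of_lt hlt
  have h3 : v ≤ 2⁻¹ * (2⁻¹ * (v + b + (b + v))) := by
    refine h2.trans ?_
    gcongr
  lift v to NNReal using hv
  clear_value b
  lift b to NNReal using hb
  have h4 : (v : ℝ) ≤ 2⁻¹ * (2⁻¹ * (v + b + (b + v))) := by
    have h5 := ENNReal.toReal_mono (by finiteness) h3
    simpa [ENNReal.toReal_mul, ENNReal.toReal_add] using h5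
  have h6 : (b : ℝ) < v := by exact_mod_cast hlt
  linarith

end LogEnergy

/-! ### Strict convexity of the logarithmic energy -/

theorem lintegral_ofReal_inv_Ioc_of_pos {a b : ℝ} (ha : 0 < a) (hab : a ≤ b) :
    ∫⁻ r in Set.Ioc a b, ENNReal.ofReal r⁻¹ = ENNReal.ofReal (Real.log (b / a)) := by
  have h0 : (0 : ℝ) ∉ Set.uIcc a b := fun h => by
    rw [Set.uIcc_of_le hab] at h
    exact absurd h.1 (not_le.mpr ha)
  rw [← integral_inv h0, intervalIntegral.integral_of_le hab, ofReal_integral_eq_lintegral_ofReal]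
  · exact (intervalIntegrable_iff_integrableOn_Ioc_of_le hab).mp
      (intervalIntegral.intervalIntegrable_inv (fun x hx h => h0 (h ▸ hx)) continuousOn_id)
  · refine (ae_restrict_iff' measurableSet_Ioc).mpr (Eventually.of_forall fun r hr => ?_)
    exact inv_nonneg.mpr (ha.trans hr.1).le

theorem lintegral_ofReal_inv_Ioc_zero {b : ℝ} (hb : 0 < b) :
    ∫⁻ r in Set.Ioc 0 b, ENNReal.ofReal r⁻¹ = ⊤ := by
  refine ENNReal.eq_top_of_forall_nnreal_le fun M => ?_
  have ha : 0 < b * Real.exp (-M) := by positivity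
  have hab : b * Real.exp (-M) ≤ b :=
    mul_le_of_le_one_right hb.le (Real.exp_le_one_iff.mpr (by simp))
  calc (M : ℝ≥0∞) = ENNReal.ofReal (Real.log (b / (b * Real.exp (-M)))) := by
        rw [div_mul_cancel_left₀ hb.ne', ← Real.exp_neg, neg_neg, Real.log_exp,
          ENNReal.ofReal_coe_nnreal]
    _ = ∫⁻ r in Set.Ioc (b * Real.exp (-M)) b, ENNReal.ofReal r⁻¹ :=
        (lintegral_ofReal_inv_Ioc_of_pos ha hab).symm
    _ ≤ _ := lintegral_mono_set (Set.Ioc_subset_Ioc_left ha.le)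

section Mixture

variable {Y : Type u} [MetricSpace Y] [MeasurableSpace Y]

/-- If the kernel is a mixture of positive definite kernels, then equality of the mutual energies
forces equality for almost all kernels in the mixture. -/
theorem ae_eq_of_mixture {Θ : Type*} [MeasurableSpace Θ] {θ : Measure Θ} [SFinite θ]
    {D : ℝ} {k : Θ → Y × Y → ℝ≥0∞} (hk : Measurable (Function.uncurry k))
    (hmix : ∀ p : Y × Y, ∫⁻ t, k t p ∂θ = logKer D p.1 p.2)
    (μ ν : Measure Y) [IsProbabilityMeasure μ] [IsProbabilityMeasure ν] {v : ℝ≥0∞} (hv : v ≠ ⊤)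
    (hpos : ∀ᵐ t ∂θ, 2 * ∫⁻ p, k t p ∂(μ.prod ν) ≤
      ∫⁻ p, k t p ∂(μ.prod μ) + ∫⁻ p, k t p ∂(ν.prod ν))
    (hμ : logEnergy D μ μ ≤ v) (hν : logEnergy D ν ν ≤ v) (hμν : v ≤ logEnergy D μ ν) :
    ∀ᵐ t ∂θ, 2 * ∫⁻ p, k t p ∂(μ.prod ν) =
      ∫⁻ p, k t p ∂(μ.prod μ) + ∫⁻ p, k t p ∂(ν.prod ν) := by
  have hswap : ∀ m : Measure (Y × Y), SFinite m →
      ∫⁻ t, ∫⁻ p, k t p ∂m ∂θ = ∫⁻ p, logKer D p.1 p.2 ∂m := fun m _ => by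
    rw [lintegral_lintegral_swap hk.aemeasurable]
    exact lintegral_congr fun p => hmix p
  have hmeas : ∀ m : Measure (Y × Y), SFinite m → Measurable fun t => ∫⁻ p, k t p ∂m :=
    fun m _ => hk.lintegral_prod_right
  -- Pointwise one integrand is below the other, while both integrals are squeezed to the finite
  -- value 2v.
  have hg : ∫⁻ t, (∫⁻ p, k t p ∂(μ.prod μ) + ∫⁻ p, k t p ∂(ν.prod ν)) ∂θ ≤ 2 * v := by
    rw [lintegral_add_left (hmeas _ inferInstance), hswap _ inferInstance, hswap _ inferInstance,
      two_mul]
    exact add_le_add hμ hν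
  have hf : 2 * v ≤ ∫⁻ t, 2 * ∫⁻ p, k t p ∂(μ.prod ν) ∂θ := by
    rw [lintegral_const_mul _ (hmeas _ inferInstance), hswap _ inferInstance]
    gcongr
    exact hμν
  refine ae_eq_of_ae_le_of_lintegral_le hpos ?_
    ((hmeas _ inferInstance).add (hmeas _ inferInstance)).aemeasurable (hg.trans hf)
  exact ne_top_of_le_ne_top (ENNReal.mul_ne_top (by simp) hv) ((lintegral_mono_ae hpos).trans hg)

end Mixture

/-! ### Strict convexity on compact ultrametric spaces. -/

section Ultrametric

variable {Y : Type u} [MetricSpace Y] [IsUltrametricDist Y] [CompactSpace Y]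

variable (Y) in
-- Balls of a given radius are equal or disjoint, so every ball already occurs in a finite subcover.
theorem finite_closedBalls {r : ℝ} (hr : 0 < r) :
    {B : Set Y | ∃ x, B = Metric.closedBall x r}.Finite := by
  obtain ⟨t, -, ht⟩ := isCompact_univ.elim_nhds_subcover (fun x : Y => Metric.closedBall x r)
    fun x _ => Metric.closedBall_mem_nhds x hr
  refine (t.finite_toSet.image fun x => Metric.closedBall x r).subset ?_
  rintro B ⟨x, rfl⟩
  obtain ⟨y, hy, hxy⟩ := Set.mem_iUnion₂.mp (ht (Set.mem_univ x))
  exact ⟨y, hy, IsUltrametricDist.closedBall_eq_of_mem hxy⟩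

variable (Y) in
/-- The finite partition of a compact ultrametric space into balls of radius `r`. -/
def ballPartition {r : ℝ} (hr : 0 < r) : Finset (Set Y) := (finite_closedBalls Y hr).toFinset

theorem mem_ballPartition {r : ℝ} (hr : 0 < r) {B : Set Y} :
    B ∈ ballPartition Y hr ↔ ∃ x, B = Metric.closedBall x r :=
  (finite_closedBalls Y hr).mem_toFinset

variable [MeasurableSpace Y] [BorelSpace Y]

/-- Being at distance at most r is an equivalence relation whose classes are the balls. -/
theorem prod_dist_le_eq_sum {r : ℝ} (hr : 0 < r) (μ ν : Measure Y) [SFinite μ] [SFinite ν] :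
    (μ.prod ν) {p | dist p.1 p.2 ≤ r} = ∑ B ∈ ballPartition Y hr, μ B * ν B := by
  have h1 : {p : Y × Y | dist p.1 p.2 ≤ r} = ⋃ B ∈ ballPartition Y hr, B ×ˢ B := by
    ext ⟨x, y⟩
    simp only [Set.mem_ofPred_eq, Set.mem_iUnion, Set.mem_prod, exists_prop, mem_ballPartition]
    constructor
    · intro h
      exact ⟨_, ⟨y, rfl⟩, h, Metric.mem_closedBall_self hr.le⟩
    · rintro ⟨_, ⟨z, rfl⟩, hx, hy⟩
      rwa [IsUltrametricDist.closedBall_eq_of_mem hy] at hx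
  rw [h1, measure_biUnion_finset]
  · exact Finset.sum_congr rfl fun B _ => Measure.prod_prod B B
  · intro B hB C hC hBC
    obtain ⟨x, rfl⟩ := (mem_ballPartition hr).mp hB
    obtain ⟨y, rfl⟩ := (mem_ballPartition hr).mp hC
    rcases IsUltrametricDist.closedBall_eq_or_disjoint x y r with h | h
    · exact absurd h hBC
    · exact Set.disjoint_prod.mpr (Or.inl h)
  · intro B hB
    obtain ⟨x, rfl⟩ := (mem_ballPartition hr).mp hB
    exact Metric.isClosed_closedBall.measurableSet.prod Metric.isClosed_closedBall.measurableSet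

theorem sum_sq_sub_eq {ι : Type*} (s : Finset ι) (a b : ι → ℝ) :
    ∑ i ∈ s, (a i - b i) ^ 2 =
      (∑ i ∈ s, a i * a i + ∑ i ∈ s, b i * b i) - 2 * ∑ i ∈ s, a i * b i := by
  rw [← Finset.sum_add_distrib, Finset.mul_sum, ← Finset.sum_sub_distrib]
  exact Finset.sum_congr rfl fun i _ => by ring

theorem sum_sq_sub_measure {r : ℝ} (hr : 0 < r) (μ ν : Measure Y) [IsProbabilityMeasure μ]
    [IsProbabilityMeasure ν] :
    ∑ B ∈ ballPartition Y hr, (μ.real B - ν.real B) ^ 2 =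
      ((μ.prod μ).real {p | dist p.1 p.2 ≤ r} + (ν.prod ν).real {p | dist p.1 p.2 ≤ r}) -
        2 * (μ.prod ν).real {p | dist p.1 p.2 ≤ r} := by
  have h : ∀ (m n : Measure Y) [IsProbabilityMeasure m] [IsProbabilityMeasure n],
      (m.prod n).real {p | dist p.1 p.2 ≤ r} =
        ∑ B ∈ ballPartition Y hr, m.real B * n.real B := by
    intro m n _ _
    rw [Measure.real, prod_dist_le_eq_sum hr, ENNReal.toReal_sum fun B _ => by finiteness]
    exact Finset.sum_congr rfl fun B _ => ENNReal.toReal_mul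
  rw [sum_sq_sub_eq, h, h, h]

theorem ext_of_closedBall (μ ν : Measure Y) [IsProbabilityMeasure μ] [IsProbabilityMeasure ν]
    (h : ∀ δ > 0, ∃ r, 0 < r ∧ r < δ ∧ ∀ x : Y,
      μ (Metric.closedBall x r) = ν (Metric.closedBall x r)) : μ = ν := by
  -- Agreement is required for all centres at radius r, so that a ball may be recentred at any of
  -- its points. Intersecting balls are then nested, which gives a π-system.
  set C : Set (Set Y) := {B | ∃ x r, 0 < r ∧
    (∀ y, μ (Metric.closedBall y r) = ν (Metric.closedBall y r)) ∧ B = Metric.closedBall x r}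
  have hbasis : TopologicalSpace.IsTopologicalBasis C := by
    refine TopologicalSpace.isTopologicalBasis_of_isOpen_of_nhds ?_ ?_
    · rintro _ ⟨x, r, hr, -, rfl⟩
      exact IsUltrametricDist.isOpen_closedBall x hr.ne'
    · intro a U ha hU
      obtain ⟨δ, hδ, hball⟩ := Metric.isOpen_iff.mp hU a ha
      obtain ⟨r, hr, hrδ, hr2⟩ := h δ hδ
      exact ⟨_, ⟨a, r, hr, hr2, rfl⟩, Metric.mem_closedBall_self hr.le,
        (Metric.closedBall_subset_ball hrδ).trans hball⟩
  refine ext_of_generate_finite C ?_ ?_ ?_ (by simp)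
  · rw [BorelSpace.measurable_eq (α := Y), hbasis.borel_eq_generateFrom]
  · rintro _ ⟨x, r, hr, hr2, rfl⟩ _ ⟨y, s, hs, hs2, rfl⟩ ⟨z, hz1, hz2⟩
    rw [IsUltrametricDist.closedBall_eq_of_mem hz1, IsUltrametricDist.closedBall_eq_of_mem hz2]
    rcases le_total r s with hrs | hrs
    · rw [Set.inter_eq_left.mpr (Metric.closedBall_subset_closedBall hrs)]
      exact ⟨z, r, hr, hr2, rfl⟩
    · rw [Set.inter_eq_right.mpr (Metric.closedBall_subset_closedBall hrs)]
      exact ⟨z, s, hs, hs2, rfl⟩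
  · rintro _ ⟨x, r, -, hr2, rfl⟩
    exact hr2 x

/-- log(D/d) is the integral of dr/r over d ≤ r ≤ D. For fixed r the kernel 1[d ≤ r] has quadratic
form ∑ (μ(B) - ν(B))² over balls of radius r. Equality for almost every r gives equal ball masses at
arbitrarily small radii. -/
theorem strictlyConvexEnergy_of_isUltrametricDist {D : ℝ} (hD0 : 0 < D)
    (hD : ∀ x y : Y, dist x y ≤ D) : StrictlyConvexEnergy Y D := by
  intro μ ν _ _ v hv hμ hν hμν
  set k : ℝ → Y × Y → ℝ≥0∞ := fun r p =>
    {q : ℝ × (Y × Y) | dist q.2.1 q.2.2 ≤ q.1}.indicator (fun q => ENNReal.ofReal q.1⁻¹) (r, p)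
  have hset : MeasurableSet {q : ℝ × (Y × Y) | dist q.2.1 q.2.2 ≤ q.1} :=
    (isClosed_le (by fun_prop) (by fun_prop)).measurableSet
  have hk : Measurable (Function.uncurry k) := by
    change Measurable ({q : ℝ × (Y × Y) | dist q.2.1 q.2.2 ≤ q.1}.indicator _)
    exact Measurable.indicator (by fun_prop) hset
  have hmix : ∀ p : Y × Y, ∫⁻ r in Set.Ioc 0 D, k r p = logKer D p.1 p.2 := by
    intro p
    have h1 : ∀ r, k r p = (Set.Ici (dist p.1 p.2)).indicator (fun r => ENNReal.ofReal r⁻¹) r :=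
      fun r => rfl
    simp_rw [h1]
    rw [lintegral_indicator measurableSet_Ici, Measure.restrict_restrict measurableSet_Ici]
    by_cases h0 : dist p.1 p.2 = 0
    · rw [logKer, if_pos h0, h0, Set.inter_eq_right.mpr
        ((Set.Ioc_subset_Ioi_self).trans Set.Ioi_subset_Ici_self), lintegral_ofReal_inv_Ioc_zero hD0]
    · have hpos : 0 < dist p.1 p.2 := lt_of_le_of_ne dist_nonneg (Ne.symm h0)
      have h2 : Set.Ici (dist p.1 p.2) ∩ Set.Ioc 0 D = Set.Icc (dist p.1 p.2) D := by
        ext r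
        simp only [Set.mem_inter_iff, Set.mem_Ici, Set.mem_Ioc, Set.mem_Icc]
        exact ⟨fun h => ⟨h.1, h.2.2⟩, fun h => ⟨h.1, hpos.trans_le h.1, h.2⟩⟩
      rw [logKer, if_neg h0, h2, Measure.restrict_congr_set Ioc_ae_eq_Icc.symm,
        lintegral_ofReal_inv_Ioc_of_pos hpos (hD _ _)]
  have hint : ∀ (m : Measure (Y × Y)) [IsProbabilityMeasure m] (r : ℝ), 0 < r →
      ∫⁻ p, k r p ∂m = ENNReal.ofReal (r⁻¹ * m.real {p | dist p.1 p.2 ≤ r}) := by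
    intro m _ r hr
    have h1 : ∀ p, k r p =
        {p : Y × Y | dist p.1 p.2 ≤ r}.indicator (fun _ => ENNReal.ofReal r⁻¹) p := fun p => rfl
    simp_rw [h1]
    rw [lintegral_indicator_const (isClosed_le continuous_dist continuous_const).measurableSet,
      ENNReal.ofReal_mul (inv_nonneg.mpr hr.le), ofReal_measureReal]
  have hsum : ∀ r (hr : 0 < r), 2 * ∫⁻ p, k r p ∂(μ.prod ν) =
      ENNReal.ofReal (r⁻¹ * (2 * (μ.prod ν).real {p | dist p.1 p.2 ≤ r})) ∧
      ∫⁻ p, k r p ∂(μ.prod μ) + ∫⁻ p, k r p ∂(ν.prod ν) =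
        ENNReal.ofReal (r⁻¹ * ((μ.prod μ).real {p | dist p.1 p.2 ≤ r} +
          (ν.prod ν).real {p | dist p.1 p.2 ≤ r})) := by
    intro r hr
    rw [hint _ r hr, hint _ r hr, hint _ r hr]
    constructor
    · rw [← ENNReal.ofReal_ofNat, ← ENNReal.ofReal_mul (by norm_num)]
      congr 1
      ring
    · rw [← ENNReal.ofReal_add (by positivity) (by positivity), mul_add]
  have hpos : ∀ᵐ r ∂(volume.restrict (Set.Ioc 0 D)), 2 * ∫⁻ p, k r p ∂(μ.prod ν) ≤
      ∫⁻ p, k r p ∂(μ.prod μ) + ∫⁻ p, k r p ∂(ν.prod ν) := by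
    refine (ae_restrict_iff' measurableSet_Ioc).mpr (Eventually.of_forall fun r hr => ?_)
    rw [(hsum r hr.1).1, (hsum r hr.1).2]
    refine ENNReal.ofReal_le_ofReal (mul_le_mul_of_nonneg_left ?_ (inv_nonneg.mpr hr.1.le))
    have h1 := sum_sq_sub_measure hr.1 μ ν
    have h2 : 0 ≤ ∑ B ∈ ballPartition Y hr.1, (μ.real B - ν.real B) ^ 2 :=
      Finset.sum_nonneg fun _ _ => sq_nonneg _
    linarith
  have hae := ae_eq_of_mixture hk hmix μ ν hv hpos hμ hν hμν
  refine ext_of_closedBall μ ν fun δ hδ => ?_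
  have hsub : Set.Ioo 0 (min δ D) ⊆ Set.Ioc 0 D := fun r hr =>
    ⟨hr.1, (hr.2.trans_le (min_le_right _ _)).le⟩
  have hvol : volume (Set.Ioo 0 (min δ D)) ≠ 0 := by
    rw [Real.volume_Ioo, sub_zero]
    simpa using ⟨hδ, hD0⟩
  have : (ae (volume.restrict (Set.Ioo 0 (min δ D)))).NeBot := by
    rw [ae_neBot, Ne, Measure.restrict_eq_zero]
    exact hvol
  obtain ⟨r, hr, hr2⟩ :=
    ((ae_restrict_mem measurableSet_Ioo).and (ae_restrict_of_ae_restrict_of_subset hsub hae)).exists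
  refine ⟨r, hr.1, hr.2.trans_le (min_le_left _ _), fun x => ?_⟩
  rw [(hsum r hr.1).1, (hsum r hr.1).2, ENNReal.ofReal_eq_ofReal_iff
    (mul_nonneg (inv_nonneg.mpr hr.1.le) (by positivity))
    (mul_nonneg (inv_nonneg.mpr hr.1.le) (by positivity))] at hr2
  have h1 := mul_left_cancel₀ (inv_ne_zero hr.1.ne') hr2
  have h2 := sum_sq_sub_measure hr.1 μ ν
  rw [← h1, sub_self, Finset.sum_eq_zero_iff_of_nonneg fun _ _ => sq_nonneg _] at h2
  have h3 := h2 _ ((mem_ballPartition hr.1).mpr ⟨x, rfl⟩)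
  rw [sq_eq_zero_iff, sub_eq_zero] at h3
  exact (measureReal_eq_measureReal_iff).mp h3

end Ultrametric

/-! ### Strict convexity in Euclidean space via Gaussian kernels. -/

theorem integral_gaussian_prod_comm {V : Type u} [NormedAddCommGroup V] [MeasurableSpace V]
    {t : ℝ} (μ ν : Measure V) [SFinite μ] [SFinite ν] :
    ∫ p : V × V, Real.exp (-t * ‖p.1 - p.2‖ ^ 2) ∂(μ.prod ν) =
      ∫ p : V × V, Real.exp (-t * ‖p.1 - p.2‖ ^ 2) ∂(ν.prod μ) := by
  rw [← integral_prod_swap]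
  simp only [Prod.fst_swap, Prod.snd_swap, norm_sub_rev]

section Euclidean

variable {V : Type u} [NormedAddCommGroup V] [InnerProductSpace ℝ V] [FiniteDimensional ℝ V]
  [MeasurableSpace V] [BorelSpace V]

/-- The Fourier transform of a Gaussian, normalized to have total mass `1`. -/
theorem exists_gaussian_fourier {t : ℝ} (ht : 0 < t) :
    ∃ c b : ℝ, 0 < c ∧ 0 < b ∧ ∀ w : V,
      ∫ ξ : V, ((c * Real.exp (-b * ‖ξ‖ ^ 2) : ℝ) : ℂ) *
        Complex.exp (inner ℝ w ξ * Complex.I) = ((Real.exp (-t * ‖w‖ ^ 2) : ℝ) : ℂ) := by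
  -- The transform of exp(-b|ξ|²) is a multiple of exp(-|w|²/(4b)), so this b produces the exponent
  -- -t|w|².
  set b : ℝ := 1 / (4 * t)
  have hb : 0 < b := by positivity
  set a : ℝ := (Real.pi / b) ^ (Module.finrank ℝ V / 2 : ℝ)
  have ha : 0 < a := by positivity
  refine ⟨a⁻¹, b, inv_pos.mpr ha, hb, fun w => ?_⟩
  have h1 := GaussianFourier.integral_cexp_neg_mul_sq_norm_add (V := V) (b := (b : ℂ))
    (by simpa using hb) Complex.I w
  have h2 : ((Real.pi : ℂ) / b) ^ (Module.finrank ℝ V / 2 : ℂ) = (a : ℂ) := by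
    rw [Complex.ofReal_cpow (by positivity)]
    push_cast
    rfl
  have h3 : ∀ ξ : V, ((a⁻¹ * Real.exp (-b * ‖ξ‖ ^ 2) : ℝ) : ℂ) *
      Complex.exp (inner ℝ w ξ * Complex.I) =
        (a : ℂ)⁻¹ * Complex.exp (-b * ‖ξ‖ ^ 2 + Complex.I * inner ℝ w ξ) := fun ξ => by
    rw [Complex.exp_add]
    push_cast
    rw [mul_comm Complex.I]
    ring
  simp_rw [h3]
  rw [integral_const_mul, h1, h2, inv_mul_cancel_left₀ (by exact_mod_cast ha.ne')]
  push_cast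
  congr 1
  rw [Complex.I_sq]
  simp only [b]
  push_cast
  field_simp

/-- The energy of two probability measures for a Gaussian kernel, in terms of their
characteristic functions. -/
theorem integral_gaussian_prod {t c b : ℝ} (hb : 0 < b)
    (hw : ∀ w : V, ∫ ξ : V, ((c * Real.exp (-b * ‖ξ‖ ^ 2) : ℝ) : ℂ) *
        Complex.exp (inner ℝ w ξ * Complex.I) = ((Real.exp (-t * ‖w‖ ^ 2) : ℝ) : ℂ))
    (μ ν : Measure V) [IsProbabilityMeasure μ] [IsProbabilityMeasure ν] :
    ∫ p : V × V, ((Real.exp (-t * ‖p.1 - p.2‖ ^ 2) : ℝ) : ℂ) ∂(μ.prod ν) =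
      ∫ ξ : V, ((c * Real.exp (-b * ‖ξ‖ ^ 2) : ℝ) : ℂ) *
        (charFun μ ξ * starRingEnd ℂ (charFun ν ξ)) := by
  have hint : Integrable fun ξ : V => ((c * Real.exp (-b * ‖ξ‖ ^ 2) : ℝ) : ℂ) := by
    have h1 := (GaussianFourier.integrable_cexp_neg_mul_sq_norm_add (V := V) (b := (b : ℂ))
      (by simpa using hb) 0 0).const_mul (c : ℂ)
    refine h1.congr (Eventually.of_forall fun ξ => ?_)
    simp
  have h1 : ∀ ξ : V, charFun μ ξ * starRingEnd ℂ (charFun ν ξ) =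
      ∫ p : V × V, Complex.exp (inner ℝ (p.1 - p.2) ξ * Complex.I) ∂(μ.prod ν) := by
    intro ξ
    rw [← charFun_neg, charFun_apply, charFun_apply, ← integral_prod_mul]
    refine integral_congr_ae (Eventually.of_forall fun p => ?_)
    dsimp only
    rw [← Complex.exp_add, inner_sub_left, inner_neg_right]
    push_cast
    congr 1
    ring
  simp_rw [h1, ← integral_const_mul]
  rw [integral_integral_swap]
  · exact integral_congr_ae (Eventually.of_forall fun p => (hw (p.1 - p.2)).symm)
  · have h2 := hint.comp_fst (μ.prod ν)
    refine h2.mono (Continuous.aestronglyMeasurable (by fun_prop)) (Eventually.of_forall fun q => ?_)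
    change ‖_ * _‖ ≤ _
    rw [norm_mul, Complex.norm_exp_ofReal_mul_I, mul_one]

theorem integrable_gaussian_mul_charFun {c b : ℝ} (hb : 0 < b) (μ ν : Measure V)
    [IsProbabilityMeasure μ] [IsProbabilityMeasure ν] :
    Integrable fun ξ : V => ((c * Real.exp (-b * ‖ξ‖ ^ 2) : ℝ) : ℂ) *
      (charFun μ ξ * starRingEnd ℂ (charFun ν ξ)) := by
  have h1 : Integrable fun ξ : V => ((c * Real.exp (-b * ‖ξ‖ ^ 2) : ℝ) : ℂ) := by
    have h1 := (GaussianFourier.integrable_cexp_neg_mul_sq_norm_add (V := V) (b := (b : ℂ))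
      (by simpa using hb) 0 0).const_mul (c : ℂ)
    refine h1.congr (Eventually.of_forall fun ξ => ?_)
    simp
  refine h1.mono (Continuous.aestronglyMeasurable ?_) (Eventually.of_forall fun ξ => ?_)
  · have := continuous_charFun (μ := μ)
    have := continuous_charFun (μ := ν)
    fun_prop
  · rw [norm_mul, norm_mul, RCLike.norm_conj]
    exact mul_le_of_le_one_right (norm_nonneg _)
      (mul_le_one₀ (norm_charFun_le_one _) (norm_nonneg _) (norm_charFun_le_one _))

/-- A Gaussian is the Fourier transform of a positive Gaussian, so the energy of μ - ν is a weighted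
L² norm of the difference of characteristic functions. -/
theorem gaussian_energy_identity {t : ℝ} (ht : 0 < t) :
    ∃ c b : ℝ, 0 < c ∧ 0 < b ∧ ∀ (μ ν : Measure V) [IsProbabilityMeasure μ]
      [IsProbabilityMeasure ν],
      Integrable (fun ξ : V => c * Real.exp (-b * ‖ξ‖ ^ 2) * ‖charFun μ ξ - charFun ν ξ‖ ^ 2) ∧
      (∫ p : V × V, Real.exp (-t * ‖p.1 - p.2‖ ^ 2) ∂(μ.prod μ) +
        ∫ p : V × V, Real.exp (-t * ‖p.1 - p.2‖ ^ 2) ∂(ν.prod ν)) -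
          2 * ∫ p : V × V, Real.exp (-t * ‖p.1 - p.2‖ ^ 2) ∂(μ.prod ν) =
      ∫ ξ : V, c * Real.exp (-b * ‖ξ‖ ^ 2) * ‖charFun μ ξ - charFun ν ξ‖ ^ 2 := by
  obtain ⟨c, b, hc, hb, hw⟩ := exists_gaussian_fourier (V := V) ht
  refine ⟨c, b, hc, hb, fun μ ν _ _ => ?_⟩
  have hcast : ∀ (m n : Measure V) [IsProbabilityMeasure m] [IsProbabilityMeasure n],
      ((∫ p : V × V, Real.exp (-t * ‖p.1 - p.2‖ ^ 2) ∂(m.prod n) : ℝ) : ℂ) =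
      ∫ ξ : V, ((c * Real.exp (-b * ‖ξ‖ ^ 2) : ℝ) : ℂ) *
        (charFun m ξ * starRingEnd ℂ (charFun n ξ)) := fun m n _ _ => by
    rw [← integral_gaussian_prod hb hw m n, integral_complex_ofReal]
  have h1 := integrable_gaussian_mul_charFun (c := c) hb μ μ
  have h2 := integrable_gaussian_mul_charFun (c := c) hb ν ν
  have h3 := integrable_gaussian_mul_charFun (c := c) hb μ ν
  have h4 := integrable_gaussian_mul_charFun (c := c) hb ν μ
  have h5 : ∀ ξ : V, ((c * Real.exp (-b * ‖ξ‖ ^ 2) : ℝ) : ℂ) *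
        (charFun μ ξ * starRingEnd ℂ (charFun μ ξ)) +
      ((c * Real.exp (-b * ‖ξ‖ ^ 2) : ℝ) : ℂ) * (charFun ν ξ * starRingEnd ℂ (charFun ν ξ)) -
      (((c * Real.exp (-b * ‖ξ‖ ^ 2) : ℝ) : ℂ) * (charFun μ ξ * starRingEnd ℂ (charFun ν ξ)) +
      ((c * Real.exp (-b * ‖ξ‖ ^ 2) : ℝ) : ℂ) * (charFun ν ξ * starRingEnd ℂ (charFun μ ξ))) =
      ((c * Real.exp (-b * ‖ξ‖ ^ 2) * ‖charFun μ ξ - charFun ν ξ‖ ^ 2 : ℝ) : ℂ) := fun ξ => by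
    rw [← Complex.normSq_eq_norm_sq, Complex.ofReal_mul (c * _) (Complex.normSq _),
      ← Complex.mul_conj, map_sub]
    ring
  have h6 := (h1.add h2).sub (h3.add h4)
  constructor
  · refine (h6.congr (Eventually.of_forall h5)).re.congr (Eventually.of_forall fun ξ => ?_)
    exact Complex.ofReal_re _
  · apply Complex.ofReal_injective
    -- The two equal cross terms are written as (μ,ν) and (ν,μ), so that together they match the
    -- cross terms of |μ̂ - ν̂|².
    rw [two_mul, ← integral_complex_ofReal]
    nth_rw 4 [integral_gaussian_prod_comm]
    rw [Complex.ofReal_sub, Complex.ofReal_add, Complex.ofReal_add, hcast, hcast, hcast, hcast,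
      ← integral_add h1 h2, ← integral_add h3 h4]
    exact (integral_sub (h1.add h2) (h3.add h4)).symm.trans
      (integral_congr_ae (Eventually.of_forall h5))

theorem two_mul_gaussian_energy_le {t : ℝ} (ht : 0 < t) (μ ν : Measure V)
    [IsProbabilityMeasure μ] [IsProbabilityMeasure ν] :
    2 * ∫ p : V × V, Real.exp (-t * ‖p.1 - p.2‖ ^ 2) ∂(μ.prod ν) ≤
      ∫ p : V × V, Real.exp (-t * ‖p.1 - p.2‖ ^ 2) ∂(μ.prod μ) +
        ∫ p : V × V, Real.exp (-t * ‖p.1 - p.2‖ ^ 2) ∂(ν.prod ν) := by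
  obtain ⟨c, b, hc, hb, h⟩ := gaussian_energy_identity (V := V) ht
  rw [← sub_nonneg, (h μ ν).2]
  exact integral_nonneg fun ξ => by positivity

/-- A continuous nonnegative integrand with zero integral vanishes everywhere, and its Gaussian
factor is positive, so the characteristic functions agree. -/
theorem eq_of_gaussian_energy_eq {t : ℝ} (ht : 0 < t) (μ ν : Measure V)
    [IsProbabilityMeasure μ] [IsProbabilityMeasure ν]
    (heq : 2 * ∫ p : V × V, Real.exp (-t * ‖p.1 - p.2‖ ^ 2) ∂(μ.prod ν) =
      ∫ p : V × V, Real.exp (-t * ‖p.1 - p.2‖ ^ 2) ∂(μ.prod μ) +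
        ∫ p : V × V, Real.exp (-t * ‖p.1 - p.2‖ ^ 2) ∂(ν.prod ν)) : μ = ν := by
  obtain ⟨c, b, hc, hb, h⟩ := gaussian_energy_identity (V := V) ht
  obtain ⟨h1, h2⟩ := h μ ν
  rw [← heq, sub_self, eq_comm, integral_eq_zero_iff_of_nonneg (fun ξ => by positivity) h1] at h2
  have hμ := continuous_charFun (μ := μ)
  have hν := continuous_charFun (μ := ν)
  have h3 := (Continuous.ae_eq_iff_eq volume (by fun_prop) continuous_const).mp h2
  refine Measure.ext_of_charFun (funext fun ξ => ?_)
  have h4 : c * Real.exp (-b * ‖ξ‖ ^ 2) * ‖charFun μ ξ - charFun ν ξ‖ ^ 2 = 0 := congrFun h3 ξ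
  have h5 := (mul_eq_zero.mp h4).resolve_left (mul_pos hc (Real.exp_pos _)).ne'
  exact sub_eq_zero.mp (norm_eq_zero.mp (pow_eq_zero_iff two_ne_zero |>.mp h5))

theorem integral_Ioc_exp_neg_mul {t : ℝ} (ht : t ≠ 0) {a b : ℝ} (hab : a ≤ b) :
    ∫ s in Set.Ioc a b, Real.exp (-t * s) = t⁻¹ * (Real.exp (-t * a) - Real.exp (-t * b)) := by
  rw [← intervalIntegral.integral_of_le hab]
  have h : ∀ s : ℝ, HasDerivAt (fun s => -t⁻¹ * Real.exp (-t * s)) (Real.exp (-t * s)) s := by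
    intro s
    have h1 := (((hasDerivAt_id s).const_mul (-t)).exp).const_mul (-t⁻¹)
    refine h1.congr_deriv ?_
    field_simp
    simp
  rw [intervalIntegral.integral_eq_sub_of_hasDerivAt (fun s _ => h s)
    (Continuous.intervalIntegrable (by fun_prop) _ _)]
  ring

/-- Frullani's integral for the exponential function, including the divergent case. -/
theorem lintegral_frullani {a b : ℝ} (ha : 0 ≤ a) (hab : a ≤ b) :
    ∫⁻ t in Set.Ioi (0 : ℝ), ENNReal.ofReal (t⁻¹ * (Real.exp (-t * a) - Real.exp (-t * b))) =
      ∫⁻ s in Set.Ioc a b, ENNReal.ofReal s⁻¹ := by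
  have h1 : ∀ t ∈ Set.Ioi (0 : ℝ),
      ENNReal.ofReal (t⁻¹ * (Real.exp (-t * a) - Real.exp (-t * b))) =
        ∫⁻ s in Set.Ioc a b, ENNReal.ofReal (Real.exp (-t * s)) := fun t ht => by
    rw [← integral_Ioc_exp_neg_mul (ne_of_gt ht) hab, ofReal_integral_eq_lintegral_ofReal]
    · exact (Continuous.integrableOn_Ioc (by fun_prop))
    · exact Eventually.of_forall fun s => (Real.exp_pos _).le
  rw [setLIntegral_congr_fun measurableSet_Ioi h1, lintegral_lintegral_swap (by fun_prop)]
  refine setLIntegral_congr_fun measurableSet_Ioc fun s hs => ?_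
  have hs0 : 0 < s := ha.trans_lt hs.1
  rw [← ofReal_integral_eq_lintegral_ofReal]
  · congr 1
    simp_rw [neg_mul, mul_comm _ s, ← neg_mul]
    rw [integral_exp_mul_Ioi (neg_neg_of_pos hs0)]
    simp [neg_div, one_div]
  · simp_rw [neg_mul, mul_comm _ s, ← neg_mul]
    exact integrableOn_exp_mul_Ioi (neg_neg_of_pos hs0) 0
  · exact Eventually.of_forall fun t => (Real.exp_pos _).le

variable {Y : Type*} [MetricSpace Y] [SecondCountableTopology Y] [MeasurableSpace Y] [BorelSpace Y]

theorem integral_gaussian_map {f : Y → V} (hf : Isometry f) (t : ℝ) (μ ν : Measure Y)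
    [IsProbabilityMeasure μ] [IsProbabilityMeasure ν] :
    ∫ p : V × V, Real.exp (-t * ‖p.1 - p.2‖ ^ 2) ∂((μ.map f).prod (ν.map f)) =
      ∫ p : Y × Y, Real.exp (-t * dist p.1 p.2 ^ 2) ∂(μ.prod ν) := by
  have hm := hf.continuous.measurable
  rw [Measure.map_prod_map _ _ hm hm, integral_map (hm.prodMap hm).aemeasurable
    (Continuous.aestronglyMeasurable (by fun_prop))]
  simp only [Prod.map_fst, Prod.map_snd, ← dist_eq_norm, hf.dist_eq]

/-- Frullani's integral writes log(D/d) = ½ log(D²/d²) as a mixture of the kernels exp(-t d²) -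
exp(-t D²). The subtracted constants cancel between probability measures. Equality at a single t
already identifies the measures. -/
theorem strictlyConvexEnergy_of_isometry [CompactSpace Y] {f : Y → V} (hf : Isometry f) {D : ℝ} (hD0 : 0 < D)
    (hD : ∀ x y : Y, dist x y ≤ D) : StrictlyConvexEnergy Y D := by
  intro μ ν _ _ v hv hμ hν hμν
  have hm := hf.continuous.measurable
  have hμf : IsProbabilityMeasure (μ.map f) := Measure.isProbabilityMeasure_map hm.aemeasurable
  have hνf : IsProbabilityMeasure (ν.map f) := Measure.isProbabilityMeasure_map hm.aemeasurable
  set g : ℝ → Y × Y → ℝ := fun t p =>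
    t⁻¹ * (Real.exp (-t * dist p.1 p.2 ^ 2) - Real.exp (-t * D ^ 2)) / 2
  set k : ℝ → Y × Y → ℝ≥0∞ := fun t p => ENNReal.ofReal (g t p)
  have hk : Measurable (Function.uncurry k) := by
    have : Measurable fun q : ℝ × (Y × Y) =>
      ENNReal.ofReal (q.1⁻¹ * (Real.exp (-q.1 * dist q.2.1 q.2.2 ^ 2) - Real.exp (-q.1 * D ^ 2)) / 2) := by
      have hd : Measurable fun q : ℝ × (Y × Y) => dist q.2.1 q.2.2 :=
        Continuous.measurable (by fun_prop)
      fun_prop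
    exact this
  have hmix : ∀ p : Y × Y, ∫⁻ t in Set.Ioi 0, k t p = logKer D p.1 p.2 := by
    intro p
    have hsq : dist p.1 p.2 ^ 2 ≤ D ^ 2 := by
      have := hD p.1 p.2
      gcongr
    simp only [k, g, div_eq_mul_inv _ (2 : ℝ)]
    simp_rw [ENNReal.ofReal_mul' (show (0 : ℝ) ≤ 2⁻¹ by norm_num)]
    rw [lintegral_mul_const' _ _ ENNReal.ofReal_ne_top, lintegral_frullani (sq_nonneg _) hsq]
    by_cases h0 : dist p.1 p.2 = 0
    · rw [logKer, if_pos h0, h0, zero_pow two_ne_zero, lintegral_ofReal_inv_Ioc_zero (by positivity),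
        ENNReal.top_mul (by simp)]
    · have hpos : 0 < dist p.1 p.2 := lt_of_le_of_ne dist_nonneg (Ne.symm h0)
      rw [logKer, if_neg h0, lintegral_ofReal_inv_Ioc_of_pos (by positivity) hsq, ← div_pow,
        Real.log_pow, ← ENNReal.ofReal_mul' (by norm_num)]
      congr 1
      push_cast
      ring
  set G : Measure Y → Measure Y → ℝ → ℝ := fun m n t =>
    ∫ p : Y × Y, Real.exp (-t * dist p.1 p.2 ^ 2) ∂(m.prod n)
  have hg0 : ∀ t > 0, ∀ p, 0 ≤ g t p := fun t ht p => by
    have hsq : dist p.1 p.2 ^ 2 ≤ D ^ 2 := by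
      have := hD p.1 p.2
      gcongr
    have : Real.exp (-t * D ^ 2) ≤ Real.exp (-t * dist p.1 p.2 ^ 2) :=
      Real.exp_le_exp.mpr (by nlinarith)
    have := sub_nonneg.mpr this
    positivity
  have hexpint : ∀ (m n : Measure Y) [IsProbabilityMeasure m] [IsProbabilityMeasure n] (t : ℝ),
      0 < t → Integrable (fun p : Y × Y => Real.exp (-t * dist p.1 p.2 ^ 2)) (m.prod n) := by
    intro m n _ _ t ht
    refine Integrable.of_bound (C := 1) (Continuous.aestronglyMeasurable (by fun_prop))
      (Eventually.of_forall fun p => ?_)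
    rw [Real.norm_eq_abs, abs_of_pos (Real.exp_pos _), Real.exp_le_one_iff]
    nlinarith [sq_nonneg (dist p.1 p.2)]
  have hint : ∀ (m n : Measure Y) [IsProbabilityMeasure m] [IsProbabilityMeasure n] (t : ℝ),
      0 < t → 0 ≤ t⁻¹ * (G m n t - Real.exp (-t * D ^ 2)) / 2 ∧ ∫⁻ p, k t p ∂(m.prod n) =
        ENNReal.ofReal (t⁻¹ * (G m n t - Real.exp (-t * D ^ 2)) / 2) := by
    intro m n _ _ t ht
    have h1 := hexpint m n t ht
    have h2 : ∫ p, g t p ∂(m.prod n) = t⁻¹ * (G m n t - Real.exp (-t * D ^ 2)) / 2 := by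
      simp only [g]
      rw [integral_div, integral_const_mul, integral_sub h1 (integrable_const _), integral_const,
        probReal_univ, one_smul]
    rw [← h2]
    refine ⟨integral_nonneg (hg0 t ht), ?_⟩
    rw [ofReal_integral_eq_lintegral_ofReal]
    · exact ((h1.sub (integrable_const _)).const_mul _).div_const _
    · exact Eventually.of_forall (hg0 t ht)
  have hsum : ∀ t > 0, 2 * ∫⁻ p, k t p ∂(μ.prod ν) =
      ENNReal.ofReal (2 * (t⁻¹ * (G μ ν t - Real.exp (-t * D ^ 2)) / 2)) ∧
      ∫⁻ p, k t p ∂(μ.prod μ) + ∫⁻ p, k t p ∂(ν.prod ν) =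
        ENNReal.ofReal (t⁻¹ * (G μ μ t - Real.exp (-t * D ^ 2)) / 2 +
          t⁻¹ * (G ν ν t - Real.exp (-t * D ^ 2)) / 2) := by
    intro t ht
    rw [(hint μ ν t ht).2, (hint μ μ t ht).2, (hint ν ν t ht).2,
      ENNReal.ofReal_add (hint μ μ t ht).1 (hint ν ν t ht).1, ENNReal.ofReal_mul (by norm_num),
      ENNReal.ofReal_ofNat]
    exact ⟨rfl, rfl⟩
  have hpos : ∀ᵐ t ∂(volume.restrict (Set.Ioi (0 : ℝ))), 2 * ∫⁻ p, k t p ∂(μ.prod ν) ≤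
      ∫⁻ p, k t p ∂(μ.prod μ) + ∫⁻ p, k t p ∂(ν.prod ν) := by
    refine (ae_restrict_iff' measurableSet_Ioi).mpr (Eventually.of_forall fun t ht => ?_)
    rw [(hsum t ht).1, (hsum t ht).2]
    refine ENNReal.ofReal_le_ofReal ?_
    have h1 := two_mul_gaussian_energy_le ht (μ.map f) (ν.map f)
    rw [integral_gaussian_map hf, integral_gaussian_map hf, integral_gaussian_map hf] at h1
    have h2 : 0 < t⁻¹ := inv_pos.mpr ht
    have h3 := mul_le_mul_of_nonneg_left h1 h2.le
    simp only [G]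
    linarith
  have hae := ae_eq_of_mixture hk hmix μ ν hv hpos hμ hν hμν
  have : (ae (volume.restrict (Set.Ioi (0 : ℝ)))).NeBot := by
    rw [ae_neBot, Ne, Measure.restrict_eq_zero]
    simp
  obtain ⟨t, ht, ht2⟩ := ((ae_restrict_mem measurableSet_Ioi).and hae).exists
  have ht0 : 0 < t := ht
  rw [(hsum t ht).1, (hsum t ht).2, ENNReal.ofReal_eq_ofReal_iff
    (mul_nonneg two_pos.le (hint μ ν t ht).1)
    (add_nonneg (hint μ μ t ht).1 (hint ν ν t ht).1)] at ht2
  have h1 : 2 * G μ ν t = G μ μ t + G ν ν t := by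
    field_simp at ht2
    linarith
  have h2 : μ.map f = ν.map f := by
    refine eq_of_gaussian_energy_eq ht0 _ _ ?_
    rw [integral_gaussian_map hf, integral_gaussian_map hf, integral_gaussian_map hf]
    exact h1
  rw [← hf.isClosedEmbedding.measurableEmbedding.comap_map μ, h2,
    hf.isClosedEmbedding.measurableEmbedding.comap_map ν]

end Euclidean

/-! ### Embedding archimedean ℂ_v isometrically in ℂ. -/

section Archimedean

/-- The inverse is bounded because it is linear on a finite-dimensional space. Applying the bound to
w^n and taking n large removes the constant; inverses give the opposite inequality. -/
theorem norm_algEquiv_rclike {L : Type*} [NormedField L] [NormedAlgebra ℝ L] {𝕜 : Type*} [RCLike 𝕜]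
    (e : L ≃ₐ[ℝ] 𝕜) (z : L) : ‖e z‖ = ‖z‖ := by
  have hfd : FiniteDimensional ℝ L := e.symm.toLinearEquiv.finiteDimensional
  let e' : 𝕜 →L[ℝ] L := LinearMap.toContinuousLinearMap e.symm.toLinearMap
  have hle : ∀ w : 𝕜, ‖e.symm w‖ ≤ ‖w‖ := by
    intro w
    have hb : ∀ n : ℕ, ‖e.symm w‖ ^ n ≤ ‖e'‖ * ‖w‖ ^ n := fun n => by
      rw [← norm_pow, ← norm_pow, ← map_pow]
      exact e'.le_opNorm (w ^ n)
    by_contra! h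
    rcases (norm_nonneg w).eq_or_lt with h0 | h0
    · have := norm_eq_zero.mp h0.symm
      simp [this] at h
    have h1 : 1 < ‖e.symm w‖ / ‖w‖ := (one_lt_div h0).mpr h
    obtain ⟨n, hn⟩ := pow_unbounded_of_one_lt ‖e'‖ h1
    rw [div_pow, lt_div_iff₀ (by positivity)] at hn
    exact absurd (hb n) (not_le.mpr hn)
  rcases eq_or_ne z 0 with rfl | hz
  · simp
  refine le_antisymm ?_ (by simpa using hle (e z))
  have h1 := hle (e z⁻¹)
  rw [e.symm_apply_apply, map_inv₀, norm_inv, norm_inv] at h1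
  exact (inv_le_inv₀ (norm_pos_iff.mpr hz) (norm_pos_iff.mpr (by simpa using hz))).mp h1

/-- A complete normed field extending `ℚ` with its usual absolute value is a closed subfield of `ℂ`
(Ostrowski). -/
theorem exists_isometry_complex_of_norm_natCast {L : Type*} [NormedField L] [CompleteSpace L]
    (h : ∀ n : ℕ, ‖(n : L)‖ = n) : ∃ f : L → ℂ, Isometry f := by
  have hchar : CharZero L := by
    refine charZero_of_inj_zero fun n hn => ?_
    have := h n
    rw [hn, norm_zero] at this
    exact_mod_cast this.symm
  have hq : Isometry (Rat.castHom L) := by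
    refine AddMonoidHomClass.isometry_of_norm _ fun q => ?_
    have hz : ∀ m : ℤ, ‖(m : L)‖ = |(m : ℝ)| := fun m => by
      obtain ⟨n, rfl | rfl⟩ := m.eq_nat_or_neg <;> simp [h]
    rw [Rat.coe_castHom, Rat.cast_def, norm_div, hz, h, ← Rat.norm_cast_real, Real.norm_eq_abs,
      Rat.cast_def, abs_div, Nat.abs_cast]
  let i : ℚ →+* ℝ := Rat.castHom ℝ
  have hi : IsUniformInducing i := Rat.isUniformEmbedding_coe_real.isUniformInducing
  have hd : DenseRange i := Rat.denseRange_cast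
  -- Completeness extends the isometric embedding of ℚ to ℝ; Gelfand–Mazur then leaves only ℝ and ℂ.
  let r : ℝ →+* L := IsDenseInducing.extendRingHom hi hd hq.uniformContinuous
  have hdi : IsDenseInducing i := hi.isDenseInducing hd
  have hrq : ∀ q : ℚ, r q = q := fun q =>
    hdi.extend_eq_of_tendsto (hq.continuous.tendsto q |>.comp (hdi.nhds_eq_comap q).ge)
  have hrc : Continuous r := (uniformContinuous_uniformly_extend hi hd hq.uniformContinuous).continuous
  have hr : ∀ x : ℝ, ‖r x‖ = ‖x‖ := fun x => by
    refine hd.induction_on (p := fun x => ‖r x‖ = ‖x‖) x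
      (isClosed_eq (by fun_prop) (by fun_prop)) fun q => ?_
    change ‖r (q : ℝ)‖ = ‖(q : ℝ)‖
    rw [hrq]
    have := hq.norm_map_of_map_zero (map_zero _) q
    rw [Rat.norm_cast_real]
    exact this
  let : Algebra ℝ L := r.toAlgebra
  let : NormedAlgebra ℝ L := ⟨fun x y => by rw [Algebra.smul_def, norm_mul]; exact (congrArg (· * ‖y‖) (hr x)).le⟩
  rcases NormedAlgebra.Real.nonempty_algEquiv_or L with ⟨⟨e⟩⟩ | ⟨⟨e⟩⟩
  · exact ⟨_, Complex.isometry_ofReal.comp (AddMonoidHomClass.isometry_of_norm e (norm_algEquiv_rclike e))⟩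
  · exact ⟨_, AddMonoidHomClass.isometry_of_norm e (norm_algEquiv_rclike e)⟩

theorem Isometry.properSpace {X Y : Type*} [MetricSpace X] [CompleteSpace X] [MetricSpace Y]
    [ProperSpace Y] {f : X → Y} (hf : Isometry f) : ProperSpace X := by
  refine ⟨fun x r => ?_⟩
  rw [← hf.preimage_closedBall]
  exact hf.isClosedEmbedding.isCompact_preimage (isCompact_closedBall _ _)

end Archimedean

namespace ProductFormulaField

variable {K : Type u} [Field K] {Place : Type w} (P : ProductFormulaField K Place)

theorem exists_isometry_complex_Cv {v : Place} (hv : ¬ IsNonarchimedean (P.abv v)) :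
    ∃ f : P.Cv v → ℂ, Isometry f := by
  obtain ⟨σ, hσ⟩ := P.archimedean_embedding v hv
  refine exists_isometry_complex_of_norm_natCast fun n => ?_
  have h1 := P.norm_algebraMap_Cv v n
  rw [hσ, map_natCast, map_natCast, Complex.norm_natCast] at h1
  exact h1

end ProductFormulaField

/-! ### Points with small Green function lie near the filled Julia set. -/

theorem IsCompact.false_of_separated {X : Type*} [PseudoMetricSpace X] {F : Set X}
    (hF : IsCompact F) {u : ℕ → X} (hu : ∀ n, u n ∈ F) {r : ℝ} (hr : 0 < r)
    (hsep : ∀ m n, m < n → r ≤ dist (u m) (u n)) : False := by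
  obtain ⟨a, -, j, hj, hlim⟩ := hF.tendsto_subseq hu
  obtain ⟨N, hN⟩ := Metric.cauchySeq_iff.mp hlim.cauchySeq r hr
  exact absurd (hN N le_rfl (N + 1) N.le_succ) (not_lt.mpr (hsep _ _ (hj N.lt_succ_self)))

namespace Polynomial

variable {L : Type*} [NormedField L] {φ : L[X]}

/-- The defining limit is uniform, with error at most C/d^n. -/
theorem continuous_green (hφ : 2 ≤ φ.natDegree) : Continuous φ.green := by
  obtain ⟨C, hC0, hC⟩ := exists_abs_green_sub_posLog_le hφ
  have hd := two_le_natDegree_cast hφ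
  have hu : TendstoUniformly
      (fun (n : ℕ) (x : L) => ((φ.natDegree : ℝ) ^ n)⁻¹ * Real.posLog ‖(fun y => φ.eval y)^[n] x‖)
      φ.green atTop := by
    rw [Metric.tendstoUniformly_iff]
    intro ε hε
    have h1 : Tendsto (fun n : ℕ => ((φ.natDegree : ℝ) ^ n)⁻¹ * C) atTop (𝓝 (0 * C)) :=
      (tendsto_pow_atTop_atTop_of_one_lt (by linarith)).inv_tendsto_atTop.mul_const C
    rw [zero_mul] at h1
    filter_upwards [h1.eventually_lt_const hε] with n hn x
    refine lt_of_le_of_lt ?_ hn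
    have h2 := hC ((fun y => φ.eval y)^[n] x)
    rw [green_iterate hφ] at h2
    have h3 : φ.green x - ((φ.natDegree : ℝ) ^ n)⁻¹ * Real.posLog ‖(fun y => φ.eval y)^[n] x‖ =
        ((φ.natDegree : ℝ) ^ n)⁻¹ *
          (φ.natDegree ^ n * φ.green x - Real.posLog ‖(fun y => φ.eval y)^[n] x‖) := by
      field_simp
    rw [Real.dist_eq, h3, abs_mul, abs_of_pos (by positivity)]
    gcongr
  refine hu.continuous (Frequently.of_forall fun n => continuous_const.mul ?_)
  exact Real.continuous_posLog.comp ((φ.continuous.iterate n).norm)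

theorem exists_norm_le_of_green_le (hφ : 2 ≤ φ.natDegree) (B : ℝ) :
    ∃ R, ∀ x, φ.green x ≤ B → ‖x‖ ≤ R := by
  obtain ⟨C, hC0, hC⟩ := exists_abs_green_sub_posLog_le hφ
  refine ⟨Real.exp (B + C), fun x hx => ?_⟩
  rcases (norm_nonneg x).eq_or_lt with h0 | h0
  · rw [← h0]; positivity
  rw [← Real.log_le_iff_le_exp h0]
  have := (abs_le.mp (hC x)).1
  have h1 : Real.log ‖x‖ ≤ Real.posLog ‖x‖ := le_max_right _ _
  linarith

/-- Points at which the Green function is small are close to its zero set: proper case. -/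
theorem exists_infDist_lt_of_properSpace [ProperSpace L] (hφ : 2 ≤ φ.natDegree)
    {δ : ℝ} (hδ : 0 < δ) :
    ∃ η > 0, ∀ x, φ.green x < η → Metric.infDist x {z | φ.green z = 0} < δ := by
  obtain ⟨R, hR⟩ := exists_norm_le_of_green_le hφ 1
  -- On this compact set the Green function has a positive minimum, which serves as η.
  set T : Set L := {x | φ.green x ≤ 1 ∧ δ ≤ Metric.infDist x {z | φ.green z = 0}}
  have hT : IsCompact T := by
    refine Metric.isCompact_of_isClosed_isBounded ?_
      (isBounded_iff_forall_norm_le.mpr ⟨R, fun x hx => hR x hx.1⟩)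
    exact (isClosed_le (continuous_green hφ) continuous_const).inter
      (isClosed_le continuous_const (Metric.continuous_infDist_pt _))
  rcases T.eq_empty_or_nonempty with h0 | h0
  · refine ⟨1, one_pos, fun x hx => ?_⟩
    by_contra! h
    exact (h0 ▸ (show x ∈ T from ⟨hx.le, h⟩) : x ∈ (∅ : Set L))
  obtain ⟨y, hy, hmin⟩ := hT.exists_isMinOn h0 (continuous_green hφ).continuousOn
  have hy0 : 0 < φ.green y := by
    refine lt_of_le_of_ne (green_nonneg hφ y) fun h => ?_
    have h1 := hy.2
    rw [Metric.infDist_zero_of_mem (show y ∈ {z | φ.green z = 0} from h.symm)] at h1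
    linarith
  refine ⟨min 1 (φ.green y), lt_min one_pos hy0, fun x hx => ?_⟩
  by_contra! h
  have h1 : x ∈ T := ⟨(hx.trans_le (min_le_left _ _)).le, h⟩
  exact absurd (hx.trans_le (min_le_right _ _)) (not_lt.mpr (hmin h1))

theorem norm_eval_le_of_roots {p : L[X]} (hp : p.Splits) {x y : L}
    (h : ∀ r ∈ p.roots, ‖y - r‖ ≤ ‖x - r‖) : ‖p.eval y‖ ≤ ‖p.eval x‖ := by
  rw [hp.eval_eq_prod_roots, hp.eval_eq_prod_roots, norm_mul, norm_mul]
  refine mul_le_mul_of_nonneg_left ?_ (norm_nonneg _)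
  have h1 : ∀ z : L, ‖(p.roots.map fun r => z - r).prod‖ = (p.roots.map fun r => ‖z - r‖).prod :=
    fun z => (map_multiset_prod (normHom : L →*₀ ℝ) _).trans (by rw [Multiset.map_map]; rfl)
  rw [h1, h1]
  exact Multiset.prod_map_le_prod_map₀ _ _ (fun r _ => norm_nonneg _) h

/-- All roots r of φ^n = b are zeros of the Green function, so they are no closer to x than z is. By
the ultrametric inequality |y-r| ≤ |x-r|, and multiplying over the roots gives |φ^n(y)-b| ≤
|φ^n(x)-b|. -/
theorem green_le_of_mem_closedBall [IsUltrametricDist L] (hφ : 2 ≤ φ.natDegree) {b : L}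
    (hb : φ.green b = 0) (hsplit : ∀ n, (φ.comp^[n] X - C b).Splits) {x y z : L}
    (hx : ∀ r, φ.green r = 0 → dist x z ≤ dist x r) (hy : dist y z ≤ dist x z) :
    φ.green y ≤ φ.green x := by
  have hd := two_le_natDegree_cast hφ
  have heval : ∀ n w, (φ.comp^[n] X - C b).eval w = (fun t => φ.eval t)^[n] w - b := fun n w => by
    rw [eval_sub, eval_C, iterate_comp_eval, eval_X]
  have hle : ∀ n, ‖(fun t => φ.eval t)^[n] y - b‖ ≤ ‖(fun t => φ.eval t)^[n] x - b‖ := by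
    intro n
    rw [← heval, ← heval]
    refine norm_eval_le_of_roots (hsplit n) fun r hr => ?_
    have h1 : (fun t => φ.eval t)^[n] r = b := by
      rw [← sub_eq_zero, ← heval]
      exact (mem_roots'.mp hr).2
    have h2 : φ.green r = 0 := by
      have h3 := green_iterate hφ r n
      rw [h1, hb, eq_comm] at h3
      exact (mul_eq_zero.mp h3).resolve_left (by positivity)
    rw [← dist_eq_norm, ← dist_eq_norm]
    have h4 := hx r h2
    calc dist y r ≤ max (dist y z) (dist z r) := dist_triangle_max _ _ _
      _ ≤ max (dist y z) (max (dist z x) (dist x r)) := by gcongr; exact dist_triangle_max _ _ _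
      _ ≤ dist x r := by
        rw [dist_comm z x]
        exact max_le (hy.trans h4) (max_le h4 le_rfl)
  -- The cost of removing b from both sides; division by d^n makes it vanish.
  set B := Real.log 2 + Real.posLog (‖b‖ + ‖b‖)
  have h1 : ∀ n : ℕ, ((φ.natDegree : ℝ) ^ n)⁻¹ * Real.posLog ‖(fun t => φ.eval t)^[n] y‖ ≤
      ((φ.natDegree : ℝ) ^ n)⁻¹ * Real.posLog ‖(fun t => φ.eval t)^[n] x‖ +
        ((φ.natDegree : ℝ) ^ n)⁻¹ * B := by
    intro n
    rw [← mul_add]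
    gcongr
    have h2 : ‖(fun t => φ.eval t)^[n] y‖ ≤ ‖(fun t => φ.eval t)^[n] x‖ + (‖b‖ + ‖b‖) := by
      have h3 := norm_le_norm_sub_add ((fun t => φ.eval t)^[n] y) b
      have h4 := norm_sub_le ((fun t => φ.eval t)^[n] x) b
      linarith [hle n]
    have h3 := Real.posLog_le_posLog (norm_nonneg _) h2
    have h4 := Real.posLog_add (x := ‖(fun t => φ.eval t)^[n] x‖) (y := ‖b‖ + ‖b‖)
    simp only [B]
    linarith
  have h2 : Tendsto (fun n : ℕ => ((φ.natDegree : ℝ) ^ n)⁻¹ * B) atTop (𝓝 (0 * B)) :=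
    (tendsto_pow_atTop_atTop_of_one_lt (by linarith)).inv_tendsto_atTop.mul_const B
  have h3 := le_of_tendsto_of_tendsto' (tendsto_green hφ y) ((tendsto_green hφ x).add h2) h1
  simpa using h3

/-- Roots of π of different orders have distinct norms in [‖π‖, 1), so they are ‖π‖-separated; a
multiple by π^k moves them into any ball. -/
theorem not_isCompact_of_closedBall_subset [IsUltrametricDist L] {π : L} (hπ0 : π ≠ 0) (hπ1 : ‖π‖ < 1)
    (hroot : ∀ m : ℕ, 0 < m → ∃ y : L, y ^ m = π) {F : Set L} {z : L} {δ : ℝ} (hδ : 0 < δ)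
    (hsub : Metric.closedBall z δ ⊆ F) : ¬ IsCompact F := by
  intro hF
  have hπ : 0 < ‖π‖ := norm_pos_iff.mpr hπ0
  choose y hy using fun m : ℕ => hroot (m + 1) m.succ_pos
  have hnorm : ∀ m, ‖y m‖ ^ (m + 1) = ‖π‖ := fun m => by rw [← norm_pow, hy]
  have hy1 : ∀ m, ‖y m‖ < 1 := fun m => by
    by_contra! h
    have := one_le_pow₀ h (n := m + 1)
    rw [hnorm] at this
    linarith
  have hyπ : ∀ m, ‖π‖ ≤ ‖y m‖ := fun m => by
    rw [← hnorm m]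
    exact pow_le_of_le_one (norm_nonneg _) (hy1 m).le m.succ_ne_zero
  have hne : ∀ m n, m < n → ‖y m‖ ≠ ‖y n‖ := fun m n hmn h => by
    have h1 := hnorm m
    rw [← hnorm n, ← h] at h1
    have h2 := pow_lt_pow_right_of_lt_one₀ (hπ.trans_le (hyπ m)) (hy1 m) (Nat.add_lt_add_right hmn 1)
    linarith
  obtain ⟨k, hk⟩ := exists_pow_lt_of_lt_one hδ hπ1
  refine hF.false_of_separated (u := fun m => z + π ^ k * y m) (fun m => hsub ?_)
    (r := ‖π‖ ^ k * ‖π‖) (by positivity) fun m n hmn => ?_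
  · rw [Metric.mem_closedBall, dist_eq_norm, add_sub_cancel_left, norm_mul, norm_pow]
    have := mul_le_mul_of_nonneg_left (hy1 m).le (pow_nonneg hπ.le k)
    linarith
  · rw [dist_eq_norm, add_sub_add_left_eq_sub, ← mul_sub, norm_mul, norm_pow]
    gcongr
    rw [sub_eq_add_neg, IsUltrametricDist.norm_add_eq_max_of_norm_ne_norm (by rw [norm_neg]; exact hne m n hmn)]
    exact (hyπ m).trans (le_max_left _ _)

/-- Points at which the Green function is small are close to its zero set: ultrametric case. -/
theorem exists_infDist_lt_of_isUltrametricDist [IsUltrametricDist L] (hφ : 2 ≤ φ.natDegree) {b : L}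
    (hb : φ.green b = 0) (hsplit : ∀ n, (φ.comp^[n] X - C b).Splits)
    {π : L} (hπ0 : π ≠ 0) (hπ1 : ‖π‖ < 1)
    (hroot : ∀ m : ℕ, 0 < m → ∃ y : L, y ^ m = π) (hF : IsCompact {z | φ.green z = 0})
    {δ : ℝ} (hδ : 0 < δ) :
    ∃ η > 0, ∀ x, φ.green x < η → Metric.infDist x {z | φ.green z = 0} < δ := by
  by_contra! h
  choose x hx hxδ using fun k : ℕ => h (1 / ((k : ℝ) + 1)) (by positivity)
  choose z hzF hz using fun k => hF.exists_infDist_eq_dist ⟨b, hb⟩ (x k)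
  obtain ⟨a, ha, j, hj, hlim⟩ := hF.tendsto_subseq hzF
  -- The nearest points z_k accumulate at a. Any y within δ of a is, along the subsequence, within δ
  -- ≤ dist(x_k, z_k) of z_k, so its Green value is at most that of x_k, which tends to 0.
  refine not_isCompact_of_closedBall_subset hπ0 hπ1 hroot hδ (z := a) (fun y hy => ?_) hF
  refine le_antisymm ?_ (green_nonneg hφ y)
  have h1 : ∀ᶠ k in atTop, φ.green y ≤ 1 / ((j k : ℝ) + 1) := by
    filter_upwards [Metric.tendsto_nhds.mp hlim δ hδ] with k hk
    refine (green_le_of_mem_closedBall hφ hb hsplit (x := x (j k)) (z := z (j k))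
      (fun r hr => ?_) ?_).trans (hx (j k)).le
    · rw [← hz]
      exact Metric.infDist_le_dist_of_mem hr
    · rw [← hz]
      refine le_trans ?_ (hxδ (j k))
      refine (dist_triangle_max y a (z (j k))).trans (max_le hy ?_)
      rw [dist_comm]
      exact hk.le
  exact ge_of_tendsto (tendsto_one_div_add_atTop_nhds_zero_nat.comp hj.tendsto_atTop) h1

end Polynomial

/-! ### The filled Julia set at a place of K. -/

namespace ProductFormulaField

variable {K : Type u} [Field K] {Place : Type w} (P : ProductFormulaField K Place)
  (ι : ∀ v, AlgebraicClosure K →ₐ[K] P.Cv v) {φ : K[X]}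

theorem filledJulia_eq (hφ : 2 ≤ φ.natDegree) (v : Place) :
    P.filledJulia φ v = {z | (P.localPoly φ v).green z = 0} := by
  ext z
  rw [Set.mem_ofPred_eq, green_eq_zero_iff (P.two_le_natDegree_localPoly hφ v)]
  simp only [filledJulia, Set.mem_ofPred_eq, eval_localPoly]

/-- A fixed point of φ, found as a root of φ - X, has bounded orbit. -/
theorem exists_green_eq_zero (hφ : 2 ≤ φ.natDegree) (v : Place) :
    ∃ b : AlgebraicClosure K, (P.localPoly φ v).green (ι v b) = 0 := by
  have hdeg : (φ - X).degree ≠ 0 := by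
    have h1 : (X : K[X]).natDegree < φ.natDegree := lt_of_le_of_lt natDegree_X_le (by omega)
    have h2 := natDegree_sub_eq_left_of_natDegree_lt h1
    exact degree_ne_of_natDegree_ne (n := 0) (by omega)
  obtain ⟨b, hb⟩ := IsAlgClosed.exists_aeval_eq_zero (AlgebraicClosure K) _ hdeg
  rw [map_sub, aeval_X, sub_eq_zero] at hb
  refine ⟨b, (green_eq_zero_iff (P.two_le_natDegree_localPoly hφ v) _).mpr fun h => ?_⟩
  simp_rw [iterate_localPoly, Function.iterate_fixed (f := fun y => aeval y φ) hb] at h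
  exact not_tendsto_const_atTop _ _ h

/-- With b algebraic over K, the equation φ^n = b already splits over the algebraic closure of K, so
algebraic closedness of ℂ_v is not needed. -/
theorem splits_iterate_localPoly (v : Place) (b : AlgebraicClosure K) (n : ℕ) :
    ((P.localPoly φ v).comp^[n] X - C (ι v b)).Splits := by
  have h : (P.localPoly φ v).comp^[n] X - C (ι v b) =
      ((φ.map (algebraMap K (AlgebraicClosure K))).comp^[n] X - C b).map (ι v).toRingHom := by
    have h1 : (φ.map (algebraMap K (AlgebraicClosure K))).map (ι v).toRingHom =
        P.localPoly φ v := by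
      rw [Polynomial.map_map, localPoly]
      congr 1
      exact (ι v).comp_algebraMap
    have h2 : ∀ n, ((φ.map (algebraMap K (AlgebraicClosure K))).comp^[n] X).map (ι v).toRingHom =
        (P.localPoly φ v).comp^[n] X := by
      intro n
      induction n with
      | zero => simp
      | succ n ih => rw [Function.iterate_succ_apply', Function.iterate_succ_apply', map_comp, ih, h1]
    rw [Polynomial.map_sub, h2, map_C]
    rfl
  rw [h]
  exact (IsAlgClosed.splits _).map _

theorem norm_eq_one_of_trivial {v : Place} (hv : IsNonarchimedean (P.abv v))
    (htriv : ∀ x, P.abv v x ≤ 1) {z : AlgebraicClosure K} (hz : z ≠ 0) : ‖ι v z‖ = 1 := by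
  refine le_antisymm (P.norm_le_one_of_coeff ι hv fun i => htriv _) ?_
  have h := P.norm_le_one_of_coeff ι hv (z := z⁻¹) fun i => htriv _
  rw [map_inv₀, norm_inv] at h
  by_contra! hlt
  have hpos : 0 < ‖ι v z‖ := norm_pos_iff.mpr (by simpa using hz)
  exact absurd h (not_le.mpr ((one_lt_inv₀ hpos).mpr hlt))

/-- For a trivial absolute value the infinitely many points of the algebraic closure all lie in F at
mutual distance 1. -/
theorem exists_one_lt_of_isCompact (hφ : 2 ≤ φ.natDegree) {v : Place}
    (hv : IsNonarchimedean (P.abv v)) (hF : IsCompact (P.filledJulia φ v)) :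
    ∃ x, 1 < P.abv v x := by
  by_contra! htriv
  let ι : ∀ v, AlgebraicClosure K →ₐ[K] P.Cv v := fun w => (P.nonempty_embedding w).some
  have hinf : Infinite (AlgebraicClosure K) := IsAlgClosed.instInfinite
  let u := Infinite.natEmbedding (AlgebraicClosure K)
  refine hF.false_of_separated (u := fun n => ι v (u n)) (fun n => ?_) one_pos fun m n hmn => ?_
  · rw [filledJulia_eq P hφ, Set.mem_ofPred_eq, green_eq_zero_iff (P.two_le_natDegree_localPoly hφ v)]
    intro h
    obtain ⟨k, hk⟩ := (h.eventually_gt_atTop 1).exists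
    rw [iterate_localPoly] at hk
    exact absurd hk (not_lt.mpr (P.norm_le_one_of_coeff ι hv fun i => htriv _))
  · rw [dist_eq_norm, ← map_sub, norm_eq_one_of_trivial P ι hv htriv]
    exact sub_ne_zero.mpr fun h => hmn.ne (u.injective h)

/-- Points at which the local height is small are close to the filled Julia set. -/
theorem exists_infDist_filledJulia_lt (hφ : 2 ≤ φ.natDegree) (v : Place)
    (hF : IsCompact (P.filledJulia φ v)) {δ : ℝ} (hδ : 0 < δ) :
    ∃ η > 0, ∀ x, (P.localPoly φ v).green x < η → Metric.infDist x (P.filledJulia φ v) < δ := by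
  have hdeg := P.two_le_natDegree_localPoly hφ v
  by_cases hv : IsNonarchimedean (P.abv v)
  · have := P.isUltrametricDist_Cv hv
    obtain ⟨x, hx⟩ := P.exists_one_lt_of_isCompact hφ hv hF
    let ι : ∀ v, AlgebraicClosure K →ₐ[K] P.Cv v := fun w => (P.nonempty_embedding w).some
    obtain ⟨b, hb⟩ := P.exists_green_eq_zero ι hφ v
    have hx0 : x ≠ 0 := by
      rintro rfl
      rw [map_zero] at hx
      linarith
    rw [filledJulia_eq P hφ] at hF ⊢
    refine exists_infDist_lt_of_isUltrametricDist hdeg hb (P.splits_iterate_localPoly ι v b)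
      (π := ι v (algebraMap K _ x)⁻¹) ?_ ?_ (fun m hm => ?_) hF hδ
    · simpa using hx0
    · rw [map_inv₀, norm_inv, AlgHom.commutes, norm_algebraMap_Cv]
      exact inv_lt_one_of_one_lt₀ hx
    · obtain ⟨y, hy⟩ := IsAlgClosed.exists_pow_nat_eq (algebraMap K (AlgebraicClosure K) x)⁻¹ hm
      exact ⟨ι v y, by rw [← map_pow, hy]⟩
  · obtain ⟨f, hf⟩ := P.exists_isometry_complex_Cv hv
    have := hf.properSpace
    rw [filledJulia_eq P hφ]
    exact exists_infDist_lt_of_properSpace hdeg hδ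

theorem nonempty_filledJulia (hφ : 2 ≤ φ.natDegree) (v : Place) :
    (P.filledJulia φ v).Nonempty := by
  obtain ⟨b, hb⟩ := P.exists_green_eq_zero (fun w => (P.nonempty_embedding w).some) hφ v
  rw [filledJulia_eq P hφ]
  exact ⟨_, hb⟩

theorem isUltrametricDist_or_exists_isometry_Cv (v : Place) :
    IsUltrametricDist (P.Cv v) ∨ ∃ f : P.Cv v → ℂ, Isometry f := by
  by_cases hv : IsNonarchimedean (P.abv v)
  · exact .inl (P.isUltrametricDist_Cv hv)
  · exact .inr (P.exists_isometry_complex_Cv hv)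

end ProductFormulaField

theorem strictlyConvexEnergy_subtype {X : Type*} [MetricSpace X] [MeasurableSpace X] [BorelSpace X]
    (hX : IsUltrametricDist X ∨ ∃ f : X → ℂ, Isometry f) {F : Set X} (hF : IsCompact F) {D : ℝ}
    (hD0 : 0 < D) (hD : ∀ x y : F, dist x y ≤ D) : StrictlyConvexEnergy F D := by
  have := isCompact_iff_compactSpace.mp hF
  rcases hX with hX | ⟨f, hf⟩
  · exact strictlyConvexEnergy_of_isUltrametricDist hD0 hD
  · have : SecondCountableTopology F := inferInstance
    exact strictlyConvexEnergy_of_isometry (hf.comp isometry_subtype_coe) hD0 hD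

/-! ### Averages over finite sets -/

section average

variable {X Y : Type*} [MeasurableSpace Y]

/-- The average of the Dirac measures at the points `p z`, for `z` in `T`. -/
def averageDirac (T : Finset X) (p : X → Y) : Measure Y :=
  (T.card : ℝ≥0∞)⁻¹ • ∑ z ∈ T, Measure.dirac (p z)

theorem isProbabilityMeasure_averageDirac {T : Finset X} (hT : T.Nonempty) (p : X → Y) :
    IsProbabilityMeasure (averageDirac T p) := by
  refine ⟨?_⟩
  rw [averageDirac, Measure.smul_apply, Measure.finsetSum_apply]
  simp only [measure_univ, Finset.sum_const, nsmul_eq_mul, mul_one, smul_eq_mul]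
  exact ENNReal.inv_mul_cancel (by exact_mod_cast hT.card_pos.ne') (ENNReal.natCast_ne_top _)

theorem integral_averageDirac [MeasurableSingletonClass Y] (T : Finset X) (p : X → Y) (f : Y → ℝ) :
    ∫ y, f y ∂(averageDirac T p) = (T.card : ℝ)⁻¹ * ∑ z ∈ T, f (p z) := by
  rw [averageDirac, integral_smul_measure,
    integral_finsetSum_measure fun z _ => integrable_dirac (by simp)]
  simp only [integral_dirac, ENNReal.toReal_inv, ENNReal.toReal_natCast, smul_eq_mul]

theorem integral_prod_averageDirac [TopologicalSpace Y] [T1Space Y] [BorelSpace Y]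
    [SecondCountableTopology Y] {T : Finset X} (hT : T.Nonempty) (p : X → Y) (f : Y × Y →ᵇ ℝ) :
    ∫ q, f q ∂((averageDirac T p).prod (averageDirac T p)) =
      ((T.card : ℝ) ^ 2)⁻¹ * ∑ q ∈ T ×ˢ T, f (p q.1, p q.2) := by
  have := isProbabilityMeasure_averageDirac hT p
  rw [integral_prod _ (f.integrable _)]
  simp only [integral_averageDirac]
  rw [Finset.sum_product, Finset.mul_sum, Finset.mul_sum]
  refine Finset.sum_congr rfl fun z _ => ?_
  rw [sq, mul_inv, mul_assoc]

theorem integral_uniformDirac {X : Type*} [MetricSpace X] [MeasurableSpace X] [BorelSpace X]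
    (T : Finset X) (f : X → ℝ) : ∫ y, f y ∂(uniformDirac T) = (T.card : ℝ)⁻¹ * ∑ z ∈ T, f z :=
  integral_averageDirac T id f

end average

/-! ### Measures on a closed subset -/

theorem exists_eq_map_subtype_val {X : Type*} [MeasurableSpace X] {F : Set X}
    (hF : MeasurableSet F) (ν : Measure X)
    [IsProbabilityMeasure ν] (h : ν Fᶜ = 0) : ∃ ν' : Measure F, IsProbabilityMeasure ν' ∧ ν = ν'.map Subtype.val := by
  have h1 : ν = (ν.comap (Subtype.val : F → X)).map Subtype.val := by
    rw [map_comap_subtype_coe hF, Measure.restrict_eq_self_of_ae_mem]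
    exact mem_ae_iff.mpr h
  refine ⟨ν.comap Subtype.val, ⟨?_⟩, h1⟩
  have h2 : ν Set.univ = 1 := measure_univ
  rwa [h1, Measure.map_apply measurable_subtype_coe MeasurableSet.univ, Set.preimage_univ] at h2

section subtype

variable {X : Type u} [MetricSpace X] [MeasurableSpace X] {F : Set X}

theorem energy_map_subtype_val (hF : MeasurableSet F) (ν : Measure F) :
    energy (ν.map Subtype.val) = energy ν := by
  simp only [energy, (MeasurableEmbedding.subtype_coe hF).lintegral_map]
  rfl

theorem isEquilibriumMeasure_map_iff (hF : MeasurableSet F) {m : Measure F}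
    [IsProbabilityMeasure m] :
    IsEquilibriumMeasure F (m.map Subtype.val) ↔
      ∀ ν : Measure F, IsProbabilityMeasure ν → energy m ≤ energy ν := by
  have hnull : ∀ ν : Measure F, ν.map Subtype.val Fᶜ = 0 := fun ν => by
    rw [Measure.map_apply measurable_subtype_coe hF.compl]
    simp
  have hprob : ∀ ν : Measure F, IsProbabilityMeasure ν →
      IsProbabilityMeasure (ν.map Subtype.val) := fun ν _ =>
    Measure.isProbabilityMeasure_map measurable_subtype_coe.aemeasurable
  constructor
  · rintro ⟨-, -, h⟩ ν hν
    have := h _ (hprob ν hν) (hnull ν)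
    rwa [energy_map_subtype_val hF, energy_map_subtype_val hF] at this
  · intro h
    refine ⟨hprob m inferInstance, hnull m, fun ν hν hν0 => ?_⟩
    obtain ⟨ν', hν', rfl⟩ := exists_eq_map_subtype_val hF ν hν0
    rw [energy_map_subtype_val hF, energy_map_subtype_val hF]
    exact h ν' hν'

end subtype

/-! ### Equidistribution -/

section equidistribution

variable {X : Type u} [MetricSpace X] {F : Set X} {g : X → ℝ} {C : ℝ}

/-- Replacing points by nearby points of `F` does not increase the truncated energy by much. -/
theorem neg_log_max_dist_le (hg0 : ∀ x, 0 ≤ g x)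
    (hgrow : ∀ x y, x ≠ y → Real.log (dist x y) ≤ g x + g y + C) {p : X → X} {η δ r : ℝ} (hη : 0 < η)
    (hδ : 0 ≤ δ) (hr : 0 < r) (hp : ∀ x, g x < η → dist x (p x) ≤ δ) {x y : X} (hxy : x ≠ y) :
    -Real.log (max (dist (p x) (p y)) r) ≤ -Real.log (dist x y) + 2 * δ / r +
      (1 + (|C| + |Real.log r|) / η) * (g x + g y) := by
  have hM : 0 ≤ |C| + |Real.log r| := by positivity
  have hxg := hg0 x
  have hyg := hg0 y
  -- If both points are near F, the distance changes by at most 2δ, a factor 1 + 2δ/r after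
  -- truncation. Otherwise g x + g y ≥ η pays for C and log r.
  by_cases h : g x < η ∧ g y < η
  · have hm : 0 < max (dist (p x) (p y)) r := lt_max_of_lt_right hr
    have h1 : dist x y ≤ max (dist (p x) (p y)) r * (1 + 2 * δ / r) := by
      have h2 := dist_triangle4 x (p x) (p y) y
      have h3 := hp x h.1
      have h4 := hp y h.2
      rw [dist_comm y] at h4
      have h5 : 2 * δ ≤ max (dist (p x) (p y)) r * (2 * δ / r) := by
        rw [mul_div_assoc', le_div_iff₀ hr, mul_comm]
        exact mul_le_mul_of_nonneg_right (le_max_right _ _) (by positivity)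
      linarith [le_max_left (dist (p x) (p y)) r]
    have h2 : Real.log (dist x y) ≤ Real.log (max (dist (p x) (p y)) r) + 2 * δ / r := by
      refine (Real.log_le_log (dist_pos.mpr hxy) h1).trans ?_
      rw [Real.log_mul hm.ne' (by positivity)]
      have := Real.log_le_sub_one_of_pos (show 0 < 1 + 2 * δ / r by positivity)
      linarith
    have h3 : 0 ≤ (1 + (|C| + |Real.log r|) / η) * (g x + g y) := by positivity
    linarith
  · have h1 : η ≤ g x + g y := by
      by_contra! h2
      exact h ⟨by linarith, by linarith⟩
    have h2 : |C| + |Real.log r| ≤ (|C| + |Real.log r|) / η * (g x + g y) := by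
      rw [div_mul_eq_mul_div, le_div_iff₀ hη]
      gcongr
    have h3 : Real.log r ≤ Real.log (max (dist (p x) (p y)) r) :=
      Real.log_le_log hr (le_max_right _ _)
    have h4 := hgrow x y hxy
    have h5 := le_abs_self C
    have h6 := neg_abs_le (Real.log r)
    have h7 : 0 ≤ 2 * δ / r := by positivity
    linarith

/-- The pairwise comparison is summed over distinct pairs; the diagonal adds only |log r| per point,
negligible against N². -/
theorem sum_log_max_dist_le (hg0 : ∀ x, 0 ≤ g x)
    (hgrow : ∀ x y, x ≠ y → Real.log (dist x y) ≤ g x + g y + C) {p : X → X} {η δ r : ℝ} (hη : 0 < η)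
    (hδ : 0 ≤ δ) (hr : 0 < r) (hp : ∀ x, g x < η → dist x (p x) ≤ δ) (T : Finset X) :
    ∑ q ∈ T ×ˢ T, -Real.log (max (dist (p q.1) (p q.2)) r) ≤
      -∑ q ∈ T.offDiag, Real.log (dist q.1 q.2) + 2 * δ / r * T.card ^ 2 +
        2 * (1 + (|C| + |Real.log r|) / η) * T.card * ∑ x ∈ T, g x + |Real.log r| * T.card := by
  classical
  set A := 1 + (|C| + |Real.log r|) / η
  have hA : 0 ≤ A := by positivity
  have h7 : 0 ≤ 2 * δ / r := by positivity
  rw [← Finset.diag_union_offDiag, Finset.sum_union (Finset.disjoint_diag_offDiag T), Finset.sum_diag]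
  have h1 : ∑ x ∈ T, -Real.log (max (dist (p x) (p x)) r) ≤ |Real.log r| * T.card := by
    rw [mul_comm, ← nsmul_eq_mul]
    refine Finset.sum_le_card_nsmul _ _ _ fun x _ => ?_
    rw [dist_self, max_eq_right hr.le]
    exact neg_le_abs _
  have h2 : ∑ q ∈ T.offDiag, -Real.log (max (dist (p q.1) (p q.2)) r) ≤
      ∑ q ∈ T.offDiag, (-Real.log (dist q.1 q.2) + (2 * δ / r + A * (g q.1 + g q.2))) := by
    refine Finset.sum_le_sum fun q hq => ?_
    rw [← add_assoc]
    exact neg_log_max_dist_le hg0 hgrow hη hδ hr hp (Finset.mem_offDiag.mp hq).2.2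
  have h3 : ∑ q ∈ T.offDiag, (2 * δ / r + A * (g q.1 + g q.2)) ≤
      ∑ q ∈ T ×ˢ T, (2 * δ / r + A * (g q.1 + g q.2)) := by
    refine Finset.sum_le_sum_of_subset_of_nonneg ?_ fun q _ _ => ?_
    · rw [← Finset.diag_union_offDiag]
      exact Finset.subset_union_right
    · have := hg0 q.1
      have := hg0 q.2
      positivity
  have h4 : ∑ q ∈ T ×ˢ T, (2 * δ / r + A * (g q.1 + g q.2)) =
      2 * δ / r * T.card ^ 2 + 2 * A * T.card * ∑ x ∈ T, g x := by
    have h5 : ∑ q ∈ T ×ˢ T, g q.1 = T.card * ∑ x ∈ T, g x := by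
      simp only [Finset.sum_product, Finset.sum_const, nsmul_eq_mul, ← Finset.mul_sum]
    have h6 : ∑ q ∈ T ×ˢ T, g q.2 = T.card * ∑ x ∈ T, g x := by
      simp only [Finset.sum_product_right, Finset.sum_const, nsmul_eq_mul, ← Finset.mul_sum]
    rw [Finset.sum_add_distrib, ← Finset.mul_sum, Finset.sum_add_distrib, h5, h6, Finset.sum_const,
      Finset.card_product, nsmul_eq_mul]
    push_cast
    ring
  simp only [Finset.sum_add_distrib, Finset.sum_neg_distrib] at h1 h2 h3 h4 ⊢
  linarith

/-- A continuous function has nearly the same averages after replacing points by nearby points of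
a compact set. -/
theorem tendsto_average_sub (hF : IsCompact F) (hg0 : ∀ x, 0 ≤ g x)
    {p : X → X} (hpF : ∀ x, p x ∈ F)
    (hp : ∀ δ > 0, ∃ η > 0, ∀ x, g x < η → dist x (p x) < δ) {T : ℕ → Finset X}
    (hT : ∀ᶠ n in atTop, (T n).Nonempty)
    (hg : Tendsto (fun n => ((T n).card : ℝ)⁻¹ * ∑ x ∈ T n, g x) atTop (𝓝 0)) (f : X →ᵇ ℝ) :
    Tendsto (fun n => ((T n).card : ℝ)⁻¹ * ∑ x ∈ T n, f x -
      ((T n).card : ℝ)⁻¹ * ∑ x ∈ T n, f (p x)) atTop (𝓝 0) := by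
  rw [Metric.tendsto_nhds]
  intro ε hε
  have hu := hF.uniformContinuousAt_of_continuousAt f (fun a _ => f.continuous.continuousAt)
    (Metric.dist_mem_uniformity (half_pos hε))
  obtain ⟨δ, hδ, hδF⟩ := Metric.mem_uniformity_dist.mp hu
  obtain ⟨η, hη, hηp⟩ := hp δ hδ
  have hpt : ∀ x, |f x - f (p x)| ≤ ε / 2 + 2 * ‖f‖ / η * g x := by
    intro x
    have hx := hg0 x
    by_cases h : g x < η
    · have h1 : dist (p x) x < δ := by rw [dist_comm]; exact hηp x h
      have h2 : dist (f (p x)) (f x) < ε / 2 := hδF h1 (hpF x)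
      rw [dist_comm, Real.dist_eq] at h2
      have : 0 ≤ 2 * ‖f‖ / η * g x := by positivity
      linarith
    -- Far points are charged to g, whose average tends to 0.
    · have h1 : 2 * ‖f‖ ≤ 2 * ‖f‖ / η * g x := by
        rw [div_mul_eq_mul_div, le_div_iff₀ hη]
        have := not_lt.mp h
        gcongr
      have h2 := f.dist_le_two_norm x (p x)
      rw [Real.dist_eq] at h2
      linarith
  have hlim := hg.const_mul (2 * ‖f‖ / η)
  rw [mul_zero] at hlim
  filter_upwards [hT, hlim.eventually_lt_const (half_pos hε)] with n hn hlt
  have hcard : (0 : ℝ) < (T n).card := by exact_mod_cast hn.card_pos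
  rw [Real.dist_eq, sub_zero, ← mul_sub, ← Finset.sum_sub_distrib, abs_mul,
    abs_of_pos (inv_pos.mpr hcard)]
  calc ((T n).card : ℝ)⁻¹ * |∑ x ∈ T n, (f x - f (p x))|
      ≤ ((T n).card : ℝ)⁻¹ * ∑ x ∈ T n, (ε / 2 + 2 * ‖f‖ / η * g x) := by
        gcongr
        exact (Finset.abs_sum_le_sum_abs _ _).trans (Finset.sum_le_sum fun x _ => hpt x)
    _ = ε / 2 + 2 * ‖f‖ / η * (((T n).card : ℝ)⁻¹ * ∑ x ∈ T n, g x) := by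
        rw [Finset.sum_add_distrib, Finset.sum_const, ← Finset.mul_sum, nsmul_eq_mul]
        field_simp
    _ < ε := by linarith

end equidistribution

section equidistribution

variable {X : Type u} [MetricSpace X] [MeasurableSpace X] [BorelSpace X] {F : Set X}

/-- The truncated energies of the projected finite sets are asymptotically at most the minimal
energy. -/
theorem eventually_integral_truncatedKer_le [CompactSpace F] {g : X → ℝ} {C V : ℝ}
    (hg0 : ∀ x, 0 ≤ g x)
    (hgrow : ∀ x y, x ≠ y → Real.log (dist x y) ≤ g x + g y + C) {p : X → F}
    (hp : ∀ δ > 0, ∃ η > 0, ∀ x, g x < η → dist x (p x) < δ) {T : ℕ → Finset X}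
    (hcard : Tendsto (fun n => (T n).card) atTop atTop)
    (hg : Tendsto (fun n => ((T n).card : ℝ)⁻¹ * ∑ x ∈ T n, g x) atTop (𝓝 0))
    (hE : ∀ ε > 0, ∀ᶠ n in atTop, -∑ q ∈ (T n).offDiag, Real.log (dist q.1 q.2) ≤
      (V + ε) * (T n).card ^ 2) (D : ℝ) {r : ℝ} (hr : 0 < r) {ε : ℝ} (hε : 0 < ε) :
    ∀ᶠ n in atTop, ∫ q, truncatedKer D r hr q ∂((averageDirac (T n) p).prod (averageDirac (T n) p)) ≤
      Real.log D + V + ε := by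
  -- Then 2δ/r = ε/4; the discrete energy uses ε/2 and the vanishing terms the remaining ε/4.
  obtain ⟨η, hη, hηp⟩ := hp (ε * r / 8) (by positivity)
  set A := 2 * (1 + (|C| + |Real.log r|) / η)
  have hlim : Tendsto (fun n => A * (((T n).card : ℝ)⁻¹ * ∑ x ∈ T n, g x) +
      |Real.log r| * ((T n).card : ℝ)⁻¹) atTop (𝓝 (A * 0 + |Real.log r| * 0)) :=
    (hg.const_mul A).add
      ((tendsto_natCast_atTop_atTop.comp hcard).inv_tendsto_atTop.const_mul _)
  rw [mul_zero, mul_zero, add_zero] at hlim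
  filter_upwards [hcard.eventually_ge_atTop 1, hE (ε / 2) (half_pos hε),
    hlim.eventually_lt_const (show 0 < ε / 4 by positivity)] with n hn hEn hlt
  have hne : (T n).Nonempty := Finset.card_pos.mp hn
  have hc : (0 : ℝ) < (T n).card := by exact_mod_cast hn
  have h1 := sum_log_max_dist_le hg0 hgrow (p := fun x => (p x : X)) hη (by positivity) hr
    (fun x hx => (hηp x hx).le) (T n)
  rw [integral_prod_averageDirac hne, inv_mul_le_iff₀ (by positivity)]
  have h2 : ∑ q ∈ T n ×ˢ T n, truncatedKer D r hr (p q.1, p q.2) =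
      (T n).card ^ 2 * Real.log D +
        ∑ q ∈ T n ×ˢ T n, -Real.log (max (dist (p q.1 : X) (p q.2)) r) := by
    have h3 : ∀ q ∈ T n ×ˢ T n, truncatedKer D r hr (p q.1, p q.2) =
      Real.log D + -Real.log (max (dist (p q.1 : X) (p q.2)) r) := fun q _ => sub_eq_add_neg _ _
    rw [Finset.sum_congr rfl h3, Finset.sum_add_distrib, Finset.sum_const, Finset.card_product,
      nsmul_eq_mul]
    push_cast
    ring
  have h3 : A * (T n).card * ∑ x ∈ T n, g x + |Real.log r| * (T n).card =
      (T n).card ^ 2 * (A * (((T n).card : ℝ)⁻¹ * ∑ x ∈ T n, g x) +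
        |Real.log r| * ((T n).card : ℝ)⁻¹) := by
    field_simp
  have h4 : 2 * (ε * r / 8) / r = ε / 4 := by
    field_simp
    ring
  have h5 := mul_le_mul_of_nonneg_left hlt.le (sq_nonneg ((T n).card : ℝ))
  rw [h4] at h1
  rw [h2]
  linarith

/-- Finite sets of points with asymptotically minimal discrete energy, most of which are close to
the compact set `F`, are equidistributed with respect to the equilibrium measure of `F`. -/
theorem exists_isEquilibriumMeasure_and_isEquidistributed (hF : IsCompact F) (hFne : F.Nonempty)
    {g : X → ℝ} {C V : ℝ} (hg0 : ∀ x, 0 ≤ g x)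
    (hconc : ∀ δ > 0, ∃ η > 0, ∀ x, g x < η → Metric.infDist x F < δ)
    (hgrow : ∀ x y, x ≠ y → Real.log (dist x y) ≤ g x + g y + C)
    (hV : ∀ ε > 0, ∃ A : ℝ, ∀ (N : ℕ) (x : Fin N → F),
      ∏ i, ∏ j ∈ {i}ᶜ, dist (x j) (x i) ≤ Real.exp (-V * N ^ 2 + ε * N ^ 2 + A))
    (hconv : ∀ D, 0 < D → (∀ x y : F, dist x y ≤ D) → StrictlyConvexEnergy F D) {T : ℕ → Finset X}
    (hcard : Tendsto (fun n => (T n).card) atTop atTop)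
    (hg : Tendsto (fun n => ((T n).card : ℝ)⁻¹ * ∑ x ∈ T n, g x) atTop (𝓝 0))
    (hE : ∀ ε > 0, ∀ᶠ n in atTop, -∑ q ∈ (T n).offDiag, Real.log (dist q.1 q.2) ≤
      (V + ε) * (T n).card ^ 2) :
    ∃ μ : Measure X, IsEquilibriumMeasure F μ ∧
      (∀ ν : Measure X, IsEquilibriumMeasure F ν → ν = μ) ∧ IsEquidistributed T μ := by
  have hFc := isCompact_iff_compactSpace.mp hF
  have hFm : MeasurableSet F := hF.measurableSet
  have hFne' : Nonempty F := hFne.to_subtype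
  obtain ⟨D, hD1, hD⟩ : ∃ D, 1 ≤ D ∧ ∀ x y : F, dist x y ≤ D := by
    obtain ⟨D, hD⟩ := Metric.isBounded_iff.mp hF.isBounded
    exact ⟨max 1 D, le_max_left _ _, fun x y => (hD x.2 y.2).trans (le_max_right _ _)⟩
  have hD0 : 0 < D := by linarith
  have hex : ∀ x, ∃ y : F, Metric.infDist x F = dist x y := fun x => by
    obtain ⟨y, hy, h⟩ := hF.exists_infDist_eq_dist hFne x
    exact ⟨⟨y, hy⟩, h⟩
  choose p hp using hex
  have hpconc : ∀ δ > 0, ∃ η > 0, ∀ x, g x < η → dist x (p x) < δ := fun δ hδ => by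
    obtain ⟨η, hη, h⟩ := hconc δ hδ
    exact ⟨η, hη, fun x hx => hp x ▸ h x hx⟩
  have hTne : ∀ᶠ n in atTop, (T n).Nonempty :=
    (hcard.eventually_ge_atTop 1).mono fun n hn => Finset.card_pos.mp hn
  -- Empty sets receive an arbitrary Dirac mass; they occur only finitely often.
  have hm : ∀ n, ∃ m : ProbabilityMeasure F, (T n).Nonempty →
      (m : Measure F) = averageDirac (T n) p := fun n => by
    by_cases h : (T n).Nonempty
    · exact ⟨⟨_, isProbabilityMeasure_averageDirac h p⟩, fun _ => rfl⟩
    · exact ⟨⟨Measure.dirac hFne'.some, inferInstance⟩, fun h' => absurd h' h⟩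
  choose m hm using hm
  have hlow := le_logEnergy hD1 hD hV
  have hmin : ∀ (U : Ultrafilter ℕ) (μ : ProbabilityMeasure F), (U : Filter ℕ) ≤ atTop →
      Tendsto m U (𝓝 μ) → logEnergy D (μ : Measure F) μ ≤ ENNReal.ofReal (Real.log D + V) := by
    intro U μ hU hlim
    refine logEnergy_le_of_tendsto hD0 hD hlim fun r hr _ ε hε => hU ?_
    filter_upwards [hTne,
      eventually_integral_truncatedKer_le hg0 hgrow hpconc hcard hg hE D hr hε] with n hn h
    rwa [hm n hn]
  have huniq : ∀ μ ν : Measure F, ∀ [IsProbabilityMeasure μ] [IsProbabilityMeasure ν],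
      logEnergy D μ μ ≤ ENNReal.ofReal (Real.log D + V) →
      logEnergy D ν ν ≤ ENNReal.ofReal (Real.log D + V) → μ = ν := fun μ ν _ _ hμ hν =>
    (hconv D hD0 hD).eq_of_minimal ENNReal.ofReal_ne_top (fun m _ => hlow m) μ ν hμ hν
  have hcpt : ∀ U : Ultrafilter ℕ, ∃ μ : ProbabilityMeasure F, Tendsto m U (𝓝 μ) := fun U => by
    obtain ⟨μ, -, h⟩ := isCompact_univ.ultrafilter_le_nhds (U.map m) (by simp)
    exact ⟨μ, h⟩
  obtain ⟨μ₀, hμ₀lim⟩ := hcpt (Ultrafilter.of atTop)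
  have hμ₀ := hmin _ μ₀ (Ultrafilter.of_le atTop) hμ₀lim
  -- Probability measures on compact F form a compact space, and every ultrafilter limit is the same
  -- minimizer.
  have hlim : Tendsto m atTop (𝓝 μ₀) := by
    rw [tendsto_iff_ultrafilter]
    intro U hU
    obtain ⟨μ, hμ⟩ := hcpt U
    have h1 : μ = μ₀ := Subtype.ext (huniq μ μ₀ (hmin U μ hU hμ) hμ₀)
    rwa [h1] at hμ
  have hmineq : ∀ ν : Measure F, IsProbabilityMeasure ν → energy (μ₀ : Measure F) ≤ energy ν :=
    fun ν _ => (energy_le_energy_iff hD1 hD _ _).mpr (hμ₀.trans (hlow ν))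
  refine ⟨(μ₀ : Measure F).map Subtype.val, (isEquilibriumMeasure_map_iff hFm).mpr hmineq,
    fun ν hν => ?_, fun f => ?_⟩
  · have := hν.1
    obtain ⟨ν', hν', rfl⟩ := exists_eq_map_subtype_val hFm ν hν.2.1
    congr 1
    have h1 := (isEquilibriumMeasure_map_iff hFm).mp hν μ₀ inferInstance
    exact huniq ν' μ₀ (((energy_le_energy_iff hD1 hD _ _).mp h1).trans hμ₀) hμ₀
  · have h1 := tendsto_average_sub hF hg0 (fun x => (p x).2) hpconc hTne hg f
    have h2 := (ProbabilityMeasure.tendsto_iff_forall_integral_tendsto.mp hlim)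
      (f.compContinuous ⟨Subtype.val, continuous_subtype_val⟩)
    have h3 : ∫ x, f x ∂((μ₀ : Measure F).map Subtype.val) = ∫ y : F, f y ∂μ₀ :=
      (MeasurableEmbedding.subtype_coe hFm).integral_map _
    rw [h3]
    have h4 := h1.add h2
    rw [zero_add] at h4
    refine h4.congr' ?_
    filter_upwards [hTne] with n hn
    rw [integral_uniformDirac, hm n hn, integral_averageDirac]
    simp only [BoundedContinuousFunction.compContinuous_apply, ContinuousMap.coe_mk]
    ring

end equidistribution

namespace Polynomial

variable {L : Type*} [NormedField L] {φ : L[X]}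

theorem exists_log_dist_le_green_add_green (hφ : 2 ≤ φ.natDegree) :
    ∃ C, ∀ x y : L, x ≠ y → Real.log (dist x y) ≤ φ.green x + φ.green y + C := by
  obtain ⟨C, hC0, hC⟩ := exists_abs_green_sub_posLog_le hφ
  refine ⟨Real.log 2 + 2 * C, fun x y _ => ?_⟩
  have h1 : Real.log (dist x y) ≤ Real.posLog (dist x y) := le_max_right _ _
  have h2 : Real.posLog (dist x y) ≤ Real.posLog (‖x‖ + ‖y‖) :=
    Real.posLog_le_posLog dist_nonneg (by rw [dist_eq_norm]; exact norm_sub_le x y)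
  have h3 := Real.posLog_add (x := ‖x‖) (y := ‖y‖)
  have h4 := (abs_le.mp (hC x)).1
  have h5 := (abs_le.mp (hC y)).1
  linarith

theorem exists_prod_dist_le_of_green_eq_zero (hφ : 2 ≤ φ.natDegree) {ε : ℝ} (hε : 0 < ε) :
    ∃ A : ℝ, ∀ (N : ℕ) (x : Fin N → {z | φ.green z = 0}),
      ∏ i, ∏ j ∈ {i}ᶜ, dist (x j) (x i) ≤ Real.exp (-φ.robin * N ^ 2 + ε * N ^ 2 + A) := by
  obtain ⟨A, -, hA⟩ := exists_prod_norm_sub_le hφ hε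
  refine ⟨A, fun N x => ?_⟩
  have h1 := hA N fun i => (x i : L)
  have h2 : ∀ i, φ.green (x i) = 0 := fun i => (x i).2
  simp only [h2, Finset.sum_const_zero, mul_zero, zero_sub] at h1
  simp only [Subtype.dist_eq, dist_eq_norm]
  rwa [neg_mul]

end Polynomial

theorem Finset.sum_offDiag_map {α β M : Type*} [AddCommMonoid M]
    (S : Finset α) (e : α ↪ β) (f : β × β → M) :
    ∑ q ∈ (S.map e).offDiag, f q = ∑ q ∈ S.offDiag, f (e q.1, e q.2) := by
  have h : (S.map e).offDiag = S.offDiag.map (e.prodMap e) := by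
    ext ⟨x, y⟩
    simp only [Finset.mem_offDiag, Finset.mem_map, Function.Embedding.prodMap, Prod.exists,
      Function.Embedding.coeFn_mk, Prod.map_apply, Prod.mk.injEq]
    constructor
    · rintro ⟨⟨a, ha, rfl⟩, ⟨b, hb, rfl⟩, h⟩
      exact ⟨a, b, ⟨ha, hb, fun hab => h (hab ▸ rfl)⟩, rfl, rfl⟩
    · rintro ⟨a, b, ⟨ha, hb, h⟩, rfl, rfl⟩
      exact ⟨⟨a, ha, rfl⟩, ⟨b, hb, rfl⟩, e.injective.ne h⟩
  rw [h, Finset.sum_map]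
  rfl

/-- A uniformly separated set that is close to a compact set is finite. -/
theorem IsCompact.finite_of_separated {X : Type*} [MetricSpace X] {F Z : Set X} (hF : IsCompact F)
    (hFne : F.Nonempty) {c : ℝ} (hc : 0 < c) (hsep : ∀ x ∈ Z, ∀ y ∈ Z, x ≠ y → c ≤ dist x y)
    (hZ : ∀ x ∈ Z, Metric.infDist x F < c / 3) : Z.Finite := by
  by_contra hinf
  let u := Set.Infinite.natEmbedding Z hinf
  choose p hpF hp using fun n => hF.exists_infDist_eq_dist hFne (u n : X)
  -- Each projection moves a point by less than c/3, so projected points stay c/3 apart.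
  refine hF.false_of_separated hpF (show 0 < c / 3 by positivity) fun m n hmn => ?_
  have h1 := hsep _ (u m).2 _ (u n).2 fun h => hmn.ne (u.injective (Subtype.ext h))
  have h2 := dist_triangle4 (u m : X) (p m) (p n) (u n)
  have h3 := hZ _ (u m).2
  have h4 := hZ _ (u n).2
  rw [hp] at h3 h4
  rw [dist_comm (p n)] at h2
  linarith

/-! ### Cardinalities tend to infinity, and the conclusion. -/

namespace ProductFormulaField

variable {K : Type u} [Field K] {Place : Type w} (P : ProductFormulaField K Place)
  (ι : ∀ v, AlgebraicClosure K →ₐ[K] P.Cv v) {φ : K[X]}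

theorem isGaloisStable_union [DecidableEq (AlgebraicClosure K)]
    {S T : Finset (AlgebraicClosure K)} (hS : IsGaloisStable K S) (hT : IsGaloisStable K T) :
    IsGaloisStable K (S ∪ T) := fun σ z hz => by
  rw [Finset.mem_union] at hz ⊢
  exact hz.imp (hS σ z) (hT σ z)

/-- Total local heights are nonnegative, and dividing by the larger cardinality only decreases the
averages. -/
theorem canonicalHeight_union_le [DecidableEq (AlgebraicClosure K)] (hφ : 2 ≤ φ.natDegree)
    {S T : Finset (AlgebraicClosure K)} (hS : IsGaloisStable K S) (hT : IsGaloisStable K T) :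
    P.canonicalHeight ι φ (S ∪ T) ≤ P.canonicalHeight ι φ S + P.canonicalHeight ι φ T := by
  have hfin : (P.badPlaces φ ∪ ⋃ z ∈ S ∪ T, {v | 1 < ‖ι v z‖}).Finite :=
    (P.finite_badPlaces (ne_zero_of_two_le_natDegree hφ)).union
      ((S ∪ T).finite_toSet.biUnion fun z _ => P.finite_one_lt_norm ι z)
  have hW : ∀ R ⊆ S ∪ T, IsGaloisStable K R → P.canonicalHeight ι φ R = (R.card : ℝ)⁻¹ *
      ∑ z ∈ R, ∑ v ∈ hfin.toFinset, P.weight v * P.localHeight ι φ v z := fun R hR hRs => by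
    rw [P.canonicalHeight_eq ι hφ hRs hfin.toFinset (fun w hw => by simp [hw])
      (fun z hz w hw => by
        rw [Set.Finite.coe_toFinset]
        exact Or.inr (Set.mem_biUnion (hR hz) hw)), Finset.sum_comm]
    simp only [Finset.mul_sum, localHeight]
  have h0 : ∀ z, 0 ≤ ∑ v ∈ hfin.toFinset, P.weight v * P.localHeight ι φ v z := fun z =>
    Finset.sum_nonneg fun v _ => mul_nonneg (P.weight_pos v).le (P.localHeight_nonneg ι hφ v z)
  rw [hW _ subset_rfl (isGaloisStable_union hS hT), hW _ Finset.subset_union_left hS,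
    hW _ Finset.subset_union_right hT]
  set H := fun z => ∑ v ∈ hfin.toFinset, P.weight v * P.localHeight ι φ v z
  have hle : ∀ R ⊆ S ∪ T, ((S ∪ T).card : ℝ)⁻¹ * ∑ z ∈ R, H z ≤ (R.card : ℝ)⁻¹ * ∑ z ∈ R, H z := by
    intro R hR
    rcases R.eq_empty_or_nonempty with rfl | hne
    · simp
    · have h1 : (0 : ℝ) < R.card := by exact_mod_cast hne.card_pos
      have h2 : (R.card : ℝ) ≤ (S ∪ T).card := by exact_mod_cast Finset.card_le_card hR
      have h3 := Finset.sum_nonneg fun z (_ : z ∈ R) => h0 z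
      gcongr
  have h1 : ∑ z ∈ S ∪ T, H z ≤ ∑ z ∈ S, H z + ∑ z ∈ T, H z := by
    rw [← Finset.sum_union_inter]
    exact le_add_of_nonneg_right (Finset.sum_nonneg fun z _ => h0 z)
  calc ((S ∪ T).card : ℝ)⁻¹ * ∑ z ∈ S ∪ T, H z
      ≤ ((S ∪ T).card : ℝ)⁻¹ * (∑ z ∈ S, H z + ∑ z ∈ T, H z) := by gcongr
    _ ≤ _ := by
      rw [mul_add]
      exact add_le_add (hle S Finset.subset_union_left) (hle T Finset.subset_union_right)

theorem localHeight_le (hφ : 2 ≤ φ.natDegree) {S : Finset (AlgebraicClosure K)}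
    (hS : IsGaloisStable K S) (v : Place) {z : AlgebraicClosure K} (hz : z ∈ S) :
    P.localHeight ι φ v z ≤ S.card * P.canonicalHeight ι φ S / P.weight v := by
  rw [le_div_iff₀' (P.weight_pos v)]
  refine le_trans ?_ (P.weight_mul_sum_green_le ι hφ hS v)
  exact mul_le_mul_of_nonneg_left (Finset.single_le_sum
    (fun z _ => P.localHeight_nonneg ι hφ v z) hz) (P.weight_pos v).le

/-- In a Galois-stable set of bounded size and bounded height, distinct points are uniformly
separated. -/
theorem exists_le_norm_sub (hφ : 2 ≤ φ.natDegree) (v : Place) (B : ℕ) (M : ℝ) :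
    ∃ c > 0, ∀ S : Finset (AlgebraicClosure K), IsGaloisStable K S → S.card ≤ B →
      P.canonicalHeight ι φ S ≤ M → ∀ x ∈ S, ∀ y ∈ S, x ≠ y → c ≤ ‖ι v x - ι v y‖ := by
  classical
  obtain ⟨A, hA0, hA⟩ := P.exists_discreteEnergy_le ι hφ v one_pos
  obtain ⟨C, hC⟩ := exists_log_dist_le_green_add_green (P.two_le_natDegree_localPoly hφ v)
  have hw := P.weight_pos v
  -- G bounds log|x-y| above for every pair, so the other pairs cannot compensate for one very close
  -- pair in the energy bound.
  set G : ℝ := |2 * (B * |M| / P.weight v) + C|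
  set E : ℝ := (|(P.localPoly φ v).robin| + 2 / P.weight v * |M| + 1) * B ^ 2 + A + B ^ 2 * G
  refine ⟨Real.exp (-E), Real.exp_pos _, fun S hS hcard hM x hx y hy hxy => ?_⟩
  have hcard' : (S.card : ℝ) ≤ B := by exact_mod_cast hcard
  have hM' : P.canonicalHeight ι φ S ≤ |M| := hM.trans (le_abs_self M)
  have hloc : ∀ z ∈ S, P.localHeight ι φ v z ≤ B * |M| / P.weight v := fun z hz => by
    refine (P.localHeight_le ι hφ hS v hz).trans ?_
    have : S.card * P.canonicalHeight ι φ S ≤ B * |M| :=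
      (mul_le_mul_of_nonneg_left hM' (Nat.cast_nonneg _)).trans
        (mul_le_mul_of_nonneg_right hcard' (abs_nonneg M))
    gcongr
  have hG : ∀ p ∈ S.offDiag, Real.log ‖ι v p.1 - ι v p.2‖ ≤ G := fun p hp => by
    obtain ⟨h1, h2, h3⟩ := Finset.mem_offDiag.mp hp
    have h4 := hC (ι v p.1) (ι v p.2) ((ι v).injective.ne h3)
    rw [dist_eq_norm] at h4
    have h5 := hloc _ h1
    have h6 := hloc _ h2
    refine le_trans ?_ (le_abs_self _)
    rw [localHeight] at h5 h6
    linarith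
  have hmem : (x, y) ∈ S.offDiag := Finset.mem_offDiag.mpr ⟨hx, hy, hxy⟩
  have h1 := hA S hS
  rw [← Finset.add_sum_erase _ _ hmem] at h1
  have h2 : ∑ p ∈ S.offDiag.erase (x, y), Real.log ‖ι v p.1 - ι v p.2‖ ≤ B ^ 2 * G := by
    refine (Finset.sum_le_card_nsmul _ _ G fun p hp => hG p (Finset.mem_of_mem_erase hp)).trans ?_
    rw [nsmul_eq_mul]
    refine mul_le_mul_of_nonneg_right ?_ (abs_nonneg _)
    have h3 : (S.offDiag.erase (x, y)).card ≤ S.card ^ 2 := by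
      refine (Finset.card_le_card (Finset.erase_subset _ _)).trans ?_
      rw [Finset.offDiag_card, sq]
      exact Nat.sub_le _ _
    have h4 : ((S.offDiag.erase (x, y)).card : ℝ) ≤ (S.card : ℝ) ^ 2 := by exact_mod_cast h3
    exact h4.trans (by gcongr)
  have h3 : (P.localPoly φ v).robin * (S.card : ℝ) ^ 2 +
      2 / P.weight v * P.canonicalHeight ι φ S * S.card ^ 2 + 1 * S.card ^ 2 ≤
      (|(P.localPoly φ v).robin| + 2 / P.weight v * |M| + 1) * B ^ 2 := by
    rw [← add_mul, ← add_mul]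
    calc _ ≤ (|(P.localPoly φ v).robin| + 2 / P.weight v * |M| + 1) * (S.card : ℝ) ^ 2 := by
          gcongr
          exact le_abs_self _
      _ ≤ _ := by gcongr
  have hpos : 0 < ‖ι v x - ι v y‖ :=
    norm_pos_iff.mpr (sub_ne_zero.mpr ((ι v).injective.ne hxy))
  rw [← Real.le_log_iff_exp_le hpos]
  simp only [E]
  linarith

/-- The sizes of distinct Galois-stable sets with canonical heights tending to zero tend to
infinity. -/
theorem tendsto_card_atTop (hφ : 2 ≤ φ.natDegree) (v : Place)
    (hF : IsCompact (P.filledJulia φ v)) {S : ℕ → Finset (AlgebraicClosure K)}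
    (hS : Function.Injective S) (hGal : ∀ n, IsGaloisStable K (S n))
    (hht : Tendsto (fun n => P.canonicalHeight ι φ (S n)) atTop (𝓝 0)) :
    Tendsto (fun n => (S n).card) atTop atTop := by
  classical
  by_contra hnot
  simp only [tendsto_atTop, not_forall, not_eventually, not_le] at hnot
  obtain ⟨B, hB⟩ := hnot
  -- Separation is applied to unions of two sets, each of size below B and height below 1.
  obtain ⟨c, hc, hsep⟩ := P.exists_le_norm_sub ι hφ v (B + B) 2
  obtain ⟨η, hη, hconc⟩ := P.exists_infDist_filledJulia_lt hφ v hF (show 0 < c / 3 by positivity)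
  have hw := P.weight_pos v
  have hev : ∀ᶠ n in atTop, P.canonicalHeight ι φ (S n) < 1 ∧
      B * |P.canonicalHeight ι φ (S n)| / P.weight v < η := by
    refine (hht.eventually_lt_const one_pos).and ?_
    have h1 := (hht.abs.const_mul (B : ℝ)).div_const (P.weight v)
    rw [abs_zero, mul_zero, zero_div] at h1
    exact h1.eventually_lt_const hη
  have hinf := Nat.frequently_atTop_iff_infinite.mp (hB.and_eventually hev)
  set I : Set ℕ := {n | (S n).card < B ∧ P.canonicalHeight ι φ (S n) < 1 ∧
      B * |P.canonicalHeight ι φ (S n)| / P.weight v < η}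
  set Z : Set (AlgebraicClosure K) := ⋃ n ∈ I, (S n : Set (AlgebraicClosure K))
  have hZ : (ι v '' Z).Finite := by
    refine hF.finite_of_separated (P.nonempty_filledJulia hφ v) hc ?_ ?_
    · rintro _ ⟨x, hx, rfl⟩ _ ⟨y, hy, rfl⟩ hxy
      obtain ⟨m, hm, hxm⟩ := Set.mem_iUnion₂.mp hx
      obtain ⟨n, hn, hyn⟩ := Set.mem_iUnion₂.mp hy
      rw [dist_eq_norm]
      refine hsep (S m ∪ S n) (isGaloisStable_union (hGal m) (hGal n)) ?_ ?_ x
        (Finset.mem_union_left _ hxm) y (Finset.mem_union_right _ hyn) fun h => hxy (h ▸ rfl)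
      · exact (Finset.card_union_le _ _).trans (add_le_add hm.1.le hn.1.le)
      · have := P.canonicalHeight_union_le ι hφ (hGal m) (hGal n)
        linarith [hm.2.1, hn.2.1]
    · rintro _ ⟨x, hx, rfl⟩
      obtain ⟨m, hm, hxm⟩ := Set.mem_iUnion₂.mp hx
      refine hconc _ (lt_of_le_of_lt (P.localHeight_le ι hφ (hGal m) v hxm) (lt_of_le_of_lt ?_ hm.2.2))
      have h1 : ((S m).card : ℝ) ≤ B := by exact_mod_cast hm.1.le
      have h2 := le_abs_self (P.canonicalHeight ι φ (S m))
      have : ((S m).card : ℝ) * P.canonicalHeight ι φ (S m) ≤ B * |P.canonicalHeight ι φ (S m)| :=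
        (mul_le_mul_of_nonneg_left h2 (Nat.cast_nonneg _)).trans
          (mul_le_mul_of_nonneg_right h1 (abs_nonneg _))
      gcongr
  have hZ' : Z.Finite := hZ.of_finite_image (ι v).injective.injOn
  -- Infinitely many distinct S n would all be subsets of the finite set Z.
  refine hinf (Set.Finite.of_finite_image ((hZ'.toFinset.powerset.finite_toSet).subset ?_)
    (f := S) hS.injOn)
  rintro _ ⟨n, hn, rfl⟩
  rw [Finset.mem_coe, Finset.mem_powerset]
  intro x hx
  rw [Set.Finite.mem_toFinset]
  exact Set.mem_biUnion hn hx

theorem exists_equidistribution (hφ : 2 ≤ φ.natDegree) (v : Place)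
    (hF : IsCompact (P.filledJulia φ v)) {S : ℕ → Finset (AlgebraicClosure K)}
    (hS : Function.Injective S) (hGal : ∀ n, IsGaloisStable K (S n))
    (hht : Tendsto (fun n => P.canonicalHeight ι φ (S n)) atTop (𝓝 0)) :
    ∃ μ : Measure (P.Cv v),
      IsEquilibriumMeasure (P.filledJulia φ v) μ ∧
      (∀ ν : Measure (P.Cv v), IsEquilibriumMeasure (P.filledJulia φ v) ν → ν = μ) ∧
      IsEquidistributed (fun n => (S n).map ⟨ι v, (ι v).injective⟩) μ := by
  have hdeg := P.two_le_natDegree_localPoly hφ v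
  have hw := P.weight_pos v
  have hcard := P.tendsto_card_atTop ι hφ v hF hS hGal hht
  have hpos : ∀ᶠ n in atTop, (0 : ℝ) < (S n).card :=
    (hcard.eventually_ge_atTop 1).mono fun n hn => by exact_mod_cast hn
  obtain ⟨C, hC⟩ := exists_log_dist_le_green_add_green hdeg
  have hconc := fun δ (hδ : (0 : ℝ) < δ) => P.exists_infDist_filledJulia_lt hφ v hF hδ
  have hne := P.nonempty_filledJulia hφ v
  rw [filledJulia_eq P hφ] at hF hne hconc ⊢
  refine exists_isEquilibriumMeasure_and_isEquidistributed hF hne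
    (g := (P.localPoly φ v).green) (V := (P.localPoly φ v).robin) (green_nonneg hdeg) hconc hC
    (fun ε hε => exists_prod_dist_le_of_green_eq_zero hdeg hε)
    (fun D hD0 hD => strictlyConvexEnergy_subtype
      (P.isUltrametricDist_or_exists_isometry_Cv v) hF hD0 hD) ?_ ?_ fun ε hε => ?_
  · simpa only [Finset.card_map] using hcard
  · simp only [Finset.card_map, Finset.sum_map, Function.Embedding.coeFn_mk]
    have h1 := hht.div_const (P.weight v)
    rw [zero_div] at h1
    refine squeeze_zero' (Eventually.of_forall fun n => ?_) ?_ h1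
    · exact mul_nonneg (by positivity)
        (Finset.sum_nonneg fun z _ => P.localHeight_nonneg ι hφ v z)
    · filter_upwards [hpos] with n hn
      rw [inv_mul_le_iff₀ hn, mul_div_assoc', le_div_iff₀' hw]
      exact P.weight_mul_sum_green_le ι hφ (hGal n) v
  · obtain ⟨A, hA0, hA⟩ := P.exists_discreteEnergy_le ι hφ v (show 0 < ε / 3 by positivity)
    have h1 := hht.const_mul (2 / P.weight v)
    rw [mul_zero] at h1
    have h2 : Tendsto (fun n => A * ((S n).card : ℝ)⁻¹) atTop (𝓝 (A * 0)) :=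
      (tendsto_natCast_atTop_atTop.comp hcard).inv_tendsto_atTop.const_mul _
    rw [mul_zero] at h2
    filter_upwards [hpos, h1.eventually_lt_const (show 0 < ε / 3 by positivity),
      h2.eventually_lt_const (show 0 < ε / 3 by positivity), hcard.eventually_ge_atTop 1]
      with n hn hlt1 hlt2 hn1
    have hsum : ∑ q ∈ ((S n).map ⟨ι v, (ι v).injective⟩).offDiag, Real.log (dist q.1 q.2) =
        ∑ q ∈ (S n).offDiag, Real.log ‖ι v q.1 - ι v q.2‖ := by
      rw [Finset.sum_offDiag_map]
      simp only [Function.Embedding.coeFn_mk, dist_eq_norm]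
    rw [hsum, Finset.card_map]
    refine (hA (S n) (hGal n)).trans ?_
    -- The additive constant is absorbed because the cardinality tends to infinity.
    have h3 : A ≤ ε / 3 * (S n).card ^ 2 := by
      rw [← div_eq_mul_inv, div_lt_iff₀ hn] at hlt2
      refine hlt2.le.trans ?_
      have : ((S n).card : ℝ) ≤ (S n).card ^ 2 := le_self_pow₀ (by exact_mod_cast hn1) two_ne_zero
      gcongr
    have h4 := mul_le_mul_of_nonneg_right hlt1.le (sq_nonneg ((S n).card : ℝ))
    linarith

end ProductFormulaField

end

theorem mainTheorem6 {K : Type*} [Field K] {Place : Type*} (P : ProductFormulaField K Place)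
    (ι : ∀ v : Place, AlgebraicClosure K →ₐ[K] P.Cv v) (hK : P.Northcott ι)
    (φ : K[X]) (hφ : 2 ≤ φ.natDegree)
    (v : Place) (hF : IsCompact (P.filledJulia φ v))
    (S : ℕ → Finset (AlgebraicClosure K)) (hS : Function.Injective S)
    (hGal : ∀ n, IsGaloisStable K (S n))
    (hht : Tendsto (fun n => P.canonicalHeight ι φ (S n)) atTop (𝓝 0)) :
    ∃ μ : Measure (P.Cv v),
      IsEquilibriumMeasure (P.filledJulia φ v) μ ∧
      (∀ ν : Measure (P.Cv v), IsEquilibriumMeasure (P.filledJulia φ v) ν → ν = μ) ∧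
      IsEquidistributed (fun n => (S n).map ⟨ι v, (ι v).injective⟩) μ := by
  exact P.exists_equidistribution ι hφ v hF hS hGal hht
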